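/- Let $\mathbb H^2$ be the hyperbolic plane of curvature $-1$, let $M$ be a connected smooth surface (without boundary), and let $f:M\to\mathbb H^2\times\mathbb R$ be a smooth immersion such that $M$ is complete for the metric induced by $f$. Suppose that the Gaussian (intrinsic) curvature of $M$ and its extrinsic curvature (the product of its principal curvatures) both vanish identically. Let $P\subset M$ be the set of planar points, that is, of the points at which all the principal curvatures are zero, and let $P_0$ be a connected component of $P$. Then $f$ maps $P_0$ homeomorphically onto its image, and there are a unit-speed geodesic $\gamma:\mathbb R\to\mathbb H^2$ and $a,b\in[-\infty,\infty]$ with $a\le b$ such that $$f(\operatorname{int}P_0)=\gamma\big((a,b)\big)\times\mathbb R,\qquad f(\partial P_0)=\gamma\big(\{a,b\}\cap\mathbb R\big)\times\mathbb R,$$ where the interior and the boundary are taken in $M$. Thus the interior of $P_0$ is the product of an open arc of geodesic of $\mathbb H^2$ with $\mathbb R$, and its boundary consists of the two vertical lines $\gamma(a)\times\mathbb R$ and $\gamma(b)\times\mathbb R$; an infinite endpoint contributes no line, and if $a=b$ then the interior is empty and $P_0$ is the single line $\gamma(a)\times\mathbb R$. -/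

import Mathlib

open scoped Manifold ContDiff UpperHalfPlane InnerProductSpace Bundle

noncomputable section

namespace HypProd

/-! The hyperbolic plane `ℍ²` is the upper half-plane `ℍ` with the Poincaré metric
`(dx² + dy²) / y²` of curvature `-1`; the ambient space is the Riemannian product `ℍ × ℝ`, an open
subset of `ℂ × ℝ` whose tangent spaces are all identified with `ℂ × ℝ`. -/

/-- The coordinate plane in which charts of surfaces take values. -/
abbrev E2 : Type := EuclideanSpace ℝ (Fin 2)

/-- The inclusion of `ℍ × ℝ` in `ℂ × ℝ`, used as a global chart. -/
def coord (q : ℍ × ℝ) : ℂ × ℝ := ((q.1 : ℂ), q.2)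

/-- The product metric `(dx² + dy²) / y² + dt²` at the point `q = (x + i y, t)`. -/
def ambientInner (q v w : ℂ × ℝ) : ℝ :=
  (v.1.re * w.1.re + v.1.im * w.1.im) / q.1.im ^ 2 + v.2 * w.2

/-- The Christoffel symbols of the Levi-Civita connection of the product metric, as a symmetric
bilinear map: `Γ(v, w)` has `x`-component `-(v_x w_y + v_y w_x) / y`, `y`-component
`(v_x w_x - v_y w_y) / y` and `t`-component `0`. -/
def christoffel (q v w : ℂ × ℝ) : ℂ × ℝ :=
  (Complex.I * v.1 * w.1 / (q.1.im : ℂ), 0)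

/-- A vector orthogonal at `q` to both `v` and `w` (their cross product for the product metric). -/
def crossNormal (q v w : ℂ × ℝ) : ℂ × ℝ :=
  (⟨v.1.im * w.2 - v.2 * w.1.im, v.2 * w.1.re - v.1.re * w.2⟩,
    (v.1.re * w.1.im - v.1.im * w.1.re) / q.1.im ^ 2)

/-- The unit normal at `q` to the plane spanned by two independent vectors `v` and `w`. -/
def unitNormal (q v w : ℂ × ℝ) : ℂ × ℝ :=
  (Real.sqrt (ambientInner q (crossNormal q v w) (crossNormal q v w)))⁻¹ • crossNormal q v w

/-- The `i`-th partial derivative of a function on the coordinate plane. -/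
def pd {V : Type*} [NormedAddCommGroup V] [NormedSpace ℝ V] (i : Fin 2) (F : E2 → V) (x : E2) : V :=
  fderiv ℝ F x (EuclideanSpace.single i 1)

/-- For a parametrized surface `X`, the ambient covariant derivative `D_{∂ᵢ} (∂ⱼ X)`. -/
def covDeriv (X : E2 → ℂ × ℝ) (i j : Fin 2) (x : E2) : ℂ × ℝ :=
  pd i (pd j X) x + christoffel (X x) (pd i X x) (pd j X x)

/-- The coefficients `hᵢⱼ = ⟨D_{∂ᵢ} (∂ⱼ X), N⟩` of the second fundamental form of a parametrized
surface `X`, with respect to the unit normal `N` given by the parametrization. -/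
def secondForm (X : E2 → ℂ × ℝ) (x : E2) : Matrix (Fin 2) (Fin 2) ℝ :=
  Matrix.of fun i j =>
    ambientInner (X x) (covDeriv X i j x) (unitNormal (X x) (pd 0 X x) (pd 1 X x))

/-- The Gaussian curvature of the metric `E du² + 2 F du dv + G dv²`, computed from
`E = g 0 0`, `F = g 0 1`, `G = g 1 1` and their derivatives (Brioschi's formula). -/
def brioschi (g : E2 → Matrix (Fin 2) (Fin 2) ℝ) (x : E2) : ℝ :=
  let E : E2 → ℝ := fun y => g y 0 0
  let F : E2 → ℝ := fun y => g y 0 1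
  let G : E2 → ℝ := fun y => g y 1 1
  (Matrix.det
      !![-(pd 1 (pd 1 E) x) / 2 + pd 0 (pd 1 F) x - pd 0 (pd 0 G) x / 2,
           pd 0 E x / 2, pd 0 F x - pd 1 E x / 2;
         pd 1 F x - pd 0 G x / 2, E x, F x;
         pd 1 G x / 2, F x, G x]
    - Matrix.det
      !![0, pd 1 E x / 2, pd 0 G x / 2;
         pd 1 E x / 2, E x, F x;
         pd 0 G x / 2, F x, G x]) / (E x * G x - F x ^ 2) ^ 2

section Surface

variable {M : Type*} [TopologicalSpace M] [ChartedSpace E2 M]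

/-- The matrix of the Riemannian metric of `M` at the point with coordinates `x`, in the coordinate
system of `M` around `p`. -/
def chartMetric [Bundle.RiemannianBundle (fun p : M => TangentSpace (𝓡 2) p)] (p : M) (x : E2) :
    Matrix (Fin 2) (Fin 2) ℝ :=
  Matrix.of fun i j =>
    ⟪mfderiv 𝓘(ℝ, E2) (𝓡 2) (extChartAt (𝓡 2) p).symm x (EuclideanSpace.single i (1 : ℝ)),
      mfderiv 𝓘(ℝ, E2) (𝓡 2) (extChartAt (𝓡 2) p).symm x (EuclideanSpace.single j (1 : ℝ))⟫_ℝ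

/-- The (intrinsic) Gaussian curvature of the Riemannian surface `M` at `p`. -/
def gaussianCurvature [Bundle.RiemannianBundle (fun p : M => TangentSpace (𝓡 2) p)] (p : M) : ℝ :=
  brioschi (chartMetric p) (extChartAt (𝓡 2) p p)

/-- `f` is a smooth isometric immersion of the Riemannian surface `M` in `ℍ × ℝ`, that is, the
Riemannian metric of `M` is the one induced by `f`. -/
structure IsIsometricImmersion [Bundle.RiemannianBundle (fun p : M => TangentSpace (𝓡 2) p)]
    (f : M → ℍ × ℝ) : Prop where
  smooth : ContMDiff (𝓡 2) 𝓘(ℝ, ℂ × ℝ) ∞ (coord ∘ f)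
  isometric : ∀ (p : M) (v w : TangentSpace (𝓡 2) p),
    ⟪v, w⟫_ℝ = ambientInner (coord (f p))
      (mfderiv (𝓡 2) 𝓘(ℝ, ℂ × ℝ) (coord ∘ f) p v) (mfderiv (𝓡 2) 𝓘(ℝ, ℂ × ℝ) (coord ∘ f) p w)

/-- The local parametrization of the immersed surface in the coordinate system around `p`. -/
def localParam (f : M → ℍ × ℝ) (p : M) (x : E2) : ℂ × ℝ :=
  coord (f ((extChartAt (𝓡 2) p).symm x))

variable [Bundle.RiemannianBundle (fun p : M => TangentSpace (𝓡 2) p)]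

/-- The matrix `g⁻¹ h` of the shape operator at `p`, in the coordinate system around `p`. -/
def shapeMatrix (f : M → ℍ × ℝ) (p : M) : Matrix (Fin 2) (Fin 2) ℝ :=
  (chartMetric p (extChartAt (𝓡 2) p p))⁻¹ * secondForm (localParam f p) (extChartAt (𝓡 2) p p)

/-- The principal curvatures at `p` are the eigenvalues of the shape operator. -/
def IsPrincipalCurvature (f : M → ℍ × ℝ) (p : M) (k : ℝ) : Prop :=
  Module.End.HasEigenvalue (Matrix.toLin' (shapeMatrix f p)) k

/-- The extrinsic curvature at `p`: the product of the principal curvatures (counted with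
multiplicity), that is, the determinant of the shape operator. -/
def extrinsicCurvature (f : M → ℍ × ℝ) (p : M) : ℝ :=
  (shapeMatrix f p).det

/-- The set of planar points: those where the principal curvatures are zero. -/
def planarPoints (f : M → ℍ × ℝ) : Set M :=
  {p | ∀ k : ℝ, IsPrincipalCurvature f p k → k = 0}

end Surface

/-- `γ` is a geodesic of the hyperbolic plane, parametrized by arc length on the whole line: it is
smooth, `|γ'| = 1` in the Poincaré metric, and the covariant derivative of `γ'` along `γ`
vanishes. -/
structure IsUnitSpeedGeodesic (γ : ℝ → ℍ) : Prop where
  smooth : ContDiff ℝ ∞ (fun s => (γ s : ℂ))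
  unit_speed : ∀ s, ‖deriv (fun s => (γ s : ℂ)) s‖ / (γ s).im = 1
  geodesic : ∀ s, deriv (deriv fun s => (γ s : ℂ)) s
    + Complex.I * deriv (fun s => (γ s : ℂ)) s ^ 2 / ((γ s).im : ℂ) = 0

end HypProd

end

open Set Filter Topology

noncomputable section

namespace HypProd

/-! ### The ambient connection and the Gauss equation -/

/-! The sectional curvature of `ℍ × ℝ` on a tangent plane of the surface is `-ν²`, where `ν` is the
vertical component of the unit normal. The Gauss equation therefore reads `K = K_ext - ν²`, and when
both curvatures vanish so does `ν`: every tangent plane contains the vertical direction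
(`gauss_equation`, `exists_mfderiv_eq_vertical`). A surface with vertical tangent planes is locally
a unit speed curve `c` of `ℍ` times a vertical segment (`exists_unit_speed_straightening`,
`exists_isBox`), and a point of it is planar exactly when the covariant acceleration of `c` vanishes
there (`planar_iff_acc_eq_zero`). Completeness prolongs the vertical segments to full lines and the
horizontal curve through `p₀` to the whole real line. This gives a continuous open map `e : ℝ × ℝ →
M` with `f (e (s, t)) = (C s, t)`, where `C` has unit speed (`exists_development`). Pulled back by
`e`, the planar set becomes `Z × ℝ`, with `Z` the zero set of the acceleration of `C`. Let `J` be
the component of `0` in `Z`. On `J` the curve `C` agrees with a complete geodesic `γ`, which is an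
isometric embedding of the line (`exists_geodesic_of_acc_eq_zero`); hence `f ∘ e` is a closed
embedding on `J × ℝ`. The map `e` need not be injective (`C` may close up), so it must be shown that
no other part of `Z` enlarges the component downstairs: the component of `p₀` in the planar set is
exactly `e (J × ℝ)` (`connectedComponentIn_eq_image`). For this, `J` is enclosed in an open set
whose boundary avoids `Z`, and properness of `e` on suitable strips turns this into a separation in
`M`. Surjectivity of `e` is not needed. Interior and frontier are then read off from those of the
closed interval `J`. -/

lemma hasDerivAt_ambientInner {q v w : ℝ → ℂ × ℝ} {q' v' w' : ℂ × ℝ} {t : ℝ}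
    (hq : HasDerivAt q q' t) (hv : HasDerivAt v v' t) (hw : HasDerivAt w w' t)
    (hne : (q t).1.im ≠ 0) :
    HasDerivAt (fun s => ambientInner (q s) (v s) (w s))
      (ambientInner (q t) (v' + christoffel (q t) q' (v t)) (w t)
        + ambientInner (q t) (v t) (w' + christoffel (q t) q' (w t))) t := by
  have hre : ∀ {u : ℝ → ℂ × ℝ} {u' : ℂ × ℝ}, HasDerivAt u u' t →
      HasDerivAt (fun s => (u s).1.re) u'.1.re t := fun {u u'} hu =>
    ((Complex.reCLM.comp (ContinuousLinearMap.fst ℝ ℂ ℝ)).hasFDerivAt.comp_hasDerivAt t hu)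
  have him : ∀ {u : ℝ → ℂ × ℝ} {u' : ℂ × ℝ}, HasDerivAt u u' t →
      HasDerivAt (fun s => (u s).1.im) u'.1.im t := fun {u u'} hu =>
    ((Complex.imCLM.comp (ContinuousLinearMap.fst ℝ ℂ ℝ)).hasFDerivAt.comp_hasDerivAt t hu)
  have hsnd : ∀ {u : ℝ → ℂ × ℝ} {u' : ℂ × ℝ}, HasDerivAt u u' t →
      HasDerivAt (fun s => (u s).2) u'.2 t := fun {u u'} hu =>
    ((ContinuousLinearMap.snd ℝ ℂ ℝ).hasFDerivAt.comp_hasDerivAt t hu)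
  have h := ((((hre hv).mul (hre hw)).add ((him hv).mul (him hw))).div ((him hq).pow 2)
    (pow_ne_zero 2 hne)).add ((hsnd hv).mul (hsnd hw))
  refine h.congr_deriv ?_
  simp only [ambientInner, christoffel, Prod.fst_add, Prod.snd_add, Complex.add_re, Complex.add_im,
    Complex.div_ofReal_re, Complex.div_ofReal_im, Complex.mul_re, Complex.mul_im, Complex.I_re,
    Complex.I_im]
  simp only [Pi.mul_apply, Pi.add_apply, Pi.pow_apply]
  field_simp
  ring

/-- The covariant derivative along `X` of a vector field `V` along `X`. -/
def covAlong (X : E2 → ℂ × ℝ) (k : Fin 2) (V : E2 → ℂ × ℝ) (x : E2) : ℂ × ℝ :=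
  pd k V x + christoffel (X x) (pd k X x) (V x)

lemma hasDerivAt_line {V : Type*} [NormedAddCommGroup V] [NormedSpace ℝ V] {F : E2 → V} {x : E2}
    (hF : DifferentiableAt ℝ F x) (k : Fin 2) :
    HasDerivAt (fun t : ℝ => F (x + t • EuclideanSpace.single k (1 : ℝ))) (pd k F x) 0 := by
  have hl : HasDerivAt (fun t : ℝ => x + t • EuclideanSpace.single k (1 : ℝ))
      (EuclideanSpace.single k (1 : ℝ)) 0 := by
    simpa using ((hasDerivAt_id (0 : ℝ)).smul_const
      (EuclideanSpace.single k (1 : ℝ) : E2)).const_add x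
  have h0 : x + (0 : ℝ) • EuclideanSpace.single k (1 : ℝ) = x := by simp
  have := hF.hasFDerivAt
  rw [← h0] at this
  have h := this.comp_hasDerivAt (0 : ℝ) hl
  rw [h0] at h
  exact h

lemma pd_eq_of_hasDerivAt {V : Type*} [NormedAddCommGroup V] [NormedSpace ℝ V] {F : E2 → V}
    {x : E2} {v : V} (hF : DifferentiableAt ℝ F x) (k : Fin 2)
    (h : HasDerivAt (fun t : ℝ => F (x + t • EuclideanSpace.single k (1 : ℝ))) v 0) :
    pd k F x = v :=
  (hasDerivAt_line hF k).unique h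

lemma differentiableAt_ambientInner {X V W : E2 → ℂ × ℝ} {x : E2} (hX : DifferentiableAt ℝ X x)
    (hV : DifferentiableAt ℝ V x) (hW : DifferentiableAt ℝ W x) (hne : (X x).1.im ≠ 0) :
    DifferentiableAt ℝ (fun y => ambientInner (X y) (V y) (W y)) x := by
  have hre : ∀ {U : E2 → ℂ × ℝ}, DifferentiableAt ℝ U x →
      DifferentiableAt ℝ (fun y => (U y).1.re) x := fun {U} hU =>
    (Complex.reCLM.comp (ContinuousLinearMap.fst ℝ ℂ ℝ)).differentiableAt.comp x hU
  have him : ∀ {U : E2 → ℂ × ℝ}, DifferentiableAt ℝ U x →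
      DifferentiableAt ℝ (fun y => (U y).1.im) x := fun {U} hU =>
    (Complex.imCLM.comp (ContinuousLinearMap.fst ℝ ℂ ℝ)).differentiableAt.comp x hU
  have hsnd : ∀ {U : E2 → ℂ × ℝ}, DifferentiableAt ℝ U x →
      DifferentiableAt ℝ (fun y => (U y).2) x := fun {U} hU =>
    (ContinuousLinearMap.snd ℝ ℂ ℝ).differentiableAt.comp x hU
  have hd : DifferentiableAt ℝ (fun y => (X y).1.im ^ 2) x := (him hX).fun_pow 2
  simp only [ambientInner, div_eq_mul_inv]
  exact ((((hre hV).fun_mul (hre hW)).fun_add ((him hV).fun_mul (him hW))).fun_mul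
    (hd.fun_inv (pow_ne_zero 2 hne))).fun_add ((hsnd hV).fun_mul (hsnd hW))

lemma pd_ambientInner {X V W : E2 → ℂ × ℝ} {x : E2} (hX : DifferentiableAt ℝ X x)
    (hV : DifferentiableAt ℝ V x) (hW : DifferentiableAt ℝ W x) (hne : (X x).1.im ≠ 0)
    (k : Fin 2) :
    pd k (fun y => ambientInner (X y) (V y) (W y)) x
      = ambientInner (X x) (covAlong X k V x) (W x)
        + ambientInner (X x) (V x) (covAlong X k W x) := by
  refine pd_eq_of_hasDerivAt (differentiableAt_ambientInner hX hV hW hne) k ?_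
  have := hasDerivAt_ambientInner (hasDerivAt_line hX k) (hasDerivAt_line hV k)
    (hasDerivAt_line hW k) (by simpa using hne)
  simpa [covAlong] using this

lemma differentiableAt_christoffel {X V W : E2 → ℂ × ℝ} {x : E2} (hX : DifferentiableAt ℝ X x)
    (hV : DifferentiableAt ℝ V x) (hW : DifferentiableAt ℝ W x) (hne : (X x).1.im ≠ 0) :
    DifferentiableAt ℝ (fun y => christoffel (X y) (V y) (W y)) x := by
  have h1 : ∀ {U : E2 → ℂ × ℝ}, DifferentiableAt ℝ U x →
      DifferentiableAt ℝ (fun y => (U y).1) x := fun {U} hU => hU.fst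
  have him : DifferentiableAt ℝ (fun y => ((X y).1.im : ℂ)) x :=
    (Complex.ofRealCLM.comp (Complex.imCLM.comp
      (ContinuousLinearMap.fst ℝ ℂ ℝ))).differentiableAt.comp x hX
  have hne' : ((X x).1.im : ℂ) ≠ 0 := by exact_mod_cast hne
  simp only [christoffel, div_eq_mul_inv]
  exact ((((h1 hV).const_mul Complex.I).fun_mul (h1 hW)).fun_mul (him.fun_inv hne')).prodMk
    (differentiableAt_const (0 : ℝ))

lemma pd_christoffel {X V W : E2 → ℂ × ℝ} {x : E2} (hX : DifferentiableAt ℝ X x)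
    (hV : DifferentiableAt ℝ V x) (hW : DifferentiableAt ℝ W x) (hne : (X x).1.im ≠ 0)
    (k : Fin 2) :
    pd k (fun y => christoffel (X y) (V y) (W y)) x
      = christoffel (X x) (pd k V x) (W x) + christoffel (X x) (V x) (pd k W x)
        - ((pd k X x).1.im / (X x).1.im) • christoffel (X x) (V x) (W x) := by
  refine pd_eq_of_hasDerivAt (differentiableAt_christoffel hX hV hW hne) k ?_
  have h1 : ∀ {U : E2 → ℂ × ℝ}, DifferentiableAt ℝ U x →
      HasDerivAt (fun t : ℝ => (U (x + t • EuclideanSpace.single k (1 : ℝ))).1)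
        (pd k U x).1 0 := fun {U} hU =>
    (ContinuousLinearMap.fst ℝ ℂ ℝ).hasFDerivAt.comp_hasDerivAt (0 : ℝ) (hasDerivAt_line hU k)
  have him : HasDerivAt (fun t : ℝ => ((X (x + t • EuclideanSpace.single k (1 : ℝ))).1.im : ℂ))
      ((pd k X x).1.im : ℂ) 0 :=
    (Complex.ofRealCLM.comp (Complex.imCLM.comp
      (ContinuousLinearMap.fst ℝ ℂ ℝ))).hasFDerivAt.comp_hasDerivAt (0 : ℝ) (hasDerivAt_line hX k)
  have hne' : ((X x).1.im : ℂ) ≠ 0 := by exact_mod_cast hne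
  have h := ((((h1 hV).const_mul Complex.I).mul (h1 hW)).div him (by simpa using hne)).prodMk
    (hasDerivAt_const (0 : ℝ) (0 : ℝ))
  refine HasDerivAt.congr_deriv (f := _) h ?_
  ext1
  · simp [christoffel]
    field_simp
  · simp [christoffel]

lemma contDiffAt_pd {V : Type*} [NormedAddCommGroup V] [NormedSpace ℝ V] {F : E2 → V} {x : E2}
    (hF : ContDiffAt ℝ ∞ F x) (k : Fin 2) : ContDiffAt ℝ ∞ (pd k F) x :=
  (hF.fderiv_right (m := ∞) (by simp)).clm_apply contDiffAt_const

lemma pd_comm {V : Type*} [NormedAddCommGroup V] [NormedSpace ℝ V] {F : E2 → V} {x : E2}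
    (hF : ContDiffAt ℝ ∞ F x) (i j : Fin 2) : pd i (pd j F) x = pd j (pd i F) x := by
  have hd : DifferentiableAt ℝ (fderiv ℝ F) x :=
    (hF.fderiv_right (m := ∞) (by simp)).differentiableAt (by simp)
  have hs : IsSymmSndFDerivAt ℝ F x := hF.isSymmSndFDerivAt (by simpa using WithTop.coe_le_coe.2 (le_top : (2 : ℕ∞) ≤ ⊤))
  have key : ∀ i j : Fin 2, pd i (pd j F) x
      = fderiv ℝ (fderiv ℝ F) x (EuclideanSpace.single i 1) (EuclideanSpace.single j 1) := by
    intro i j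
    have : pd j F = fun y => (fderiv ℝ F y) (EuclideanSpace.single j 1) := rfl
    rw [this, pd, fderiv_clm_apply hd (differentiableAt_const _)]
    simp
  rw [key, key, hs]

lemma contDiffAt_covAlong {X V : E2 → ℂ × ℝ} {x : E2} (hX : ContDiffAt ℝ ∞ X x)
    (hV : ContDiffAt ℝ ∞ V x) (hne : (X x).1.im ≠ 0) (k : Fin 2) :
    ContDiffAt ℝ ∞ (covAlong X k V) x := by
  have him : ContDiffAt ℝ ∞ (fun y => ((X y).1.im : ℂ)) x :=
    (Complex.ofRealCLM.comp (Complex.imCLM.comp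
      (ContinuousLinearMap.fst ℝ ℂ ℝ))).contDiff.contDiffAt.comp x hX
  have hne' : ((X x).1.im : ℂ) ≠ 0 := by exact_mod_cast hne
  refine (contDiffAt_pd hV k).add (ContDiffAt.prodMk ?_ contDiffAt_const)
  simp only [div_eq_mul_inv]
  exact ((contDiffAt_const.mul (contDiffAt_pd hX k).fst).mul hV.fst).mul (him.inv hne')

lemma covAlong_pd_comm {X : E2 → ℂ × ℝ} {x : E2} (hX : ContDiffAt ℝ ∞ X x) (i j : Fin 2) :
    covAlong X i (pd j X) x = covAlong X j (pd i X) x := by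
  simp only [covAlong, pd_comm hX i j, christoffel]
  congr 3
  ring

/-- The curvature of the ambient connection. -/
lemma covAlong_commutator {X V : E2 → ℂ × ℝ} {x : E2} (hX : ContDiffAt ℝ ∞ X x)
    (hV : ContDiffAt ℝ ∞ V x) (hne : (X x).1.im ≠ 0) :
    covAlong X 0 (covAlong X 1 V) x - covAlong X 1 (covAlong X 0 V) x
      = (Complex.I * ((((pd 0 X x).1.re * (pd 1 X x).1.im - (pd 1 X x).1.re * (pd 0 X x).1.im)
          / (X x).1.im ^ 2 : ℝ) : ℂ) * (V x).1, 0) := by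
  have hpd : ∀ i j : Fin 2, pd i (covAlong X j V) x = pd i (pd j V) x
      + (christoffel (X x) (pd i (pd j X) x) (V x) + christoffel (X x) (pd j X x) (pd i V x)
        - ((pd i X x).1.im / (X x).1.im) • christoffel (X x) (pd j X x) (V x)) := by
    intro i j
    have h1 : DifferentiableAt ℝ (pd j V) x := (contDiffAt_pd hV j).differentiableAt (by simp)
    have h2 : DifferentiableAt ℝ (pd j X) x := (contDiffAt_pd hX j).differentiableAt (by simp)
    have h3 := hX.differentiableAt (by simp : (∞ : WithTop ℕ∞) ≠ 0)
    have h4 := hV.differentiableAt (by simp : (∞ : WithTop ℕ∞) ≠ 0)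
    rw [← pd_christoffel h3 h2 h4 hne]
    have : covAlong X j V = pd j V + fun y => christoffel (X y) (pd j X y) (V y) := rfl
    rw [this, pd, fderiv_add h1 (differentiableAt_christoffel h3 h2 h4 hne)]
    rfl
  have hne' : ((X x).1.im : ℂ) ≠ 0 := by exact_mod_cast hne
  rw [covAlong, covAlong.eq_def X 1 (covAlong X 0 V), hpd 0 1, hpd 1 0, pd_comm hV 0 1, pd_comm hX 0 1]
  ext1
  · simp only [covAlong, christoffel, Prod.fst_add, Prod.fst_sub, Prod.smul_fst,
      Complex.real_smul]
    have e : ∀ z : ℂ, z = (z.re : ℂ) + z.im * Complex.I := fun z => (Complex.re_add_im z).symm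
    have e0 := e (pd 0 X x).1
    have e1 := e (pd 1 X x).1
    push_cast
    generalize ((pd 0 X x).1.re : ℂ) = a0 at *
    generalize ((pd 0 X x).1.im : ℂ) = b0 at *
    generalize ((pd 1 X x).1.re : ℂ) = a1 at *
    generalize ((pd 1 X x).1.im : ℂ) = b1 at *
    rw [e0, e1]
    field_simp
    ring
  · simp [covAlong, christoffel]

lemma ambientInner_comm (q v w : ℂ × ℝ) : ambientInner q v w = ambientInner q w v := by
  simp only [ambientInner]; ring

lemma ambientInner_smul_right (q v w : ℂ × ℝ) (a : ℝ) :
    ambientInner q v (a • w) = a * ambientInner q v w := by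
  simp [ambientInner]; ring

lemma ambientInner_smul_left (q v w : ℂ × ℝ) (a : ℝ) :
    ambientInner q (a • v) w = a * ambientInner q v w := by
  simp [ambientInner]; ring

lemma ambientInner_add_right (q v w u : ℂ × ℝ) :
    ambientInner q v (w + u) = ambientInner q v w + ambientInner q v u := by
  simp [ambientInner]; ring

lemma ambientInner_add_left (q v w u : ℂ × ℝ) :
    ambientInner q (v + w) u = ambientInner q v u + ambientInner q w u := by
  simp [ambientInner]; ring

lemma ambientInner_crossNormal_self {q : ℂ × ℝ} (hq : q.1.im ≠ 0) (v w : ℂ × ℝ) :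
    ambientInner q (crossNormal q v w) (crossNormal q v w)
      = ambientInner q v v * ambientInner q w w - ambientInner q v w ^ 2 := by
  simp only [ambientInner, crossNormal]
  field_simp
  ring

/-- This is the product of two `3 × 3` determinants written as a Gram determinant. It eliminates the
normal from products of normal components, so that the determinant of the second fundamental form
becomes a polynomial in inner products, comparable with Brioschi's formula. -/
lemma ambientInner_crossNormal_mul {q : ℂ × ℝ} (hq : q.1.im ≠ 0) (v w a b : ℂ × ℝ) :
    ambientInner q a (crossNormal q v w) * ambientInner q b (crossNormal q v w)
      = ambientInner q a b
          * (ambientInner q v v * ambientInner q w w - ambientInner q v w ^ 2)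
        - ambientInner q a v
          * (ambientInner q b v * ambientInner q w w - ambientInner q b w * ambientInner q v w)
        + ambientInner q a w
          * (ambientInner q b v * ambientInner q v w - ambientInner q b w * ambientInner q v v) := by
  simp only [ambientInner, crossNormal]
  field_simp
  ring

/-- The vertical component of the normal to the plane spanned by two vectors, up to scaling. -/
def jac (v w : ℂ × ℝ) : ℝ := v.1.re * w.1.im - w.1.re * v.1.im

lemma eventuallyEq_pd {V : Type*} [NormedAddCommGroup V] [NormedSpace ℝ V] {F G : E2 → V} {x : E2}
    (h : F =ᶠ[𝓝 x] G) (k : Fin 2) : pd k F =ᶠ[𝓝 x] pd k G := by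
  filter_upwards [h.fderiv (𝕜 := ℝ)] with y hy
  simp [pd, hy]

/-- The matrix of the metric induced by a parametrized surface. -/
def firstForm (X : E2 → ℂ × ℝ) (x : E2) : Matrix (Fin 2) (Fin 2) ℝ :=
  Matrix.of fun i j => ambientInner (X x) (pd i X x) (pd j X x)

lemma brioschi_congr {g g' : E2 → Matrix (Fin 2) (Fin 2) ℝ} {x : E2} (h : g =ᶠ[𝓝 x] g') :
    brioschi g x = brioschi g' x := by
  have e : ∀ i j, (fun y => g y i j) =ᶠ[𝓝 x] fun y => g' y i j := fun i j =>
    h.mono fun y hy => by simp [hy]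
  have e1 : ∀ i j k, pd k (fun y => g y i j) x = pd k (fun y => g' y i j) x := fun i j k =>
    (eventuallyEq_pd (e i j) k).self_of_nhds
  have e2 : ∀ i j k l, pd l (pd k (fun y => g y i j)) x = pd l (pd k (fun y => g' y i j)) x :=
    fun i j k l => (eventuallyEq_pd (eventuallyEq_pd (e i j) k) l).self_of_nhds
  simp only [brioschi, e1, e2, h.self_of_nhds]

/-- The Gauss equation for surfaces in `ℍ × ℝ`. -/
lemma gauss_equation {X : E2 → ℂ × ℝ} {x : E2} (hXe : ∀ᶠ y in 𝓝 x, ContDiffAt ℝ ∞ X y)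
    (hy : (X x).1.im ≠ 0) (hd : 0 < (firstForm X x).det) :
    brioschi (firstForm X) x * (firstForm X x).det
      = (secondForm X x).det - (jac (pd 0 X x) (pd 1 X x)) ^ 2 / (X x).1.im ^ 4 := by
  have hX : ContDiffAt ℝ ∞ X x := hXe.self_of_nhds
  have hye : ∀ᶠ y in 𝓝 x, (X y).1.im ≠ 0 :=
    (Complex.continuous_im.continuousAt.comp
      (continuous_fst.continuousAt.comp hX.continuousAt)).eventually_ne hy
  have dp : ∀ {V : E2 → ℂ × ℝ} {y}, ContDiffAt ℝ ∞ V y → DifferentiableAt ℝ V y :=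
    fun h => h.differentiableAt (by simp)
  have hV : ∀ k, ContDiffAt ℝ ∞ (pd k X) x := contDiffAt_pd hX
  have hW : ∀ k j, ContDiffAt ℝ ∞ (covAlong X k (pd j X)) x := fun k j =>
    contDiffAt_covAlong hX (hV j) hy k
  have first : ∀ i j k, pd k (fun y => firstForm X y i j) =ᶠ[𝓝 x] fun y =>
      ambientInner (X y) (covAlong X k (pd i X) y) (pd j X y)
        + ambientInner (X y) (pd i X y) (covAlong X k (pd j X) y) := by
    intro i j k
    filter_upwards [hXe, hye] with y h1 h2
    exact pd_ambientInner (dp h1) (dp (contDiffAt_pd h1 i)) (dp (contDiffAt_pd h1 j)) h2 k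
  have second : ∀ i j k l, pd l (pd k (fun y => firstForm X y i j)) x
      = (ambientInner (X x) (covAlong X l (covAlong X k (pd i X)) x) (pd j X x)
        + ambientInner (X x) (covAlong X k (pd i X) x) (covAlong X l (pd j X) x))
      + (ambientInner (X x) (covAlong X l (pd i X) x) (covAlong X k (pd j X) x)
        + ambientInner (X x) (pd i X x) (covAlong X l (covAlong X k (pd j X)) x)) := by
    intro i j k l
    rw [(eventuallyEq_pd (first i j k) l).self_of_nhds, ← pd_ambientInner (dp hX) (dp (hW k i))
      (dp (hV j)) hy l, ← pd_ambientInner (dp hX) (dp (hV i)) (dp (hW k j)) hy l]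
    rw [pd, fderiv_fun_add (differentiableAt_ambientInner (dp hX) (dp (hW k i)) (dp (hV j)) hy)
      (differentiableAt_ambientInner (dp hX) (dp (hV i)) (dp (hW k j)) hy)]
    rfl
  have comm : covAlong X 1 (pd 0 X) =ᶠ[𝓝 x] covAlong X 0 (pd 1 X) := by
    filter_upwards [hXe] with y h1 using covAlong_pd_comm h1 1 0
  have comm2 : ∀ l, covAlong X l (covAlong X 1 (pd 0 X)) x
      = covAlong X l (covAlong X 0 (pd 1 X)) x := fun l => by
    rw [covAlong, (eventuallyEq_pd comm l).self_of_nhds, comm.self_of_nhds]; rfl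
  have curv := covAlong_commutator hX (hV 1) hy
  -- The only place where the ambient curvature enters: exchanging the two outer covariant
  -- derivatives costs the sectional curvature term of the tangent plane.
  have hcurv : ambientInner (X x) (pd 0 X x) (covAlong X 0 (covAlong X 1 (pd 1 X)) x)
      = ambientInner (X x) (pd 0 X x) (covAlong X 1 (covAlong X 0 (pd 1 X)) x)
        - (jac (pd 0 X x) (pd 1 X x)) ^ 2 / (X x).1.im ^ 4 := by
    rw [sub_eq_iff_eq_add.1 curv, ambientInner_add_right]
    have hr : ∀ r : ℝ, ambientInner (X x) (pd 0 X x) (Complex.I * (r : ℂ) * (pd 1 X x).1, 0)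
        = - r * jac (pd 0 X x) (pd 1 X x) / (X x).1.im ^ 2 := by
      intro r
      simp [ambientInner, jac]
      ring
    rw [hr, jac]
    field_simp
    ring
  have hE := ambientInner_crossNormal_self hy (pd 0 X x) (pd 1 X x)
  have hdet : (firstForm X x).det = ambientInner (X x) (pd 0 X x) (pd 0 X x)
      * ambientInner (X x) (pd 1 X x) (pd 1 X x)
      - ambientInner (X x) (pd 0 X x) (pd 1 X x) ^ 2 := by
    rw [Matrix.det_fin_two]
    simp only [firstForm, Matrix.of_apply, ambientInner_comm (X x) (pd 1 X x) (pd 0 X x)]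
    ring
  have hAC := ambientInner_crossNormal_mul hy (pd 0 X x) (pd 1 X x) (covAlong X 0 (pd 0 X) x)
    (covAlong X 1 (pd 1 X) x)
  have hBB := ambientInner_crossNormal_mul hy (pd 0 X x) (pd 1 X x) (covAlong X 0 (pd 1 X) x)
    (covAlong X 0 (pd 1 X) x)
  have hs : (Real.sqrt (ambientInner (X x) (crossNormal (X x) (pd 0 X x) (pd 1 X x))
      (crossNormal (X x) (pd 0 X x) (pd 1 X x))))⁻¹ ^ 2 * (firstForm X x).det = 1 := by
    rw [hE, ← hdet, inv_pow, Real.sq_sqrt hd.le, inv_mul_cancel₀ hd.ne']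
  have hII : (firstForm X x).det * (secondForm X x).det
      = ambientInner (X x) (covAlong X 0 (pd 0 X) x) (crossNormal (X x) (pd 0 X x) (pd 1 X x))
        * ambientInner (X x) (covAlong X 1 (pd 1 X) x) (crossNormal (X x) (pd 0 X x) (pd 1 X x))
        - ambientInner (X x) (covAlong X 0 (pd 1 X) x) (crossNormal (X x) (pd 0 X x) (pd 1 X x))
        * ambientInner (X x) (covAlong X 0 (pd 1 X) x)
          (crossNormal (X x) (pd 0 X x) (pd 1 X x)) := by
    rw [Matrix.det_fin_two (secondForm X x)]
    have hc : ∀ i j, covDeriv X i j x = covAlong X i (pd j X) x := fun _ _ => rfl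
    simp only [secondForm, Matrix.of_apply, unitNormal, ambientInner_smul_right, hc,
      comm.self_of_nhds]
    generalize ambientInner (X x) (covAlong X 0 (pd 0 X) x) _ = a
    generalize ambientInner (X x) (covAlong X 1 (pd 1 X) x) _ = c
    generalize ambientInner (X x) (covAlong X 0 (pd 1 X) x) _ = b
    linear_combination (a * c - b * b) * hs
  rw [hAC, hBB] at hII
  -- After metric compatibility, both sides are polynomials in inner products of the `∂ᵢX` and their
  -- covariant derivatives. Torsion-freeness (`comm`, `comm2`) and `hcurv` dispose of the terms with
  -- two covariant derivatives.
  have hN : brioschi (firstForm X) x * (firstForm X x).det ^ 2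
      = (firstForm X x).det * (secondForm X x).det
        - (firstForm X x).det * (jac (pd 0 X x) (pd 1 X x)) ^ 2 / (X x).1.im ^ 4 := by
    rw [hII]
    have hb : ∀ i j k, pd k (fun y => firstForm X y i j) x = _ := fun i j k =>
      (first i j k).self_of_nhds
    have hF : ∀ i j, firstForm X x i j = ambientInner (X x) (pd i X x) (pd j X x) :=
      fun _ _ => rfl
    have hE0 : firstForm X x 0 0 * firstForm X x 1 1 - firstForm X x 0 1 ^ 2
      = (firstForm X x).det := by rw [hdet]; rfl
    simp only [brioschi, hE0]
    rw [div_mul_cancel₀ _ (by positivity)]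
    simp only [second, hb, hF, comm2, comm.self_of_nhds, hdet]
    simp only [Matrix.det_fin_three, Matrix.of_apply, Matrix.cons_val', Matrix.cons_val_zero,
      Matrix.cons_val_one, Matrix.cons_val, hcurv]
    simp only [ambientInner_comm (X x) (pd 0 X x) (covAlong X _ _ x),
      ambientInner_comm (X x) (pd 1 X x) (covAlong X _ _ x)]
    ring
  have hd' := hd.ne'
  apply mul_left_cancel₀ hd'
  linear_combination hN

lemma localParam_im_pos {M : Type*} [TopologicalSpace M] [ChartedSpace E2 M]
    (f : M → ℍ × ℝ) (p : M) (x : E2) : 0 < (localParam f p x).1.im :=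
  (f ((extChartAt (𝓡 2) p).symm x)).1.im_pos

/-! ### The immersion in charts: vertical tangent planes and planar points. -/

section Local

variable {M : Type*} [TopologicalSpace M] [ChartedSpace E2 M] [IsManifold (𝓡 2) ∞ M]

lemma contDiffOn_localParam {f : M → ℍ × ℝ} (hf : ContMDiff (𝓡 2) 𝓘(ℝ, ℂ × ℝ) ∞ (coord ∘ f))
    (p : M) : ContDiffOn ℝ ∞ (localParam f p) (extChartAt (𝓡 2) p).target := by
  rw [← contMDiffOn_iff_contDiffOn]
  exact hf.comp_contMDiffOn (contMDiffOn_extChartAt_symm p)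

lemma mdifferentiableAt_chart_symm (p : M) {x : E2} (hx : x ∈ (extChartAt (𝓡 2) p).target) :
    MDifferentiableAt 𝓘(ℝ, E2) (𝓡 2) (extChartAt (𝓡 2) p).symm x :=
  ((contMDiffOn_extChartAt_symm (n := ∞) p).contMDiffAt
    ((isOpen_extChartAt_target p).mem_nhds hx)).mdifferentiableAt (by simp)

lemma fderiv_localParam {f : M → ℍ × ℝ} (hf : ContMDiff (𝓡 2) 𝓘(ℝ, ℂ × ℝ) ∞ (coord ∘ f))
    (p : M) {x : E2} (hx : x ∈ (extChartAt (𝓡 2) p).target) (v : E2) :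
    fderiv ℝ (localParam f p) x v = mfderiv (𝓡 2) 𝓘(ℝ, ℂ × ℝ) (coord ∘ f)
      ((extChartAt (𝓡 2) p).symm x)
      (mfderiv 𝓘(ℝ, E2) (𝓡 2) (extChartAt (𝓡 2) p).symm x v) := by
  have h : localParam f p = (coord ∘ f) ∘ (extChartAt (𝓡 2) p).symm := rfl
  rw [← mfderiv_eq_fderiv, h, mfderiv_comp x (hf.mdifferentiableAt (by simp))
    (mdifferentiableAt_chart_symm p hx)]
  rfl

lemma isInvertible_mfderiv_chart_symm (p : M) {x : E2} (hx : x ∈ (extChartAt (𝓡 2) p).target) :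
    (mfderiv 𝓘(ℝ, E2) (𝓡 2) (extChartAt (𝓡 2) p).symm x).IsInvertible := by
  have := isInvertible_mfderivWithin_extChartAt_symm (I := 𝓡 2) hx
  rwa [(by simp : range (𝓡 2) = univ), mfderivWithin_univ] at this

variable [Bundle.RiemannianBundle (fun p : M => TangentSpace (𝓡 2) p)]

lemma chartMetric_eq_firstForm {f : M → ℍ × ℝ} (hf : IsIsometricImmersion f) (p : M) {x : E2}
    (hx : x ∈ (extChartAt (𝓡 2) p).target) :
    chartMetric p x = firstForm (localParam f p) x := by
  ext i j
  simp only [chartMetric, firstForm, Matrix.of_apply, hf.isometric, pd,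
    fderiv_localParam hf.smooth p hx]
  rfl

lemma ambientInner_fderiv_localParam_pos {f : M → ℍ × ℝ} (hf : IsIsometricImmersion f) (p : M)
    {x : E2} (hx : x ∈ (extChartAt (𝓡 2) p).target) {v : E2} (hv : v ≠ 0) :
    0 < ambientInner (localParam f p x) (fderiv ℝ (localParam f p) x v)
      (fderiv ℝ (localParam f p) x v) := by
  have h := hf.isometric _ (mfderiv 𝓘(ℝ, E2) (𝓡 2) (extChartAt (𝓡 2) p).symm x v)
    (mfderiv 𝓘(ℝ, E2) (𝓡 2) (extChartAt (𝓡 2) p).symm x v)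
  rw [← fderiv_localParam hf.smooth p hx] at h
  change 0 < ambientInner (coord (f ((extChartAt (𝓡 2) p).symm x))) _ _
  rw [← h]
  refine real_inner_self_pos.2 fun h0 => hv ?_
  exact (isInvertible_mfderiv_chart_symm p hx).injective (h0.trans (map_zero _).symm)

lemma fderiv_localParam_injective {f : M → ℍ × ℝ} (hf : IsIsometricImmersion f) (p : M)
    {x : E2} (hx : x ∈ (extChartAt (𝓡 2) p).target) {v : E2}
    (hv : fderiv ℝ (localParam f p) x v = 0) : v = 0 := by
  by_contra h
  have := ambientInner_fderiv_localParam_pos hf p hx h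
  simp [hv, ambientInner] at this

lemma smul_single_add_fderiv (X : E2 → ℂ × ℝ) (x : E2) (a b : ℝ) :
    fderiv ℝ X x (a • EuclideanSpace.single 0 (1 : ℝ) + b • EuclideanSpace.single 1 (1 : ℝ))
      = a • pd 0 X x + b • pd 1 X x := by
  simp [pd]

lemma eq_zero_of_smul_single_add {a b : ℝ}
    (h : (a • EuclideanSpace.single 0 (1 : ℝ) + b • EuclideanSpace.single 1 (1 : ℝ) : E2) = 0) :
    a = 0 ∧ b = 0 := by
  constructor
  · simpa using congrArg (fun v : E2 => v 0) h
  · simpa using congrArg (fun v : E2 => v 1) h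

lemma firstForm_localParam_pos {f : M → ℍ × ℝ} (hf : IsIsometricImmersion f) (p : M) {x : E2}
    (hx : x ∈ (extChartAt (𝓡 2) p).target) :
    0 < firstForm (localParam f p) x 0 0 ∧ 0 < (firstForm (localParam f p) x).det := by
  have key : ∀ a b : ℝ, (a ≠ 0 ∨ b ≠ 0) → 0 < ambientInner (localParam f p x)
      (a • pd 0 (localParam f p) x + b • pd 1 (localParam f p) x)
      (a • pd 0 (localParam f p) x + b • pd 1 (localParam f p) x) := by
    intro a b hab
    rw [← smul_single_add_fderiv]
    refine ambientInner_fderiv_localParam_pos hf p hx fun h => ?_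
    have := eq_zero_of_smul_single_add h
    tauto
  have h00 : 0 < firstForm (localParam f p) x 0 0 := by
    simpa [firstForm] using key 1 0 (by simp)
  refine ⟨h00, ?_⟩
  -- With `E`, `F` the entries of the first row, the vector `-F ∂₀X + E ∂₁X` is orthogonal to `∂₀X`,
  -- and its squared length is `E` times the determinant.
  have h1 := key (-(firstForm (localParam f p) x 0 1)) (firstForm (localParam f p) x 0 0)
    (Or.inr h00.ne')
  have h2 : ambientInner (localParam f p x)
      (-(firstForm (localParam f p) x 0 1) • pd 0 (localParam f p) x
        + (firstForm (localParam f p) x 0 0) • pd 1 (localParam f p) x)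
      (-(firstForm (localParam f p) x 0 1) • pd 0 (localParam f p) x
        + (firstForm (localParam f p) x 0 0) • pd 1 (localParam f p) x)
      = firstForm (localParam f p) x 0 0 * (firstForm (localParam f p) x).det := by
    rw [Matrix.det_fin_two]
    simp only [ambientInner_add_left, ambientInner_add_right, ambientInner_smul_left,
      ambientInner_smul_right, firstForm, Matrix.of_apply,
      ambientInner_comm _ (pd 1 (localParam f p) x) (pd 0 (localParam f p) x)]
    ring
  rw [h2] at h1
  exact (mul_pos_iff_of_pos_left h00).1 h1

lemma secondForm_symm {X : E2 → ℂ × ℝ} {x : E2} (hX : ContDiffAt ℝ ∞ X x) :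
    secondForm X x 1 0 = secondForm X x 0 1 := by
  have : covDeriv X 1 0 x = covDeriv X 0 1 x := covAlong_pd_comm hX 1 0
  simp [secondForm, this]

lemma det_secondForm_eq_zero {f : M → ℍ × ℝ} (hf : IsIsometricImmersion f) {p : M}
    (hext : extrinsicCurvature f p = 0) :
    (secondForm (localParam f p) (extChartAt (𝓡 2) p p)).det = 0 := by
  have hx := mem_extChartAt_target (I := 𝓡 2) p
  have hd := (firstForm_localParam_pos hf p hx).2
  rw [extrinsicCurvature, shapeMatrix, Matrix.det_mul, chartMetric_eq_firstForm hf p hx,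
    Matrix.det_nonsing_inv, mul_eq_zero] at hext
  refine hext.resolve_left ?_
  rw [Ring.inverse_eq_inv]
  exact inv_ne_zero hd.ne'

lemma eventually_contDiffAt_localParam {f : M → ℍ × ℝ} (hf : IsIsometricImmersion f) (p : M)
    {x : E2} (hx : x ∈ (extChartAt (𝓡 2) p).target) :
    ∀ᶠ y in 𝓝 x, ContDiffAt ℝ ∞ (localParam f p) y := by
  filter_upwards [(isOpen_extChartAt_target p).mem_nhds hx] with y hy
  exact (contDiffOn_localParam hf.smooth p).contDiffAt ((isOpen_extChartAt_target p).mem_nhds hy)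

lemma jac_localParam_eq_zero {f : M → ℍ × ℝ} (hf : IsIsometricImmersion f) {p : M}
    (hK : gaussianCurvature p = 0) (hext : extrinsicCurvature f p = 0) :
    jac (pd 0 (localParam f p) (extChartAt (𝓡 2) p p))
      (pd 1 (localParam f p) (extChartAt (𝓡 2) p p)) = 0 := by
  have hx := mem_extChartAt_target (I := 𝓡 2) p
  have hy := localParam_im_pos f p (extChartAt (𝓡 2) p p)
  have hG := gauss_equation (eventually_contDiffAt_localParam hf p hx) hy.ne'
    (firstForm_localParam_pos hf p hx).2
  have hK' : brioschi (firstForm (localParam f p)) (extChartAt (𝓡 2) p p) = 0 := by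
    rw [← hK, gaussianCurvature]
    refine brioschi_congr ?_
    filter_upwards [(isOpen_extChartAt_target p).mem_nhds hx] with y hy
    exact (chartMetric_eq_firstForm hf p hy).symm
  rw [hK', det_secondForm_eq_zero hf hext] at hG
  have h4 : (localParam f p (extChartAt (𝓡 2) p p)).1.im ^ 4 ≠ 0 := by positivity
  have : jac (pd 0 (localParam f p) (extChartAt (𝓡 2) p p))
      (pd 1 (localParam f p) (extChartAt (𝓡 2) p p)) ^ 2 = 0 := by
    field_simp at hG
    linarith
  exact pow_eq_zero_iff (two_ne_zero) |>.1 this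

/-- When the horizontal parts are parallel, some nontrivial combination cancels them; independence
makes its height nonzero, and rescaling gives `(0, 1)`. The cases pick coefficients from the `x`
components, from the `y` components, or arbitrarily if all of these vanish. -/
lemma exists_smul_add_eq_vertical {v w : ℂ × ℝ} (h : jac v w = 0)
    (hvw : ∀ a b : ℝ, a • v + b • w = 0 → a = 0 ∧ b = 0) :
    ∃ a b : ℝ, a • v + b • w = (0, 1) := by
  have key : ∀ a b : ℝ, (a ≠ 0 ∨ b ≠ 0) → a * v.1.re + b * w.1.re = 0 →
      a * v.1.im + b * w.1.im = 0 → ∃ a b : ℝ, a • v + b • w = (0, 1) := by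
    intro a b hab h1 h2
    have h0 : (a • v + b • w).1 = 0 := by
      apply Complex.ext
      · simpa using h1
      · simpa using h2
    have ht : (a • v + b • w).2 ≠ 0 := fun ht => by
      have := hvw a b (Prod.ext h0 ht)
      tauto
    refine ⟨(a • v + b • w).2⁻¹ * a, (a • v + b • w).2⁻¹ * b, ?_⟩
    rw [mul_smul, mul_smul, ← smul_add]
    ext1
    · rw [Prod.smul_fst, h0, smul_zero]
    · rw [Prod.smul_snd, smul_eq_mul, inv_mul_cancel₀ ht]
  unfold jac at h
  by_cases h1 : w.1.re ≠ 0 ∨ v.1.re ≠ 0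
  · exact key w.1.re (-v.1.re) (by simpa using h1) (by ring) (by linarith)
  by_cases h2 : w.1.im ≠ 0 ∨ v.1.im ≠ 0
  · exact key w.1.im (-v.1.im) (by simpa using h2) (by linarith) (by ring)
  push Not at h1 h2
  exact key 1 0 (by simp) (by simp [h1]) (by simp [h2])

lemma exists_mfderiv_eq_vertical {f : M → ℍ × ℝ} (hf : IsIsometricImmersion f) {p : M}
    (hK : gaussianCurvature p = 0) (hext : extrinsicCurvature f p = 0) :
    ∃ w : TangentSpace (𝓡 2) p, mfderiv (𝓡 2) 𝓘(ℝ, ℂ × ℝ) (coord ∘ f) p w = ((0, 1) : ℂ × ℝ) := by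
  have hx := mem_extChartAt_target (I := 𝓡 2) p
  obtain ⟨a, b, hab⟩ := exists_smul_add_eq_vertical (jac_localParam_eq_zero hf hK hext)
    (fun a b hab => by
      rw [← smul_single_add_fderiv] at hab
      exact eq_zero_of_smul_single_add (fderiv_localParam_injective hf p hx hab))
  rw [← smul_single_add_fderiv, fderiv_localParam hf.smooth p hx] at hab
  have h : ∃ w : TangentSpace (𝓡 2) ((extChartAt (𝓡 2) p).symm (extChartAt (𝓡 2) p p)),
    mfderiv (𝓡 2) 𝓘(ℝ, ℂ × ℝ) (coord ∘ f) _ w = ((0, 1) : ℂ × ℝ) := ⟨_, hab⟩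
  rwa [extChartAt_to_inv (I := 𝓡 2) p] at h

lemma exists_fderiv_localParam_eq_vertical {f : M → ℍ × ℝ} (hf : IsIsometricImmersion f)
    (hK : ∀ p : M, gaussianCurvature p = 0) (hext : ∀ p : M, extrinsicCurvature f p = 0) (p : M)
    {x : E2} (hx : x ∈ (extChartAt (𝓡 2) p).target) :
    ∃ v : E2, fderiv ℝ (localParam f p) x v = (0, 1) := by
  obtain ⟨w, hw⟩ := exists_mfderiv_eq_vertical hf (hK ((extChartAt (𝓡 2) p).symm x)) (hext _)
  obtain ⟨v, hv⟩ := (isInvertible_mfderiv_chart_symm p hx).surjective w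
  exact ⟨v, (fderiv_localParam hf.smooth p hx v).trans ((congrArg _ hv).trans hw)⟩

/-- A self-adjoint operator with zero trace and zero determinant is zero. Since the determinant
vanishes by hypothesis, planarity only has to supply the trace. -/
lemma planar_iff_secondForm_eq_zero {f : M → ℍ × ℝ} (hf : IsIsometricImmersion f) {p : M}
    (hext : extrinsicCurvature f p = 0) :
    p ∈ planarPoints f ↔ secondForm (localParam f p) (extChartAt (𝓡 2) p p) = 0 := by
  have hx := mem_extChartAt_target (I := 𝓡 2) p
  obtain ⟨h0, hd⟩ := firstForm_localParam_pos hf p hx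
  have hdet := det_secondForm_eq_zero hf hext
  have hsymm := secondForm_symm (eventually_contDiffAt_localParam hf p hx).self_of_nhds
  have hsymm' : firstForm (localParam f p) (extChartAt (𝓡 2) p p) 1 0
    = firstForm (localParam f p) (extChartAt (𝓡 2) p p) 0 1 := ambientInner_comm _ _ _
  constructor
  · intro hp
    -- With zero determinant the characteristic polynomial is `X² - tr X`, so the trace is itself an
    -- eigenvalue.
    have htr : (shapeMatrix f p).trace = 0 := by
      apply hp
      rw [IsPrincipalCurvature, Module.End.hasEigenvalue_iff_isRoot_charpoly,
        Matrix.charpoly_toLin', Polynomial.IsRoot, Matrix.charpoly_fin_two]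
      have : (shapeMatrix f p).det = 0 := hext
      simp [this]
      ring
    rw [shapeMatrix, chartMetric_eq_firstForm hf p hx, Matrix.inv_def, Ring.inverse_eq_inv,
      Matrix.smul_mul, Matrix.trace_smul, smul_eq_mul, mul_eq_zero,
      or_iff_right (inv_ne_zero hd.ne'), Matrix.adjugate_fin_two, Matrix.trace_fin_two] at htr
    rw [Matrix.det_fin_two] at hd hdet
    generalize secondForm (localParam f p) (extChartAt (𝓡 2) p p) = h at *
    generalize firstForm (localParam f p) (extChartAt (𝓡 2) p p) = g at *
    simp [Matrix.mul_apply, Fin.sum_univ_two] at htr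
    rw [hsymm] at hdet htr
    rw [hsymm'] at hd htr
    -- Eliminating `h 1 1` between trace and determinant leaves a sum of two nonnegative terms,
    -- because `g` is positive definite.
    have e1 : (g 1 1 * g 0 0 - g 0 1 ^ 2) * h 0 1 ^ 2
        + (g 1 1 * h 0 0 - g 0 1 * h 0 1) ^ 2 = 0 := by
      linear_combination (g 1 1 * h 0 0) * htr - (g 1 1 * g 0 0) * hdet
    have h01 : h 0 1 = 0 := by
      have : 0 < g 1 1 * g 0 0 - g 0 1 ^ 2 := by nlinarith
      have h2 := sq_nonneg (g 1 1 * h 0 0 - g 0 1 * h 0 1)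
      have h3 := sq_nonneg (h 0 1)
      by_contra hne
      have : 0 < h 0 1 ^ 2 := by positivity
      nlinarith [mul_pos ‹0 < g 1 1 * g 0 0 - g 0 1 ^ 2› this]
    have hg11 : 0 < g 1 1 := by nlinarith [sq_nonneg (g 0 1)]
    have h00 : h 0 0 = 0 := by
      rw [h01] at e1
      have : (g 1 1 * h 0 0) ^ 2 = 0 := by linarith
      simpa [hg11.ne'] using this
    have h11 : h 1 1 = 0 := by
      rw [h01, h00] at htr
      have : g 0 0 * h 1 1 = 0 := by linarith
      simpa [h0.ne'] using this
    ext i j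
    fin_cases i <;> fin_cases j <;> simp [*]
  · intro h k hk
    rw [IsPrincipalCurvature, shapeMatrix, h, mul_zero] at hk
    obtain ⟨v, hv⟩ := hk.exists_hasEigenvector
    have := hv.apply_eq_smul
    simp only [map_zero, LinearMap.zero_apply] at this
    exact (smul_eq_zero.1 this.symm).resolve_right hv.2

end Local

/-! ### Straightening a vertical surface -/

/-- `X` parametrizes an immersed surface in `ℍ × ℝ`, over the open set `U`, whose tangent planes
are all vertical. -/
structure IsVerticalOn (X : E2 → ℂ × ℝ) (U : Set E2) : Prop where
  isOpen : IsOpen U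
  smooth : ContDiffOn ℝ ∞ X U
  im_pos : ∀ x ∈ U, 0 < (X x).1.im
  immersion : ∀ x ∈ U, ∀ v, fderiv ℝ X x v = 0 → v = 0
  vertical : ∀ x ∈ U, ∃ v, fderiv ℝ X x v = (0, 1)

variable {X : E2 → ℂ × ℝ} {U : Set E2}

lemma IsVerticalOn.mono (h : IsVerticalOn X U) {V : Set E2} (hV : IsOpen V) (hVU : V ⊆ U) :
    IsVerticalOn X V :=
  ⟨hV, h.smooth.mono hVU, fun x hx => h.im_pos x (hVU hx), fun x hx => h.immersion x (hVU hx),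
    fun x hx => h.vertical x (hVU hx)⟩

lemma IsVerticalOn.contDiffAt (h : IsVerticalOn X U) {x : E2} (hx : x ∈ U) :
    ContDiffAt ℝ ∞ X x :=
  h.smooth.contDiffAt (h.isOpen.mem_nhds hx)

/-- Otherwise every tangent vector would be a multiple of the vertical one `T`, and the differential
could not be injective on a plane. -/
lemma IsVerticalOn.exists_fderiv_fst_ne_zero (h : IsVerticalOn X U) {x : E2} (hx : x ∈ U) :
    ∃ v, (fderiv ℝ X x v).1 ≠ 0 := by
  by_contra! hc
  obtain ⟨T, hT⟩ := h.vertical x hx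
  have key : ∀ v, v = (fderiv ℝ X x v).2 • T := fun v => by
    refine sub_eq_zero.1 (h.immersion x hx _ ?_)
    rw [map_sub, map_smul, hT]
    ext1
    · simp [hc v]
    · simp
  have h0 := key (EuclideanSpace.single 0 1)
  have h1 := key (EuclideanSpace.single 1 1)
  generalize (fderiv ℝ X x (EuclideanSpace.single 0 1)).2 = a at h0
  generalize (fderiv ℝ X x (EuclideanSpace.single 1 1)).2 = b at h1
  have a0 := congrArg (fun v : E2 => v 0) h0
  have a1 := congrArg (fun v : E2 => v 1) h0
  have b0 := congrArg (fun v : E2 => v 0) h1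
  have b1 := congrArg (fun v : E2 => v 1) h1
  simp at a0 a1 b0 b1
  rcases a1 with a1 | a1
  · simp [a1] at a0
  · simp [a1] at b1

lemma bijective_of_vertical {L : E2 →L[ℝ] ℝ × ℝ} {T u : E2} (hT : L T = (0, 1))
    (hu : (L u).1 ≠ 0) : Function.Bijective L := by
  have hs : Function.Surjective L := fun y => by
    refine ⟨(y.1 / (L u).1) • u + (y.2 - (y.1 / (L u).1) * (L u).2) • T, ?_⟩
    rw [map_add, map_smul, map_smul, hT]
    ext1
    · simp [hu]
    · simp
  have hf : Module.finrank ℝ E2 = Module.finrank ℝ (ℝ × ℝ) := by simp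
  exact ⟨(LinearMap.injective_iff_surjective_of_finrank_eq_finrank
    (f := (L : E2 →ₗ[ℝ] ℝ × ℝ)) hf).2 hs, hs⟩

/-- If `g` is a submersion along the horizontal part of a vertical surface `X`, then `g` and the
height are coordinates on the surface, and the horizontal part only depends on the first one. -/
lemma IsVerticalOn.exists_straightening (h : IsVerticalOn X U) {x₀ : E2} (hx₀ : x₀ ∈ U)
    {g : ℂ → ℝ} {W : Set ℂ} (hW : IsOpen W) (hg : ContDiffOn ℝ ∞ g W) (hx₀W : (X x₀).1 ∈ W)
    (hgx : ∃ v, fderiv ℝ g (X x₀).1 (fderiv ℝ X x₀ v).1 ≠ 0) :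
    ∃ (r : ℝ) (Ψ : OpenPartialHomeomorph E2 (ℝ × ℝ)) (c : ℝ → ℂ), 0 < r ∧ x₀ ∈ Ψ.source ∧
      Ψ.source ⊆ U ∧
      Ψ.target = Metric.ball (g (X x₀).1) r ×ˢ Metric.ball (X x₀).2 r ∧
      (∀ x ∈ Ψ.source, Ψ x = (g (X x).1, (X x).2) ∧ (X x).1 ∈ W ∧ (X x).1 = c (g (X x).1) ∧
        ∃ v, fderiv ℝ g (X x).1 (fderiv ℝ X x v).1 ≠ 0) ∧
      ContDiffOn ℝ ∞ Ψ.symm Ψ.target ∧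
      ContDiffOn ℝ ∞ c (Metric.ball (g (X x₀).1) r) ∧
      ∀ s ∈ Metric.ball (g (X x₀).1) r, g (c s) = s ∧ c s ∈ W ∧
        ∀ t ∈ Metric.ball (X x₀).2 r, X (Ψ.symm (s, t)) = (c s, t) := by
  set G : E2 → ℝ × ℝ := fun x => (g (X x).1, (X x).2) with hG
  have hZ : ∀ x ∈ U, ContDiffAt ℝ ∞ (fun x => (X x).1) x := fun x hx => (h.contDiffAt hx).fst
  have hN1 : ∀ᶠ x in 𝓝 x₀, x ∈ U ∧ (X x).1 ∈ W := by
    filter_upwards [h.isOpen.mem_nhds hx₀,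
      (hZ x₀ hx₀).continuousAt.preimage_mem_nhds (hW.mem_nhds hx₀W)] with x h1 h2 using ⟨h1, h2⟩
  have hgat : ∀ z ∈ W, ContDiffAt ℝ ∞ g z := fun z hz => hg.contDiffAt (hW.mem_nhds hz)
  have hGat : ∀ x, x ∈ U → (X x).1 ∈ W → ContDiffAt ℝ ∞ G x := fun x hx hxW =>
    ((hgat _ hxW).comp x (hZ x hx)).prodMk (h.contDiffAt hx).snd
  have hGd : ∀ x, x ∈ U → (X x).1 ∈ W → HasFDerivAt G
      ((((fderiv ℝ g (X x).1).comp ((ContinuousLinearMap.fst ℝ ℂ ℝ).comp (fderiv ℝ X x)))).prod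
        ((ContinuousLinearMap.snd ℝ ℂ ℝ).comp (fderiv ℝ X x))) x := fun x hx hxW => by
    have hXd := ((h.contDiffAt hx).differentiableAt (by simp)).hasFDerivAt
    have hgd := ((hgat _ hxW).differentiableAt (by simp)).hasFDerivAt
    exact (hgd.comp x hXd.fst).prodMk hXd.snd
  have hN2 : ∀ᶠ x in 𝓝 x₀, ∃ v, fderiv ℝ g (X x).1 (fderiv ℝ X x v).1 ≠ 0 := by
    obtain ⟨v, hv⟩ := hgx
    have hc : ContinuousAt (fun x => fderiv ℝ g (X x).1 (fderiv ℝ X x v).1) x₀ := by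
      have h1 : ContinuousAt (fun x => fderiv ℝ g (X x).1) x₀ :=
        ContinuousAt.comp (f := fun x => (X x).1)
          ((hgat _ hx₀W).fderiv_right (m := ∞) (by simp)).continuousAt
          (hZ x₀ hx₀).continuousAt
      have h2 : ContinuousAt (fun x => fderiv ℝ X x v) x₀ :=
        (((h.contDiffAt hx₀).fderiv_right (m := ∞) (by simp)).clm_apply
          contDiffAt_const).continuousAt
      exact h1.clm_apply h2.fst
    filter_upwards [hc.eventually_ne hv] with x hx using ⟨v, hx⟩
  obtain ⟨N, hN, hNo, hxN⟩ := eventually_nhds_iff.1 (hN1.and hN2)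
  -- The differential of `(g, height)` sends the vertical direction to `(0, 1)` and some vector to
  -- one with nonzero first component, so it is invertible on the whole of `N`, not only at `x₀`.
  have hequiv : ∀ x ∈ N, ∃ L : E2 ≃L[ℝ] ℝ × ℝ, HasFDerivAt G (L : E2 →L[ℝ] ℝ × ℝ) x ∧
      ∀ v, L v = (fderiv ℝ g (X x).1 (fderiv ℝ X x v).1, (fderiv ℝ X x v).2) := by
    intro x hx
    obtain ⟨⟨hxU, hxW⟩, u, hu⟩ := hN x hx
    obtain ⟨T, hT⟩ := h.vertical x hxU
    have hb := bijective_of_vertical (L := (((fderiv ℝ g (X x).1).comp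
        ((ContinuousLinearMap.fst ℝ ℂ ℝ).comp (fderiv ℝ X x)))).prod
        ((ContinuousLinearMap.snd ℝ ℂ ℝ).comp (fderiv ℝ X x))) (T := T) (u := u)
        (by simp [hT]) (by simpa using hu)
    refine ⟨ContinuousLinearEquiv.ofBijective _ (LinearMap.ker_eq_bot.2 hb.1)
      (LinearMap.range_eq_top.2 hb.2), ?_, fun v => rfl⟩
    exact hGd x hxU hxW
  obtain ⟨L₀, hL₀, -⟩ := hequiv x₀ hxN
  have hG₀ : ContDiffAt ℝ ∞ G x₀ := hGat x₀ hx₀ hx₀W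
  set Φ := (hG₀.toOpenPartialHomeomorph G hL₀ (by simp)).restrOpen N hNo with hΦ
  have hΦG : ∀ x, Φ x = G x := fun x => rfl
  have hΦx : x₀ ∈ Φ.source := ⟨hG₀.mem_toOpenPartialHomeomorph_source hL₀ (by simp), hxN⟩
  have hΦN : Φ.source ⊆ N := fun x hx => hx.2
  obtain ⟨r, hr, hrt⟩ := Metric.isOpen_iff.1 Φ.open_target _ (Φ.map_source hΦx)
  -- Balls of `ℝ × ℝ` are squares for the product metric; cutting the target down to one makes all
  -- vertical slices connected.
  set Ψ := (Φ.symm.restrOpen (Metric.ball (Φ x₀) r) Metric.isOpen_ball).symm with hΨ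
  have hball : Metric.ball (Φ x₀) r = Metric.ball (g (X x₀).1) r ×ˢ Metric.ball (X x₀).2 r :=
    (ball_prod_same _ _ _).symm
  have hΨt : Ψ.target = Metric.ball (g (X x₀).1) r ×ˢ Metric.ball (X x₀).2 r := by
    rw [← hball]
    exact inter_eq_right.2 hrt
  have hΨΦ : ∀ x, Ψ x = G x := fun x => rfl
  have hΨsource : Ψ.source ⊆ N := fun x hx => by
    refine hΦN ?_
    have : x ∈ Φ.source := by
      have h3 := Ψ.map_source hx
      have h4 := Ψ.left_inv hx
      rw [← h4]
      have h5 : Ψ x ∈ Φ.target := by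
        rw [hΨt, ← hball] at h3; exact hrt h3
      exact Φ.map_target h5
    exact this
  have hxΨ : x₀ ∈ Ψ.source := by
    have h3 : Φ x₀ ∈ Ψ.target := by rw [hΨt, ← hball]; exact Metric.mem_ball_self hr
    have h4 := Ψ.map_target h3
    have h5 : Ψ.symm (Φ x₀) = x₀ := Φ.left_inv hΦx
    rwa [h5] at h4
  have hsymm : ∀ y ∈ Ψ.target, ContDiffAt ℝ ∞ Ψ.symm y := fun y hy => by
    have hyN := hΨsource (Ψ.map_target hy)
    obtain ⟨L, hL, -⟩ := hequiv _ hyN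
    exact Ψ.contDiffAt_symm hy hL (hGat _ (hN _ hyN).1.1 (hN _ hyN).1.2)
  have hinv : ∀ y ∈ Ψ.target, G (Ψ.symm y) = y := fun y hy => Ψ.right_inv hy
  set c : ℝ → ℂ := fun s => (X (Ψ.symm (s, (X x₀).2))).1 with hc
  -- Moving `t` alone means moving along the vertical tangent vector `T`, whose horizontal part is
  -- zero.
  have hconst : ∀ s ∈ Metric.ball (g (X x₀).1) r, ∀ t ∈ Metric.ball (X x₀).2 r,
      (X (Ψ.symm (s, t))).1 = c s := by
    intro s hs t ht
    have hd : ∀ t ∈ Metric.ball (X x₀).2 r,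
        HasDerivAt (fun t => (X (Ψ.symm (s, t))).1) 0 t := by
      intro t ht
      have hy : (s, t) ∈ Ψ.target := by rw [hΨt]; exact ⟨hs, ht⟩
      have hyN := hΨsource (Ψ.map_target hy)
      obtain ⟨L, hL, hLv⟩ := hequiv _ hyN
      obtain ⟨T, hT⟩ := h.vertical _ (hN _ hyN).1.1
      have hLT : L.symm (0, 1) = T := by
        rw [ContinuousLinearEquiv.symm_apply_eq, hLv, hT]
        simp
      have h1 : HasFDerivAt Ψ.symm (L.symm : ℝ × ℝ →L[ℝ] E2) (s, t) :=
        Ψ.hasFDerivAt_symm hy hL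
      have h2 : HasDerivAt (fun t : ℝ => (s, t)) ((0, 1) : ℝ × ℝ) t :=
        (hasDerivAt_const t s).prodMk (hasDerivAt_id t)
      have h3 := h1.comp_hasDerivAt t h2
      have h4 := (((h.contDiffAt (hN _ hyN).1.1).differentiableAt
        (by simp)).hasFDerivAt).comp_hasDerivAt t h3
      have h5 := (ContinuousLinearMap.fst ℝ ℂ ℝ).hasFDerivAt.comp_hasDerivAt t h4
      refine HasDerivAt.congr_deriv (f := _) h5 ?_
      simp [hLT, hT]
    exact Metric.isOpen_ball.is_const_of_deriv_eq_zero (convex_ball _ _).isPreconnected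
      (fun t ht => (hd t ht).differentiableAt.differentiableWithinAt)
      (fun t ht => (hd t ht).deriv) ht (Metric.mem_ball_self hr)
  refine ⟨r, Ψ, c, hr, hxΨ, fun x hx => (hN x (hΨsource hx)).1.1, hΨt, fun x hx =>
    ⟨rfl, (hN x (hΨsource hx)).1.2, ?_, (hN x (hΨsource hx)).2⟩,
    fun y hy => (hsymm y hy).contDiffWithinAt, ?_, ?_⟩
  · have hy : ((g (X x).1, (X x).2) : ℝ × ℝ) ∈ Ψ.target := Ψ.map_source hx
    have hy' := hy
    rw [hΨt] at hy'
    rw [← hconst _ hy'.1 _ hy'.2]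
    have h4 : Ψ.symm (g (X x).1, (X x).2) = x := Ψ.left_inv hx
    rw [h4]
  · intro s hs
    have hy : (s, (X x₀).2) ∈ Ψ.target := by
      rw [hΨt]; exact ⟨hs, Metric.mem_ball_self hr⟩
    have h1 : ContDiffAt ℝ ∞ (fun s : ℝ => Ψ.symm (s, (X x₀).2)) s :=
      (hsymm _ hy).comp s (contDiffAt_id.prodMk contDiffAt_const)
    exact ((hZ _ (hN _ (hΨsource (Ψ.map_target hy))).1.1).comp s h1).contDiffWithinAt
  · intro s hs
    have hy : (s, (X x₀).2) ∈ Ψ.target := by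
      rw [hΨt]; exact ⟨hs, Metric.mem_ball_self hr⟩
    refine ⟨congrArg Prod.fst (hinv _ hy), (hN _ (hΨsource (Ψ.map_target hy))).1.2, ?_⟩
    intro t ht
    have hy : (s, t) ∈ Ψ.target := by rw [hΨt]; exact ⟨hs, ht⟩
    have h2 : (X (Ψ.symm (s, t))).2 = t := congrArg Prod.snd (hinv _ hy)
    exact Prod.ext (hconst s hs t ht) h2

/-- Supplies the arc length function of a curve as a smooth primitive of its hyperbolic speed. -/
lemma exists_contDiffOn_primitive {φ : ℝ → ℝ} {a r : ℝ}
    (hφ : ContDiffOn ℝ ∞ φ (Metric.ball a r)) :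
    ∃ Λ : ℝ → ℝ, Λ a = 0 ∧ ContDiffOn ℝ ∞ Λ (Metric.ball a r) ∧
      ∀ s ∈ Metric.ball a r, HasDerivAt Λ (φ s) s := by
  have hd : ∀ s ∈ Metric.ball a r, HasDerivAt (fun s => ∫ u in a..s, φ u) (φ s) s := by
    intro s hs
    have ha : a ∈ Metric.ball a r := Metric.mem_ball_self (Metric.pos_of_mem_ball hs)
    have hsub : uIcc a s ⊆ Metric.ball a r :=
      segment_eq_uIcc a s ▸ (convex_ball a r).segment_subset ha hs
    exact intervalIntegral.integral_hasDerivAt_right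
      ((hφ.continuousOn.mono hsub).intervalIntegrable)
      (hφ.continuousOn.stronglyMeasurableAtFilter Metric.isOpen_ball s hs)
      (hφ.continuousOn.continuousAt (Metric.isOpen_ball.mem_nhds hs))
  refine ⟨fun s => ∫ u in a..s, φ u, intervalIntegral.integral_same, ?_, hd⟩
  rw [contDiffOn_infty_iff_deriv_of_isOpen Metric.isOpen_ball]
  refine ⟨fun s hs => (hd s hs).differentiableAt.differentiableWithinAt, ?_⟩
  exact hφ.congr fun s hs => (hd s hs).deriv

variable {X : E2 → ℂ × ℝ} {U : Set E2}

/-- A vertical surface is locally the product of a unit speed curve with a vertical segment. -/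
lemma IsVerticalOn.exists_unit_speed_straightening (h : IsVerticalOn X U) {x₀ : E2}
    (hx₀ : x₀ ∈ U) :
    ∃ (r : ℝ) (Ψ : OpenPartialHomeomorph E2 (ℝ × ℝ)) (c : ℝ → ℂ) (g : ℂ → ℝ),
      0 < r ∧ x₀ ∈ Ψ.source ∧ Ψ.source ⊆ U ∧ Ψ x₀ = (0, (X x₀).2) ∧
      Ψ.target = Metric.ball 0 r ×ˢ Metric.ball (X x₀).2 r ∧
      (∀ x ∈ Ψ.source, Ψ x = (g (X x).1, (X x).2) ∧ DifferentiableAt ℝ g (X x).1 ∧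
        ContDiffAt ℝ ∞ (fun y => g (X y).1) x ∧ (X x).1 = c (g (X x).1) ∧
        ∃ v, fderiv ℝ (fun y => g (X y).1) x v ≠ 0) ∧
      ContDiffOn ℝ ∞ Ψ.symm Ψ.target ∧
      ContDiffOn ℝ ∞ c (Metric.ball 0 r) ∧
      ∀ s ∈ Metric.ball (0 : ℝ) r, g (c s) = s ∧ DifferentiableAt ℝ g (c s) ∧
        ‖deriv c s‖ = (c s).im ∧ 0 < (c s).im ∧
        ∀ t ∈ Metric.ball (X x₀).2 r, X (Ψ.symm (s, t)) = (c s, t) := by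
  obtain ⟨v, hv⟩ := h.exists_fderiv_fst_ne_zero hx₀
  obtain ⟨ℓ, hℓ⟩ : ∃ ℓ : ℂ →L[ℝ] ℝ, ℓ (fderiv ℝ X x₀ v).1 ≠ 0 := by
    by_contra! hc
    exact hv (Complex.ext (hc Complex.reCLM) (hc Complex.imCLM))
  -- The surface is straightened twice: with a linear coordinate `ℓ`, which yields a regular curve
  -- `c₁`, and then with the hyperbolic arc length of `c₁`, viewed as the function `Λ ∘ ℓ` on the
  -- half-plane.
  obtain ⟨r₁, Ψ₁, c₁, hr₁, hx₁, hU₁, ht₁, hs₁, -, hc₁, hp₁⟩ :=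
    h.exists_straightening hx₀ isOpen_univ ℓ.contDiff.contDiffOn (mem_univ _)
      ⟨v, by rwa [ℓ.fderiv]⟩
  have hc₁at : ∀ s ∈ Metric.ball (ℓ (X x₀).1) r₁, ContDiffAt ℝ ∞ c₁ s := fun s hs =>
    hc₁.contDiffAt (Metric.isOpen_ball.mem_nhds hs)
  have hdc₁ : ∀ s ∈ Metric.ball (ℓ (X x₀).1) r₁, deriv c₁ s ≠ 0 := by
    intro s hs h0
    have h1 : HasDerivAt (fun s => ℓ (c₁ s)) (ℓ (deriv c₁ s)) s :=
      ℓ.hasFDerivAt.comp_hasDerivAt s ((hc₁at s hs).differentiableAt (by simp)).hasDerivAt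
    have h2 : HasDerivAt (fun s => ℓ (c₁ s)) 1 s :=
      (hasDerivAt_id s).congr_of_eventuallyEq (by
        filter_upwards [Metric.isOpen_ball.mem_nhds hs] with u hu using (hp₁ u hu).1)
    rw [h0, map_zero] at h1
    exact zero_ne_one (h1.unique h2)
  have him₁ : ∀ s ∈ Metric.ball (ℓ (X x₀).1) r₁, 0 < (c₁ s).im := by
    intro s hs
    have h1 := (hp₁ s hs).2.2 _ (Metric.mem_ball_self hr₁)
    have h2 : (s, (X x₀).2) ∈ Ψ₁.target := by
      rw [ht₁]; exact ⟨hs, Metric.mem_ball_self hr₁⟩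
    have h3 := h.im_pos _ (hU₁ (Ψ₁.map_target h2))
    rwa [h1] at h3
  have hφ : ContDiffOn ℝ ∞ (fun s => ‖deriv c₁ s‖ * ((c₁ s).im)⁻¹)
      (Metric.ball (ℓ (X x₀).1) r₁) := by
    have hd := ((contDiffOn_infty_iff_deriv_of_isOpen Metric.isOpen_ball).1 hc₁).2
    refine (hd.norm ℝ hdc₁).mul (ContDiffOn.inv ?_ fun s hs => (him₁ s hs).ne')
    exact Complex.imCLM.contDiff.comp_contDiffOn hc₁
  obtain ⟨Λ, hΛ0, hΛ, hΛd⟩ := exists_contDiffOn_primitive hφ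
  set g : ℂ → ℝ := fun z => Λ (ℓ z) with hg
  set W : Set ℂ := ℓ ⁻¹' Metric.ball (ℓ (X x₀).1) r₁ with hWdef
  have hW : IsOpen W := Metric.isOpen_ball.preimage ℓ.continuous
  have hgW : ContDiffOn ℝ ∞ g W := hΛ.comp ℓ.contDiff.contDiffOn fun z hz => hz
  have hgd : ∀ z ∈ W, HasFDerivAt g ((‖deriv c₁ (ℓ z)‖ * ((c₁ (ℓ z)).im)⁻¹) • ℓ) z :=
    fun z hz => (hΛd _ hz).comp_hasFDerivAt z ℓ.hasFDerivAt
  have hxW : (X x₀).1 ∈ W := Metric.mem_ball_self hr₁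
  have hV := h.mono Ψ₁.open_source hU₁
  have hgx : ∃ v, fderiv ℝ g (X x₀).1 (fderiv ℝ X x₀ v).1 ≠ 0 := by
    refine ⟨v, ?_⟩
    rw [(hgd _ hxW).fderiv]
    have h1 := hdc₁ _ hxW
    have h2 := (him₁ _ hxW).ne'
    simp [h1, h2, hℓ]
  obtain ⟨r, Ψ, c, hr, hx, hU, ht, hs, hsymm, hc, hp⟩ :=
    hV.exists_straightening hx₁ hW hgW hxW hgx
  have hg0 : g (X x₀).1 = 0 := hΛ0
  rw [hg0] at ht hc hp
  have him : ∀ s ∈ Metric.ball (0 : ℝ) r, 0 < (c s).im ∧ c s = c₁ (ℓ (c s)) := by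
    intro s hs
    have h1 := (hp s hs).2.2 _ (Metric.mem_ball_self hr)
    have h2 : (s, (X x₀).2) ∈ Ψ.target := by
      rw [ht]; exact ⟨hs, Metric.mem_ball_self hr⟩
    have h3 := hV.im_pos _ (hU (Ψ.map_target h2))
    have h4 := (hs₁ _ (hU (Ψ.map_target h2))).2.2.1
    rw [h1] at h3 h4
    exact ⟨h3, h4⟩
  refine ⟨r, Ψ, c, g, hr, hx, hU.trans hU₁, ?_, ht, ?_, hsymm, hc, ?_⟩
  · rw [(hs x₀ hx).1, hg0]
  · intro x hxs
    have hgat : ContDiffAt ℝ ∞ g (X x).1 :=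
      hgW.contDiffAt (hW.mem_nhds (hs x hxs).2.1)
    have hXat := hV.contDiffAt (hU hxs)
    have hXfst : ContDiffAt ℝ ∞ (fun y => (X y).1) x := hXat.fst
    have hcomp : ContDiffAt ℝ ∞ (g ∘ fun y => (X y).1) x :=
      ContDiffAt.comp (g := g) x hgat hXfst
    refine ⟨(hs x hxs).1, hgat.differentiableAt (by simp), hcomp,
      (hs x hxs).2.2.1, ?_⟩
    obtain ⟨v, hv⟩ := (hs x hxs).2.2.2
    refine ⟨v, ?_⟩
    have := (hgat.differentiableAt (by simp)).hasFDerivAt.comp x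
      (hXat.differentiableAt (by simp)).hasFDerivAt.fst
    have h2 : fderiv ℝ (fun y => g (X y).1) x = _ := this.fderiv
    rw [h2]
    exact hv
  · intro s hsb
    have hcs := hc.contDiffAt (Metric.isOpen_ball.mem_nhds hsb)
    have hcW := (hp s hsb).2.1
    refine ⟨(hp s hsb).1, (hgd _ hcW).differentiableAt, ?_, (him s hsb).1,
      (hp s hsb).2.2⟩
    have hcd := (hcs.differentiableAt (by simp)).hasDerivAt
    have h1 : HasDerivAt (fun s => g (c s)) 1 s :=
      (hasDerivAt_id s).congr_of_eventuallyEq (by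
        filter_upwards [Metric.isOpen_ball.mem_nhds hsb] with u hu using (hp u hu).1)
    have h2 := h1.unique ((hgd _ hcW).comp_hasDerivAt s hcd)
    have hm : HasDerivAt (fun s => ℓ (c s)) (ℓ (deriv c s)) s :=
      ℓ.hasFDerivAt.comp_hasDerivAt s hcd
    have h3 : HasDerivAt c (ℓ (deriv c s) • deriv c₁ (ℓ (c s))) s := by
      refine HasDerivAt.congr_of_eventuallyEq
        (HasDerivAt.scomp s ((hc₁at _ hcW).differentiableAt (by simp)).hasDerivAt hm) ?_
      filter_upwards [Metric.isOpen_ball.mem_nhds hsb] with u hu using (him u hu).2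
    have h4 := hcd.unique h3
    have hpos := him₁ _ hcW
    have hnd : 0 < ‖deriv c₁ (ℓ (c s))‖ := norm_pos_iff.2 (hdc₁ _ hcW)
    rw [← (him s hsb).2] at hpos h2
    simp only [_root_.smul_apply, smul_eq_mul] at h2
    -- Differentiating `g (c s) = s` gives this product. It is positive, so `ℓ (deriv c s)` is
    -- positive too, and the norm of `c' = ℓ(c') c₁'` carries no sign ambiguity.
    have h5 : ‖deriv c₁ (ℓ (c s))‖ * ℓ (deriv c s) = (c s).im := by
      field_simp at h2
      linarith
    have h6 : 0 < ℓ (deriv c s) := by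
      by_contra hneg
      nlinarith
    rw [h4, norm_smul, Real.norm_of_nonneg h6.le, mul_comm]
    exact h5

/-- The covariant acceleration of a curve in the upper half-plane. -/
def acc (c : ℝ → ℂ) (s : ℝ) : ℂ :=
  deriv (deriv c) s + Complex.I * deriv c s ^ 2 / ((c s).im : ℂ)

lemma acc_congr {c d : ℝ → ℂ} {s : ℝ} (h : c =ᶠ[𝓝 s] d) : acc c s = acc d s := by
  simp only [acc, h.deriv.deriv.eq_of_nhds, h.deriv.eq_of_nhds, h.eq_of_nhds]

lemma contDiffAt_deriv {c : ℝ → ℂ} {s : ℝ} (hc : ContDiffAt ℝ ∞ c s) :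
    ContDiffAt ℝ ∞ (deriv c) s :=
  (hc.fderiv_right (m := ∞) (by simp)).clm_apply contDiffAt_const

/-- Differentiate the constant function `⟨c', c'⟩ = 1`, using compatibility of the connection with
the metric. -/
lemma acc_orthogonal {c : ℝ → ℂ} {s : ℝ} (hc : ContDiffAt ℝ ∞ c s) (hpos : 0 < (c s).im)
    (hspeed : ∀ᶠ u in 𝓝 s, ‖deriv c u‖ = (c u).im) :
    (acc c s).re * (deriv c s).re + (acc c s).im * (deriv c s).im = 0 := by
  have hd1 := (hc.differentiableAt (by simp)).hasDerivAt
  have hd2 : HasDerivAt (deriv c) (deriv (deriv c) s) s :=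
    ((contDiffAt_deriv hc).differentiableAt (by simp)).hasDerivAt
  have h1 := hasDerivAt_ambientInner (hd1.prodMk (hasDerivAt_const s (0 : ℝ)))
    (hd2.prodMk (hasDerivAt_const s (0 : ℝ))) (hd2.prodMk (hasDerivAt_const s (0 : ℝ))) hpos.ne'
  have hposu : ∀ᶠ u in 𝓝 s, 0 < (c u).im :=
    (Complex.continuous_im.continuousAt.comp hc.continuousAt).eventually (lt_mem_nhds hpos)
  have h2 : HasDerivAt (fun u => ambientInner (c u, (0 : ℝ)) (deriv c u, 0) (deriv c u, 0)) 0 s := by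
    refine (hasDerivAt_const s (1 : ℝ)).congr_of_eventuallyEq ?_
    filter_upwards [hspeed, hposu] with u hu hpu
    have : (deriv c u).re * (deriv c u).re + (deriv c u).im * (deriv c u).im = (c u).im ^ 2 := by
      rw [← hu, ← Complex.normSq_eq_norm_sq, Complex.normSq_apply]
    simp [ambientInner, this, hpu.ne']
  have h3 := h1.unique h2
  have e : ((deriv (deriv c) s, (0 : ℝ)) : ℂ × ℝ)
      + christoffel (c s, 0) (deriv c s, 0) (deriv c s, 0) = (acc c s, 0) := by
    simp only [christoffel, acc, Prod.mk_add_mk, add_zero]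
    congr 3
    ring
  rw [e] at h3
  simp only [ambientInner] at h3
  field_simp at h3
  linarith

lemma hasFDerivAt_comp_curve {σ : E2 → ℝ} {c : ℝ → ℂ} {y : E2} (hσ : DifferentiableAt ℝ σ y)
    (hc : DifferentiableAt ℝ c (σ y)) :
    HasFDerivAt (fun y => c (σ y)) ((fderiv ℝ σ y).smulRight (deriv c (σ y))) y := by
  refine (hc.hasFDerivAt.comp y hσ.hasFDerivAt).congr_fderiv ?_
  ext v; simp

/-- The horizontal part of `D_{∂ᵢ} ∂ⱼX` is `∂ᵢ∂ⱼσ c' + ∂ᵢσ ∂ⱼσ acc`. The normal is horizontal and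
orthogonal to `c'`, so only the normal component of the acceleration survives. -/
lemma secondForm_cylinder {X : E2 → ℂ × ℝ} {σ : E2 → ℝ} {c : ℝ → ℂ} {x : E2}
    (hX : ContDiffAt ℝ ∞ X x) (hσ : ∀ᶠ y in 𝓝 x, ContDiffAt ℝ ∞ σ y)
    (hc : ∀ᶠ s in 𝓝 (σ x), ContDiffAt ℝ ∞ c s)
    (hXc : ∀ᶠ y in 𝓝 x, (X y).1 = c (σ y) ∧ DifferentiableAt ℝ X y) (i j : Fin 2) :
    secondForm X x i j = (pd i σ x * pd j σ x) *
      ((Real.sqrt (ambientInner (X x) (crossNormal (X x) (pd 0 X x) (pd 1 X x))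
        (crossNormal (X x) (pd 0 X x) (pd 1 X x))))⁻¹ *
        (pd 0 σ x * (pd 1 X x).2 - pd 1 σ x * (pd 0 X x).2) *
        ((acc c (σ x)).re * (deriv c (σ x)).im - (acc c (σ x)).im * (deriv c (σ x)).re)
          / (X x).1.im ^ 2) := by
  have hσx := hσ.self_of_nhds
  have hcx := hc.self_of_nhds
  have hfst : ∀ {V : E2 → ℂ × ℝ} {y}, DifferentiableAt ℝ V y → ∀ k, (pd k V y).1
      = pd k (fun y => (V y).1) y := fun {V y} h k => by
    rw [pd, pd, h.hasFDerivAt.fst.fderiv]; rfl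
  have hpd : ∀ k, ∀ᶠ y in 𝓝 x, (pd k X y).1 = pd k σ y • deriv c (σ y) := by
    intro k
    filter_upwards [hXc.eventually_nhds, hσ, hσx.continuousAt.eventually hc] with y h1 h2 h3
    have h4 := hasFDerivAt_comp_curve (h2.differentiableAt (by simp))
      (h3.differentiableAt (by simp))
    have h5 : pd k (fun y => (X y).1) y = pd k (fun y => c (σ y)) y :=
      (eventuallyEq_pd (h1.mono fun _ h => h.1) k).self_of_nhds
    rw [hfst h1.self_of_nhds.2, h5, pd, h4.fderiv]
    rfl
  have hpd2 : ∀ k l, (pd k (pd l X) x).1 = pd k (pd l σ) x • deriv c (σ x)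
      + (pd k σ x * pd l σ x) • deriv (deriv c) (σ x) := by
    intro k l
    have h1 := hasFDerivAt_comp_curve (hσx.differentiableAt (by simp))
      ((contDiffAt_deriv hcx).differentiableAt (by simp))
    have h2 := ((contDiffAt_pd hσx l).differentiableAt (by simp)).hasFDerivAt.fun_smul h1
    rw [hfst ((contDiffAt_pd hX l).differentiableAt (by simp)),
      (eventuallyEq_pd (hpd l) k).self_of_nhds, pd, h2.fderiv]
    simp [pd]
    ring
  have hx0 := (hpd 0).self_of_nhds
  have hx1 := (hpd 1).self_of_nhds
  have hXx := hXc.self_of_nhds.1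
  have hcov : (covDeriv X i j x).1 = pd i (pd j σ) x • deriv c (σ x)
      + (pd i σ x * pd j σ x) • acc c (σ x) := by
    rw [covDeriv, Prod.fst_add, hpd2, christoffel, (hpd i).self_of_nhds, (hpd j).self_of_nhds,
      hXx, acc]
    simp only [Complex.real_smul]
    push_cast
    ring
  simp only [secondForm, Matrix.of_apply, unitNormal, ambientInner_smul_right]
  rw [mul_comm (pd i σ x * pd j σ x), mul_div_assoc, mul_assoc, mul_assoc]
  congr 1
  simp only [ambientInner, crossNormal, hcov, hx0, hx1]
  simp
  ring

/-! ### Planar points as zeros of the acceleration of the base curve. -/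

section Planar

variable {M : Type*} [TopologicalSpace M] [ChartedSpace E2 M] [IsManifold (𝓡 2) ∞ M]
  [Bundle.RiemannianBundle (fun p : M => TangentSpace (𝓡 2) p)]

lemma planar_iff_acc_eq_zero {f : M → ℍ × ℝ} (hf : IsIsometricImmersion f) {p : M}
    (hext : extrinsicCurvature f p = 0) {σ : E2 → ℝ} {c : ℝ → ℂ}
    (hσ : ∀ᶠ y in 𝓝 (extChartAt (𝓡 2) p p), ContDiffAt ℝ ∞ σ y)
    (hc : ∀ᶠ s in 𝓝 (σ (extChartAt (𝓡 2) p p)), ContDiffAt ℝ ∞ c s ∧ ‖deriv c s‖ = (c s).im)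
    (hXc : ∀ᶠ y in 𝓝 (extChartAt (𝓡 2) p p), (localParam f p y).1 = c (σ y))
    (hσ0 : ∃ v, fderiv ℝ σ (extChartAt (𝓡 2) p p) v ≠ 0) :
    p ∈ planarPoints f ↔ acc c (σ (extChartAt (𝓡 2) p p)) = 0 := by
  rw [planar_iff_secondForm_eq_zero hf hext]
  have hx := mem_extChartAt_target (I := 𝓡 2) p
  have hXe := eventually_contDiffAt_localParam hf p hx
  have hpos := localParam_im_pos f p (extChartAt (𝓡 2) p p)
  have key := secondForm_cylinder hXe.self_of_nhds hσ (hc.mono fun _ h => h.1)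
    (hXc.and (hXe.mono fun _ h => h.differentiableAt (by simp)))
  have hd := (firstForm_localParam_pos hf p hx).2
  have hcross := ambientInner_crossNormal_self hpos.ne'
    (pd 0 (localParam f p) (extChartAt (𝓡 2) p p)) (pd 1 (localParam f p) (extChartAt (𝓡 2) p p))
  generalize extChartAt (𝓡 2) p p = x at *
  have hXx := hXc.self_of_nhds
  constructor
  · intro h
    obtain ⟨i, hi⟩ : ∃ i : Fin 2, pd i σ x ≠ 0 := by
      by_contra! h0
      obtain ⟨v, hv⟩ := hσ0
      apply hv
      have : v = v 0 • EuclideanSpace.single 0 (1 : ℝ) + v 1 • EuclideanSpace.single 1 (1 : ℝ) := by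
        ext i; fin_cases i <;> simp
      rw [this, map_add, map_smul, map_smul]
      have h0' : ∀ i, fderiv ℝ σ x (EuclideanSpace.single i 1) = 0 := h0
      simp [h0']
    have hii := key i i
    have hn : 0 < ambientInner (localParam f p x)
        (crossNormal (localParam f p x) (pd 0 (localParam f p) x) (pd 1 (localParam f p) x))
        (crossNormal (localParam f p x) (pd 0 (localParam f p) x) (pd 1 (localParam f p) x)) := by
      rw [hcross]
      rw [Matrix.det_fin_two] at hd
      simp only [firstForm, Matrix.of_apply,
        ambientInner_comm _ (pd 1 (localParam f p) x) (pd 0 (localParam f p) x)] at hd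
      linarith
    -- This is the Jacobian of `(σ, height)`. If it vanished, so would the cross product of the
    -- coordinate vectors.
    have hJ : pd 0 σ x * (pd 1 (localParam f p) x).2
        - pd 1 σ x * (pd 0 (localParam f p) x).2 ≠ 0 := by
      intro hJ
      have hfst : ∀ k, (pd k (localParam f p) x).1 = pd k σ x • deriv c (σ x) := by
        intro k
        have h4 := hasFDerivAt_comp_curve (hσ.self_of_nhds.differentiableAt (by simp))
          (hc.self_of_nhds.1.differentiableAt (by simp))
        have h5 : pd k (fun y => (localParam f p y).1) x = pd k (fun y => c (σ y)) x :=
          (eventuallyEq_pd hXc k).self_of_nhds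
        have h6 := (hXe.self_of_nhds.differentiableAt (by simp)).hasFDerivAt.fst.fderiv
        rw [show pd k (fun y => c (σ y)) x = pd k σ x • deriv c (σ x) by
          rw [pd, h4.fderiv]; rfl] at h5
        rw [← show pd k (fun y => (localParam f p y).1) x = (pd k (localParam f p) x).1 by
          rw [pd, h6]; rfl]
        exact h5
      have : crossNormal (localParam f p x) (pd 0 (localParam f p) x)
          (pd 1 (localParam f p) x) = 0 := by
        ext1
        · apply Complex.ext
          · simp [crossNormal, hfst]
            linear_combination (deriv c (σ x)).im * hJ
          · simp [crossNormal, hfst]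
            linear_combination -(deriv c (σ x)).re * hJ
        · simp [crossNormal, hfst]
          left; ring
      rw [this] at hn
      simp [ambientInner] at hn
    rw [h, Matrix.zero_apply, zero_eq_mul, or_iff_right (mul_ne_zero hi hi),
      div_eq_zero_iff, or_iff_left (by positivity), mul_eq_zero,
      or_iff_right (mul_ne_zero (inv_ne_zero (Real.sqrt_pos.2 hn).ne') hJ)] at hii
    have hcpos : 0 < (c (σ x)).im := by rwa [← hXx]
    have horth := acc_orthogonal hc.self_of_nhds.1 hcpos (hc.mono fun _ h => h.2)
    have hsp := hc.self_of_nhds.2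
    have hsq : (deriv c (σ x)).re ^ 2 + (deriv c (σ x)).im ^ 2 ≠ 0 := by
      have : (deriv c (σ x)).re ^ 2 + (deriv c (σ x)).im ^ 2 = (c (σ x)).im ^ 2 := by
        rw [← hsp, ← Complex.normSq_eq_norm_sq, Complex.normSq_apply]; ring
      rw [this]; positivity
    -- The acceleration is orthogonal to `c'` by unit speed (`horth`) and parallel to it by the
    -- vanishing second form (`hii`); as `c' ≠ 0`, it is zero.
    apply Complex.ext
    · apply mul_left_cancel₀ hsq
      simp only [Complex.zero_re]
      linear_combination (deriv c (σ x)).re * horth + (deriv c (σ x)).im * hii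
    · apply mul_left_cancel₀ hsq
      simp only [Complex.zero_im]
      linear_combination (deriv c (σ x)).im * horth - (deriv c (σ x)).re * hii
  · intro h
    ext i j
    rw [key, h]
    simp

end Planar

/-! ### Product neighbourhoods in the surface. -/

section Box

variable {M : Type*} [MetricSpace M] [ChartedSpace E2 M]
  [Bundle.RiemannianBundle (fun p : M => TangentSpace (𝓡 2) p)]

/-- A product neighbourhood of `p`: the curve `c` has unit speed, `g` is a left inverse of it, and
`Θ = (g ∘ f.1, f.2)` identifies a neighbourhood of `p` with a square in such a way that `f` becomes
`(s, t) ↦ (c s, t)`. -/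
structure IsBox (f : M → ℍ × ℝ) (p : M) (r : ℝ) (Θ : OpenPartialHomeomorph M (ℝ × ℝ))
    (c : ℝ → ℂ) (g : ℂ → ℝ) : Prop where
  pos : 0 < r
  mem : p ∈ Θ.source
  target : Θ.target = Metric.ball 0 r ×ˢ Metric.ball (f p).2 r
  apply_center : g (f p).1 = 0
  apply : ∀ q ∈ Θ.source, Θ q = (g (f q).1, (f q).2)
  param : ∀ s ∈ Metric.ball (0 : ℝ) r, ∀ t ∈ Metric.ball (f p).2 r,
    coord (f (Θ.symm (s, t))) = (c s, t)
  smooth : ContDiffOn ℝ ∞ c (Metric.ball 0 r)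
  speed : ∀ s ∈ Metric.ball (0 : ℝ) r, ‖deriv c s‖ = (c s).im
  differentiable : ∀ s ∈ Metric.ball (0 : ℝ) r, DifferentiableAt ℝ g (c s)
  lipschitz : ∀ x ∈ Θ.target, ∀ y ∈ Θ.target,
    dist (Θ.symm x) (Θ.symm y) ≤ |x.1 - y.1| + |x.2 - y.2|
  planar : p ∈ planarPoints f ↔ acc c 0 = 0

-- The Riemannian distance is at most the length of any path, and lengths can be measured after
-- applying `f`. This converts unit speed in `ℍ × ℝ` into a Lipschitz bound in `M`, the form in
-- which completeness is used.
variable [IsRiemannianManifold (𝓡 2) M]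

lemma dist_le_of_unit_speed {f : M → ℍ × ℝ} (hf : IsIsometricImmersion f) {γ : ℝ → M} {a b : ℝ}
    (hab : a ≤ b) (hγ : ContMDiffOn 𝓘(ℝ, ℝ) (𝓡 2) 1 γ (Icc a b))
    (hspeed : ∀ t ∈ Ioo a b, ∃ w : ℂ × ℝ, HasDerivAt (fun t => coord (f (γ t))) w t ∧
      ambientInner (coord (f (γ t))) w w = 1) :
    dist (γ a) (γ b) ≤ b - a := by
  have h1 : edist (γ a) (γ b) ≤ Manifold.pathELength (𝓡 2) γ a b := by
    rw [IsRiemannianManifold.out (I := 𝓡 2) (γ a) (γ b)]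
    exact Manifold.riemannianEDist_le_pathELength hγ rfl rfl hab
  have h2 : Manifold.pathELength (𝓡 2) γ a b = ENNReal.ofReal (b - a) := by
    rw [Manifold.pathELength_eq_lintegral_mfderiv_Ioo,
      MeasureTheory.setLIntegral_congr_fun (g := fun _ => 1) measurableSet_Ioo]
    · simp
    intro t ht
    have hmd : MDifferentiableAt 𝓘(ℝ, ℝ) (𝓡 2) γ t :=
      (hγ.contMDiffAt (Icc_mem_nhds ht.1 ht.2)).mdifferentiableAt (by simp)
    obtain ⟨w, hw, hw1⟩ := hspeed t ht
    have h3 : mfderiv (𝓡 2) 𝓘(ℝ, ℂ × ℝ) (coord ∘ f) (γ t) (mfderiv 𝓘(ℝ, ℝ) (𝓡 2) γ t (1 : ℝ))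
        = w := by
      have h4 := mfderiv_comp t (hf.smooth.mdifferentiableAt (by simp)) hmd
      have h5 : mfderiv 𝓘(ℝ, ℝ) 𝓘(ℝ, ℂ × ℝ) ((coord ∘ f) ∘ γ) t (1 : ℝ) = w := by
        rw [mfderiv_eq_fderiv]
        have : HasFDerivAt ((coord ∘ f) ∘ γ) _ t := hw.hasFDerivAt
        rw [this.fderiv]
        exact one_smul ℝ w
      rw [h4] at h5
      exact h5
    have h6 := hf.isometric (γ t) (mfderiv 𝓘(ℝ, ℝ) (𝓡 2) γ t (1 : ℝ))
      (mfderiv 𝓘(ℝ, ℝ) (𝓡 2) γ t (1 : ℝ))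
    rw [h3, hw1, real_inner_self_eq_norm_sq] at h6
    have h7 : ‖mfderiv 𝓘(ℝ, ℝ) (𝓡 2) γ t (1 : ℝ)‖ = 1 := by
      have := norm_nonneg (mfderiv 𝓘(ℝ, ℝ) (𝓡 2) γ t (1 : ℝ))
      nlinarith
    change ‖mfderiv 𝓘(ℝ, ℝ) (𝓡 2) γ t (1 : ℝ)‖ₑ = 1
    rw [← ofReal_norm, h7, ENNReal.ofReal_one]
  rw [h2, edist_dist] at h1
  exact (ENNReal.ofReal_le_ofReal_iff (by linarith)).1 h1

lemma dist_le_of_unit_speed' {f : M → ℍ × ℝ} (hf : IsIsometricImmersion f) {γ : ℝ → M} {a b : ℝ}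
    (hγ : ContMDiffOn 𝓘(ℝ, ℝ) (𝓡 2) 1 γ (uIcc a b))
    (hspeed : ∀ t ∈ uIcc a b, ∃ w : ℂ × ℝ, HasDerivAt (fun t => coord (f (γ t))) w t ∧
      ambientInner (coord (f (γ t))) w w = 1) :
    dist (γ a) (γ b) ≤ |a - b| := by
  rcases le_total a b with hab | hab
  · rw [uIcc_of_le hab] at hγ hspeed
    rw [abs_sub_comm, abs_of_nonneg (by linarith)]
    exact dist_le_of_unit_speed hf hab hγ fun t ht => hspeed t (Ioo_subset_Icc_self ht)
  · rw [uIcc_of_ge hab] at hγ hspeed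
    rw [dist_comm, abs_of_nonneg (by linarith)]
    exact dist_le_of_unit_speed hf hab hγ fun t ht => hspeed t (Ioo_subset_Icc_self ht)

lemma exists_isBox [IsManifold (𝓡 2) ∞ M] {f : M → ℍ × ℝ} (hf : IsIsometricImmersion f)
    (hK : ∀ p : M, gaussianCurvature p = 0) (hext : ∀ p : M, extrinsicCurvature f p = 0) (p : M) :
    ∃ r Θ c g, IsBox f p r Θ c g := by
  have hx₀ := mem_extChartAt_target (I := 𝓡 2) p
  have hvert : IsVerticalOn (localParam f p) (extChartAt (𝓡 2) p).target :=
    ⟨isOpen_extChartAt_target p, contDiffOn_localParam hf.smooth p,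
      fun x _ => localParam_im_pos f p x, fun x hx v hv => fderiv_localParam_injective hf p hx hv,
      fun x hx => exists_fderiv_localParam_eq_vertical hf hK hext p hx⟩
  obtain ⟨r, Ψ, c, g, hr, hx, hU, hΨx, ht, hs, hsymm, hc, hp⟩ :=
    hvert.exists_unit_speed_straightening hx₀
  have hX₀ : localParam f p (extChartAt (𝓡 2) p p) = coord (f p) := by
    rw [localParam, extChartAt_to_inv]
  have hX₀2 : (localParam f p (extChartAt (𝓡 2) p p)).2 = (f p).2 := by rw [hX₀]; rfl
  have hX₀1 : (localParam f p (extChartAt (𝓡 2) p p)).1 = (f p).1 := by rw [hX₀]; rfl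
  rw [hX₀2] at hΨx ht hp
  set Θ := (chartAt E2 p).trans Ψ with hΘ
  have hchart : ∀ q, extChartAt (𝓡 2) p q = chartAt E2 p q := fun q => rfl
  have hchart' : ∀ q, (extChartAt (𝓡 2) p).symm q = (chartAt E2 p).symm q := fun q => rfl
  have hctarget : (extChartAt (𝓡 2) p).target = (chartAt E2 p).target := by simp [mfld_simps]
  have hΘapp : ∀ q, Θ q = Ψ (chartAt E2 p q) := fun q => rfl
  have hΘsymm : ∀ y, Θ.symm y = (extChartAt (𝓡 2) p).symm (Ψ.symm y) := fun y => rfl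
  have hΘs : ∀ q, q ∈ Θ.source ↔ q ∈ (chartAt E2 p).source ∧ chartAt E2 p q ∈ Ψ.source := by
    intro q; simp [hΘ]
  have hΘt : Θ.target = Metric.ball 0 r ×ˢ Metric.ball (f p).2 r := by
    rw [← ht]
    simp only [hΘ, mfld_simps]
    exact inter_eq_left.2 fun y hy => hctarget ▸ hU (Ψ.map_target hy)
  have hlocal : ∀ q ∈ Θ.source, localParam f p (chartAt E2 p q) = coord (f q) := by
    intro q hq
    rw [localParam, hchart', (chartAt E2 p).left_inv ((hΘs q).1 hq).1]
  have hparam : ∀ s ∈ Metric.ball (0 : ℝ) r, ∀ t ∈ Metric.ball (f p).2 r,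
      coord (f (Θ.symm (s, t))) = (c s, t) := fun s hs t ht => (hp s hs).2.2.2.2 t ht
  have hΘsm : ContMDiffOn 𝓘(ℝ, ℝ × ℝ) (𝓡 2) ∞ Θ.symm Θ.target := by
    have h1 : ContMDiffOn 𝓘(ℝ, ℝ × ℝ) 𝓘(ℝ, E2) ∞ Ψ.symm Θ.target := by
      rw [contMDiffOn_iff_contDiffOn, hΘt, ← ht]; exact hsymm
    refine (contMDiffOn_extChartAt_symm p).comp h1 fun y hy => ?_
    rw [hΘt, ← ht] at hy
    exact hU (Ψ.map_target hy)
  have hcd : ∀ s ∈ Metric.ball (0 : ℝ) r, HasDerivAt c (deriv c s) s := fun s hs =>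
    ((hc.contDiffAt (Metric.isOpen_ball.mem_nhds hs)).differentiableAt (by simp)).hasDerivAt
  have hcsq : ∀ s ∈ Metric.ball (0 : ℝ) r,
      (deriv c s).re * (deriv c s).re + (deriv c s).im * (deriv c s).im = (c s).im ^ 2 := by
    intro s hs
    rw [← (hp s hs).2.2.1, ← Complex.normSq_eq_norm_sq, Complex.normSq_apply]
  -- Horizontal and vertical segments of the square have unit speed; an L-shaped path then gives the
  -- `ℓ¹` Lipschitz bound for `Θ.symm`.
  have hlip1 : ∀ s ∈ Metric.ball (0 : ℝ) r, ∀ s' ∈ Metric.ball (0 : ℝ) r,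
      ∀ t ∈ Metric.ball (f p).2 r, dist (Θ.symm (s, t)) (Θ.symm (s', t)) ≤ |s - s'| := by
    intro s hs s' hs' t ht'
    have hsub : uIcc s s' ⊆ Metric.ball 0 r :=
      segment_eq_uIcc s s' ▸ (convex_ball 0 r).segment_subset hs hs'
    refine dist_le_of_unit_speed' hf (γ := fun s => Θ.symm (s, t)) ?_ ?_
    · refine (hΘsm.of_le (by simp)).comp ?_ fun u hu => ?_
      · rw [contMDiffOn_iff_contDiffOn]
        exact contDiffOn_id.prodMk contDiffOn_const
      · rw [hΘt]; exact ⟨hsub hu, ht'⟩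
    · intro u hu
      have hu' := hsub hu
      refine ⟨(deriv c u, 0), ?_, ?_⟩
      · refine ((hcd u hu').prodMk (hasDerivAt_const u t)).congr_of_eventuallyEq ?_
        filter_upwards [Metric.isOpen_ball.mem_nhds hu'] with v hv using hparam v hv t ht'
      · simp only [hparam u hu' t ht', ambientInner, hcsq u hu']
        have := (hp u hu').2.2.2.1
        field_simp
        simp
  have hlip2 : ∀ s ∈ Metric.ball (0 : ℝ) r, ∀ t ∈ Metric.ball (f p).2 r,
      ∀ t' ∈ Metric.ball (f p).2 r, dist (Θ.symm (s, t)) (Θ.symm (s, t')) ≤ |t - t'| := by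
    intro s hs t ht t' ht'
    have hsub : uIcc t t' ⊆ Metric.ball (f p).2 r :=
      segment_eq_uIcc t t' ▸ (convex_ball _ r).segment_subset ht ht'
    refine dist_le_of_unit_speed' hf (γ := fun t => Θ.symm (s, t)) ?_ ?_
    · refine (hΘsm.of_le (by simp)).comp ?_ fun u hu => ?_
      · rw [contMDiffOn_iff_contDiffOn]
        exact contDiffOn_const.prodMk contDiffOn_id
      · rw [hΘt]; exact ⟨hs, hsub hu⟩
    · intro u hu
      have hu' := hsub hu
      refine ⟨(0, 1), ?_, ?_⟩
      · refine ((hasDerivAt_const u (c s)).prodMk (hasDerivAt_id u)).congr_of_eventuallyEq ?_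
        filter_upwards [Metric.isOpen_ball.mem_nhds hu'] with v hv using hparam s hs v hv
      · simp [ambientInner]
  have h0 : g (f p).1 = 0 := by
    have := (hs _ hx).1
    rw [hΨx, hX₀1] at this
    exact (congrArg Prod.fst this).symm
  have hcont : ContinuousAt (fun y => g (localParam f p y).1) (extChartAt (𝓡 2) p p) :=
    ((hs _ hx).2.2.1).continuousAt
  refine ⟨r, Θ, c, g, hr, (hΘs p).2 ⟨mem_chart_source E2 p, hx⟩, hΘt, h0, ?_, hparam, hc,
    fun s hs => (hp s hs).2.2.1, fun s hs => (hp s hs).2.1, ?_, ?_⟩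
  · intro q hq
    rw [hΘapp, (hs _ ((hΘs q).1 hq).2).1, hlocal q hq]
    rfl
  · rintro ⟨s, t⟩ hx ⟨s', t'⟩ hy
    rw [hΘt] at hx hy
    exact (dist_triangle _ (Θ.symm (s', t)) _).trans
      (add_le_add (hlip1 s hx.1 s' hy.1 t hx.2) (hlip2 s' hy.1 t hx.2 t' hy.2))
  · have hσ0 : g (localParam f p (extChartAt (𝓡 2) p p)).1 = 0 := by rw [hX₀1, h0]
    have hmem : ∀ᶠ y in 𝓝 (extChartAt (𝓡 2) p p), y ∈ Ψ.source := Ψ.open_source.mem_nhds hx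
    have := planar_iff_acc_eq_zero hf (hext p) (σ := fun y => g (localParam f p y).1) (c := c)
      (hmem.mono fun y hy => (hs y hy).2.2.1)
      (by
        rw [hσ0]
        filter_upwards [Metric.ball_mem_nhds (0 : ℝ) hr] with s hsb
        exact ⟨hc.contDiffAt (Metric.isOpen_ball.mem_nhds hsb), (hp s hsb).2.2.1⟩)
      (hmem.mono fun y hy => (hs y hy).2.2.2.1) (hs _ hx).2.2.2.2
    rw [hσ0] at this
    exact this

end Box

/-! ### Continuation of solutions -/

section Continuation

variable {X : Type*} [TopologicalSpace X] [T2Space X] {S : (ℝ → X) → ℝ → Prop}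

/-- The points where the two germs agree form an open set by `uniq`; it is relatively closed in `I`
by continuity and the Hausdorff property. -/
lemma eqOn_of_solution (cont : ∀ u t, S u t → ContinuousAt u t)
    (uniq : ∀ u v t, S u t → S v t → u t = v t → u =ᶠ[𝓝 t] v) {u v : ℝ → X} {I : Set ℝ}
    (hI : IsPreconnected I) (hu : ∀ t ∈ I, S u t) (hv : ∀ t ∈ I, S v t) {τ : ℝ}
    (hτ : τ ∈ I) (huv : u τ = v τ) : EqOn u v I := by
  have hA : IsOpen {t | u =ᶠ[𝓝 t] v} := isOpen_setOfPred_eventually_nhds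
  have := hI.subset_of_closure_inter_subset hA ⟨τ, hτ, uniq u v τ (hu τ hτ) (hv τ hτ) huv⟩ ?_
  · exact fun t ht => (this ht).self_of_nhds
  · rintro t ⟨ht, htI⟩
    refine uniq u v t (hu t htI) (hv t htI) ?_
    refine tendsto_nhds_unique_of_frequently_eq (cont u t (hu t htI)) (cont v t (hv t htI)) ?_
    exact (mem_closure_iff_frequently.1 ht).mono fun s hs => hs.self_of_nhds

/-- The diagonal `t ↦ w t t` works: two of the given solutions agree on the smaller of their balls,
so near `t` the diagonal coincides with `w t`. -/
lemma exists_glued_solution (congr : ∀ u v t, u =ᶠ[𝓝 t] v → S u t → S v t)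
    (cont : ∀ u t, S u t → ContinuousAt u t)
    (uniq : ∀ u v t, S u t → S v t → u t = v t → u =ᶠ[𝓝 t] v) {τ : ℝ} {x : X} {I : Set ℝ}
    (hI : IsOpen I) (hτ : τ ∈ I)
    (h : ∀ t ∈ I, ∃ n, |t - τ| < n ∧ ∃ w, w τ = x ∧ ∀ s ∈ Metric.ball τ n, S w s) :
    ∃ u, u τ = x ∧ ∀ t ∈ I, S u t := by
  have : Nonempty X := ⟨x⟩
  choose! n hn w hw hS using h
  refine ⟨fun t => w t t, hw τ hτ, fun t ht => ?_⟩
  refine congr (w t) _ t ?_ (hS t ht t (hn t ht))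
  filter_upwards [hI.mem_nhds ht, Metric.isOpen_ball.mem_nhds (show t ∈ Metric.ball τ (n t) from
    hn t ht)] with s hs hst
  refine eqOn_of_solution cont uniq (I := Metric.ball τ (min (n t) (n s)))
    (convex_ball _ _).isPreconnected
    (fun r hr => hS t ht r (Metric.ball_subset_ball (min_le_left _ _) hr))
    (fun r hr => hS s hs r (Metric.ball_subset_ball (min_le_right _ _) hr))
    (τ := τ) (Metric.mem_ball_self ?_) ((hw t ht).trans (hw s hs).symm) ?_
  · exact lt_min ((abs_nonneg _).trans_lt (hn t ht)) ((abs_nonneg _).trans_lt (hn s hs))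
  · exact lt_min hst (hn s hs)

/-- If solutions are locally unique and can be continued past the endpoints of open intervals,
then they can be continued to the whole line. -/
lemma exists_global_solution (congr : ∀ u v t, u =ᶠ[𝓝 t] v → S u t → S v t)
    (cont : ∀ u t, S u t → ContinuousAt u t)
    (uniq : ∀ u v t, S u t → S v t → u t = v t → u =ᶠ[𝓝 t] v)
    (ext : ∀ u a b, a < b → (∀ t ∈ Ioo a b, S u t) → ∀ T, T = a ∨ T = b →
      ∃ ε > 0, ∃ v, (∀ t, |t - T| < ε → S v t) ∧ ∀ t ∈ Ioo a b, |t - T| < ε → u t = v t)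
    {τ r : ℝ} (hr : 0 < r) {u₀ : ℝ → X} (hu₀ : ∀ t, |t - τ| < r → S u₀ t) :
    ∃ u, u τ = u₀ τ ∧ ∀ t, S u t := by
  -- Radii of symmetric intervals about `τ` that carry a solution with the prescribed value. If they
  -- were bounded, a solution on the interval of supremal radius `N` would extend past both ends.
  set B : Set ℝ := {n | 0 < n ∧ ∃ w, w τ = u₀ τ ∧ ∀ s ∈ Metric.ball τ n, S w s} with hB
  have hrB : r ∈ B := ⟨hr, u₀, rfl, fun s hs => hu₀ s hs⟩
  by_cases hbdd : BddAbove B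
  · exfalso
    set N := sSup B with hN
    have hNpos : 0 < N := hr.trans_le (le_csSup hbdd hrB)
    obtain ⟨u, hu0, hu⟩ := exists_glued_solution congr cont uniq
      (Metric.isOpen_ball (x := τ) (ε := N)) (x := u₀ τ) (Metric.mem_ball_self hNpos)
      (fun t ht => by
        obtain ⟨n, hn, htn⟩ := exists_lt_of_lt_csSup ⟨r, hrB⟩ (show |t - τ| < N from ht)
        exact ⟨n, htn, hn.2⟩)
    rw [Real.ball_eq_Ioo] at hu
    have hlt : τ - N < τ + N := by linarith
    obtain ⟨ε₁, hε₁, v₁, hv₁, huv₁⟩ := ext u _ _ hlt hu (τ + N) (Or.inr rfl)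
    obtain ⟨ε₂, hε₂, v₂, hv₂, huv₂⟩ := ext u _ _ hlt hu (τ - N) (Or.inl rfl)
    -- The bound by `N` keeps the two end zones, where `v₂` and `v₁` take over, from overlapping.
    set ε := min (min ε₁ ε₂) N with hε
    have hεpos : 0 < ε := lt_min (lt_min hε₁ hε₂) hNpos
    have e1 : ε ≤ ε₁ := (min_le_left _ _).trans (min_le_left _ _)
    have e2 : ε ≤ ε₂ := (min_le_left _ _).trans (min_le_right _ _)
    have e3 : ε ≤ N := min_le_right _ _
    set u' : ℝ → X := fun t => if t ≤ τ - N then v₂ t else if t < τ + N then u t else v₁ t with hu'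
    have hmem : N + ε ∈ B := by
      refine ⟨by linarith, u', ?_, fun t ht => ?_⟩
      · simp only [hu']
        rw [if_neg (by linarith), if_pos (by linarith), hu0]
      · rw [Real.ball_eq_Ioo] at ht
        rcases lt_or_ge t (τ - N + ε) with h1 | h1
        · refine congr v₂ u' t ?_ (hv₂ t (abs_lt.2 ⟨by linarith [ht.1], by linarith⟩))
          filter_upwards [Ioo_mem_nhds ht.1 h1] with s hs
          simp only [hu']
          by_cases h2 : s ≤ τ - N
          · rw [if_pos h2]
          · push Not at h2
            rw [if_neg (by linarith), if_pos (by linarith [hs.2])]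
            exact (huv₂ s ⟨h2, by linarith [hs.2]⟩
              (abs_lt.2 ⟨by linarith [hs.1], by linarith [hs.2]⟩)).symm
        · rcases lt_or_ge t (τ + N) with h3 | h3
          · have h4 : t ∈ Ioo (τ - N) (τ + N) := ⟨by linarith, h3⟩
            refine congr u u' t ?_ (hu t h4)
            filter_upwards [Ioo_mem_nhds h4.1 h4.2] with s hs
            simp only [hu']
            rw [if_neg (by linarith [hs.1]), if_pos hs.2]
          · refine congr v₁ u' t ?_ (hv₁ t (abs_lt.2 ⟨by linarith, by linarith [ht.2]⟩))
            filter_upwards [Ioo_mem_nhds (show τ + N - ε < t by linarith) ht.2] with s hs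
            simp only [hu']
            rw [if_neg (by linarith [hs.1])]
            by_cases h2 : s < τ + N
            · rw [if_pos h2]
              exact (huv₁ s ⟨by linarith [hs.1], h2⟩
                (abs_lt.2 ⟨by linarith [hs.1], by linarith [hs.2]⟩)).symm
            · rw [if_neg h2]
    linarith [le_csSup hbdd hmem]
  · rw [not_bddAbove_iff] at hbdd
    obtain ⟨u, hu0, hu⟩ := exists_glued_solution congr cont uniq isOpen_univ (x := u₀ τ)
      (mem_univ τ) (fun t _ => by
        obtain ⟨n, hn, htn⟩ := hbdd |t - τ|
        exact ⟨n, htn, hn.2⟩)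
    exact ⟨u, hu0, fun t => hu t (mem_univ t)⟩

end Continuation

/-! ### Limits at endpoints, from completeness. -/

section Lipschitz

variable {X : Type*} [MetricSpace X]

/-- Continuous induction along the interval: the set of `z` satisfying the bound is closed, and the
local estimate pushes it to the right. -/
lemma dist_le_of_local {u : ℝ → X} {x y : ℝ} (hxy : x ≤ y)
    (h : ∀ t ∈ Icc x y, ∀ᶠ t' in 𝓝 t, dist (u t) (u t') ≤ |t - t'|) :
    dist (u x) (u y) ≤ y - x := by
  have hcont : ContinuousOn u (Icc x y) := by
    intro t ht
    refine ContinuousAt.continuousWithinAt (tendsto_iff_dist_tendsto_zero.2 ?_)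
    have h0 : Tendsto (fun t' => |t - t'|) (𝓝 t) (𝓝 0) := by
      have : Continuous fun t' => |t - t'| := by fun_prop
      simpa using this.tendsto t
    refine squeeze_zero' (Eventually.of_forall fun _ => dist_nonneg) ?_ h0
    filter_upwards [h t ht] with t' ht' using by rwa [dist_comm]
  set A : Set ℝ := {z | dist (u x) (u z) ≤ z - x} with hA
  have hclosed : IsClosed (A ∩ Icc x y) := by
    have h1 : ContinuousOn (fun z => dist (u x) (u z) - (z - x)) (Icc x y) := by
      fun_prop
    have h2 := h1.preimage_isClosed_of_isClosed isClosed_Icc (isClosed_Iic (a := (0 : ℝ)))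
    convert h2 using 1
    ext z
    simp [hA, and_comm]
  have := hclosed.Icc_subset_of_forall_exists_gt (a := x) (b := y) (by simp [hA]) ?_
  · exact this (right_mem_Icc.2 hxy)
  · rintro z ⟨hzA, hz⟩ w hw
    have h1 : ∀ᶠ t in 𝓝[>] z, dist (u z) (u t) ≤ |z - t| :=
      (h z ⟨hz.1, hz.2.le⟩).filter_mono nhdsWithin_le_nhds
    have h2 : ∀ᶠ t in 𝓝[>] z, t ∈ Ioc z w := Ioc_mem_nhdsGT hw
    obtain ⟨t, ht1, ht2⟩ := (h1.and h2).exists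
    refine ⟨t, ?_, ht2⟩
    have h3 : dist (u x) (u z) ≤ z - x := hzA
    have h4 : |z - t| = t - z := by rw [abs_sub_comm, abs_of_pos (by linarith [ht2.1])]
    change dist (u x) (u t) ≤ t - x
    linarith [dist_triangle (u x) (u z) (u t)]

/-- This is where completeness of `M` is used: a locally 1-Lipschitz curve on an open interval is
uniformly continuous, hence converges at each endpoint. It serves both the vertical and the
horizontal continuation. -/
lemma exists_tendsto_of_local_lipschitz [CompleteSpace X] {u : ℝ → X} {a b T : ℝ}
    (hT : T ∈ closure (Ioo a b))
    (h : ∀ t ∈ Ioo a b, ∀ᶠ t' in 𝓝 t, dist (u t) (u t') ≤ |t - t'|) :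
    ∃ q, Tendsto u (𝓝[Ioo a b] T) (𝓝 q) := by
  have hlip : LipschitzOnWith 1 u (Ioo a b) := by
    refine LipschitzOnWith.of_dist_le_mul fun x hx y hy => ?_
    rw [NNReal.coe_one, one_mul]
    rcases le_total x y with hxy | hxy
    · have := dist_le_of_local (u := u) hxy fun t ht =>
        h t ⟨hx.1.trans_le ht.1, ht.2.trans_lt hy.2⟩
      rwa [dist_comm x y, Real.dist_eq, abs_of_nonneg (by linarith)]
    · have := dist_le_of_local (u := u) hxy fun t ht =>
        h t ⟨hy.1.trans_le ht.1, ht.2.trans_lt hx.2⟩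
      rwa [Real.dist_eq, abs_of_nonneg (by linarith), dist_comm]
  have : NeBot (𝓝[Ioo a b] T) := mem_closure_iff_nhdsWithin_neBot.1 hT
  have hc : Cauchy (𝓝[Ioo a b] T) := cauchy_nhds.mono nhdsWithin_le_nhds
  have := hc.map_of_le hlip.uniformContinuousOn
    (le_principal_iff.2 self_mem_nhdsWithin)
  exact CompleteSpace.complete this

end Lipschitz

/-! ### Vertical lines and the vertical flow. -/

section Flow

variable {M : Type*} [MetricSpace M] [ChartedSpace E2 M]
  [Bundle.RiemannianBundle (fun p : M => TangentSpace (𝓡 2) p)]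
  {f : M → ℍ × ℝ} {p : M} {r : ℝ} {Θ : OpenPartialHomeomorph M (ℝ × ℝ)} {c : ℝ → ℂ} {g : ℂ → ℝ}

lemma coord_eq_iff {q : ℍ × ℝ} {z : ℂ} {t : ℝ} :
    coord q = (z, t) ↔ (q.1 : ℂ) = z ∧ q.2 = t := by
  rw [coord, Prod.mk.injEq]

lemma IsBox.mem_of_mem_source (h : IsBox f p r Θ c g) {q : M} (hq : q ∈ Θ.source) :
    g (f q).1 ∈ Metric.ball (0 : ℝ) r ∧ (f q).2 ∈ Metric.ball (f p).2 r := by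
  have := Θ.map_source hq
  rw [h.target, h.apply q hq] at this
  exact this

lemma IsBox.symm_apply (h : IsBox f p r Θ c g) {q : M} (hq : q ∈ Θ.source) :
    Θ.symm (g (f q).1, (f q).2) = q := by
  rw [← h.apply q hq, Θ.left_inv hq]

lemma IsBox.symm_center (h : IsBox f p r Θ c g) : Θ.symm (0, (f p).2) = p := by
  have := h.symm_apply h.mem
  rwa [h.apply_center] at this

lemma IsBox.curve_eq (h : IsBox f p r Θ c g) {q : M} (hq : q ∈ Θ.source) :
    ((f q).1 : ℂ) = c (g (f q).1) := by
  obtain ⟨h1, h2⟩ := h.mem_of_mem_source hq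
  have := h.param _ h1 _ h2
  rw [h.symm_apply hq, coord_eq_iff] at this
  exact this.1

lemma IsBox.hasDerivAt (h : IsBox f p r Θ c g) {s : ℝ} (hs : s ∈ Metric.ball (0 : ℝ) r) :
    HasDerivAt c (deriv c s) s :=
  ((h.smooth.contDiffAt (Metric.isOpen_ball.mem_nhds hs)).differentiableAt (by simp)).hasDerivAt

lemma IsBox.im_pos (h : IsBox f p r Θ c g) {s : ℝ} (hs : s ∈ Metric.ball (0 : ℝ) r) :
    0 < (c s).im := by
  have h1 := h.param s hs _ (Metric.mem_ball_self h.pos)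
  rw [coord_eq_iff] at h1
  rw [← h1.1]
  exact (f _).1.im_pos

lemma IsBox.deriv_ne_zero (h : IsBox f p r Θ c g) {s : ℝ} (hs : s ∈ Metric.ball (0 : ℝ) r) :
    deriv c s ≠ 0 := by
  rw [← norm_pos_iff, h.speed s hs]
  exact h.im_pos hs

lemma IsBox.continuousAt_symm (h : IsBox f p r Θ c g) {s t : ℝ} (hs : s ∈ Metric.ball (0 : ℝ) r)
    (ht : t ∈ Metric.ball (f p).2 r) : ContinuousAt Θ.symm (s, t) :=
  Θ.symm.continuousAt (by
    change (s, t) ∈ Θ.target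
    rw [h.target]; exact ⟨hs, ht⟩)

/-- Every point of `M` has a product neighbourhood. -/
def HasBoxes (f : M → ℍ × ℝ) : Prop := ∀ p, ∃ r Θ c g, IsBox f p r Θ c g

lemma HasBoxes.isLocallyInjective (hb : HasBoxes f) : IsLocallyInjective f := by
  intro p
  obtain ⟨r, Θ, c, g, h⟩ := hb p
  refine ⟨Θ.source, Θ.open_source, h.mem, fun q hq q' hq' hqq => ?_⟩
  rw [← h.symm_apply hq, ← h.symm_apply hq', hqq]

/-! ### Vertical lines -/

/-- Near the parameter `t`, the curve `u` lifts the vertical line over `z`. -/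
def IsVerticalAt (f : M → ℍ × ℝ) (z : ℂ) (u : ℝ → M) (t : ℝ) : Prop :=
  ∀ᶠ s in 𝓝 t, ContinuousAt u s ∧ coord (f (u s)) = (z, s)

/-- Inside a box a lift of the vertical line over `z` can only be `s ↦ Θ.symm (g z, s)`, which gives
the local uniqueness of lifts. -/
lemma IsBox.eq_of_vertical (h : IsBox f p r Θ c g) {z : ℂ} {s : ℝ} {q : M} (hq : q ∈ Θ.source)
    (hs : coord (f q) = (z, s)) : g z ∈ Metric.ball (0 : ℝ) r ∧ Θ.symm (g z, s) = q := by
  rw [coord_eq_iff] at hs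
  have h1 := h.symm_apply hq
  have h2 := (h.mem_of_mem_source hq).1
  rw [hs.1] at h1 h2
  rw [hs.2] at h1
  exact ⟨h2, h1⟩

lemma IsBox.isVerticalAt_symm (h : IsBox f p r Θ c g) {s t : ℝ} (hs : s ∈ Metric.ball (0 : ℝ) r)
    (ht : t ∈ Metric.ball (f p).2 r) : IsVerticalAt f (c s) (fun t => Θ.symm (s, t)) t := by
  filter_upwards [Metric.isOpen_ball.mem_nhds ht] with t' ht'
  exact ⟨ContinuousAt.comp (f := fun t => (s, t)) (h.continuousAt_symm hs ht') (by fun_prop),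
    h.param s hs t' ht'⟩

lemma IsVerticalAt.dist_le (hb : HasBoxes f) {z : ℂ} {u : ℝ → M} {t : ℝ}
    (hu : IsVerticalAt f z u t) : ∀ᶠ t' in 𝓝 t, dist (u t) (u t') ≤ |t - t'| := by
  obtain ⟨r, Θ, c, g, h⟩ := hb (u t)
  have hc := hu.self_of_nhds.1
  have h0 := h.eq_of_vertical h.mem hu.self_of_nhds.2
  filter_upwards [hu, hc.eventually (Θ.open_source.mem_nhds h.mem)] with t' ht' hs
  have h1 := h.eq_of_vertical hs ht'.2
  have m0 : (g z, t) ∈ Θ.target := by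
    rw [h.target]
    exact ⟨h0.1, by
      simpa only [(coord_eq_iff.1 hu.self_of_nhds.2).2] using Metric.mem_ball_self h.pos⟩
  have m1 : (g z, t') ∈ Θ.target := by
    rw [h.target]
    have h2 := (h.mem_of_mem_source hs).2
    rw [(coord_eq_iff.1 ht'.2).2] at h2
    exact ⟨h0.1, h2⟩
  have := h.lipschitz _ m0 _ m1
  rw [h0.2, h1.2] at this
  simpa using this

/-- Continuation applies because a partial lift is 1-Lipschitz: it has a limit `q` at an endpoint,
and the vertical segment through the centre of a box at `q` prolongs it. -/
lemma exists_vertical_line [CompleteSpace M] (hb : HasBoxes f) (hf : Continuous (coord ∘ f))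
    (p : M) : ∃ V : ℝ → M, V (f p).2 = p ∧ Continuous V ∧
      ∀ t, coord (f (V t)) = (((f p).1 : ℂ), t) := by
  obtain ⟨r, Θ, c, g, h⟩ := hb p
  obtain ⟨z, hz⟩ : ∃ z : ℂ, z = (f p).1 := ⟨_, rfl⟩
  rw [← hz]
  have hz0 : c 0 = z := by rw [hz, h.curve_eq h.mem, h.apply_center]
  suffices hG : ∃ V : ℝ → M, V (f p).2 = Θ.symm (0, (f p).2) ∧ ∀ t, IsVerticalAt f z V t by
    obtain ⟨V, hV0, hV⟩ := hG
    exact ⟨V, hV0.trans h.symm_center, continuous_iff_continuousAt.2 fun t =>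
      (hV t).self_of_nhds.1, fun t => (hV t).self_of_nhds.2⟩
  refine exists_global_solution (S := IsVerticalAt f z) (τ := (f p).2) (r := r)
    (u₀ := fun t => Θ.symm (0, t)) ?_ (fun u t hu => hu.self_of_nhds.1) ?_ ?_ h.pos ?_
  · intro u v t huv hu
    filter_upwards [huv.eventually_nhds, hu] with s hs1 hs2
    exact ⟨hs2.1.congr hs1, hs1.self_of_nhds ▸ hs2.2⟩
  · intro u v t hu hv huv
    obtain ⟨r, Θ, c, g, h⟩ := hb (u t)
    have h1 := hu.self_of_nhds.1.eventually (Θ.open_source.mem_nhds h.mem)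
    have h2 := hv.self_of_nhds.1.eventually (Θ.open_source.mem_nhds (huv ▸ h.mem))
    filter_upwards [h1, h2, hu, hv] with s s1 s2 s3 s4
    rw [← (h.eq_of_vertical s1 s3.2).2, ← (h.eq_of_vertical s2 s4.2).2]
  · intro u a b hab hu T hT
    have hTc : T ∈ closure (Ioo a b) := by
      rw [closure_Ioo hab.ne]
      rcases hT with rfl | rfl
      · exact left_mem_Icc.2 hab.le
      · exact right_mem_Icc.2 hab.le
    obtain ⟨q, hq⟩ := exists_tendsto_of_local_lipschitz hTc fun t ht => (hu t ht).dist_le hb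
    have : NeBot (𝓝[Ioo a b] T) := mem_closure_iff_nhdsWithin_neBot.1 hTc
    have hfq : coord (f q) = (z, T) := by
      have h1 : Tendsto (fun t => coord (f (u t))) (𝓝[Ioo a b] T) (𝓝 (coord (f q))) :=
        (hf.tendsto q).comp hq
      have h2 : Tendsto (fun t : ℝ => (z, t)) (𝓝[Ioo a b] T) (𝓝 (z, T)) :=
        (Continuous.tendsto (by fun_prop) T).mono_left nhdsWithin_le_nhds
      refine tendsto_nhds_unique (h1.congr' ?_) h2
      filter_upwards [self_mem_nhdsWithin] with t ht using (hu t ht).self_of_nhds.2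
    obtain ⟨r, Θ, c, g, h⟩ := hb q
    have hq1 := h.eq_of_vertical h.mem hfq
    have hgz : g z = 0 := by
      rw [← (coord_eq_iff.1 hfq).1, h.apply_center]
    have hcz : c 0 = z := by
      rw [← (coord_eq_iff.1 hfq).1, h.curve_eq h.mem, h.apply_center]
    have hT2 : (f q).2 = T := (coord_eq_iff.1 hfq).2
    obtain ⟨δ, hδ, hδs⟩ := Metric.mem_nhdsWithin_iff.1
      (hq.eventually (Θ.open_source.mem_nhds h.mem))
    refine ⟨min δ r, lt_min hδ h.pos, fun t => Θ.symm (0, t), fun t ht => ?_, fun t ht htT => ?_⟩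
    · rw [← hcz]
      exact h.isVerticalAt_symm (Metric.mem_ball_self h.pos)
        (by rw [hT2]; exact ht.trans_le (min_le_right _ _))
    · have hs : u t ∈ Θ.source := hδs ⟨htT.trans_le (min_le_left _ _), ht⟩
      have := h.eq_of_vertical hs (hu t ht).self_of_nhds.2
      rw [hgz] at this
      exact this.2.symm
  · intro t ht
    rw [← hz0]
    exact h.isVerticalAt_symm (Metric.mem_ball_self h.pos) ht

/-- Once the lines of all points near `q` meet the box, unique lifting through the locally injective
`f` forces them to be its vertical segments at every height of the box, and these depend
continuously on the point. -/
lemma IsBox.continuousAt_vertical (h : IsBox f p r Θ c g) (hb : HasBoxes f)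
    (hf : Continuous (coord ∘ f)) {V : M → ℝ → M} (hVc : ∀ q, Continuous (V q))
    (hVf : ∀ q t, coord (f (V q t)) = (((f q).1 : ℂ), t)) {q : M}
    (hA : ∀ᶠ x in 𝓝 q, ∃ τ, V x τ ∈ Θ.source) {t : ℝ} (ht : t ∈ Metric.ball (f p).2 r) :
    ContinuousAt (fun x : M × ℝ => V x.1 x.2) (q, t) := by
  have hfst : Continuous fun q => ((f q).1 : ℂ) := continuous_fst.comp hf
  have key : ∀ᶠ x in 𝓝 q, g (f x).1 ∈ Metric.ball (0 : ℝ) r ∧ ((f x).1 : ℂ) = c (g (f x).1) ∧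
      ∀ t ∈ Metric.ball (f p).2 r, V x t = Θ.symm (g (f x).1, t) := by
    filter_upwards [hA] with x hx
    obtain ⟨τ, hτ⟩ := hx
    have h1 := h.eq_of_vertical hτ (hVf x τ)
    have h2 := (h.mem_of_mem_source hτ).2
    rw [(coord_eq_iff.1 (hVf x τ)).2] at h2
    have h3 := h.curve_eq hτ
    rw [(coord_eq_iff.1 (hVf x τ)).1] at h3
    refine ⟨h1.1, h3, ?_⟩
    refine (T2Space.isSeparatedMap f).eqOn_of_comp_eqOn hb.isLocallyInjective
      (convex_ball _ _).isPreconnected (hVc x).continuousOn ?_ ?_ h2 h1.2.symm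
    · exact fun t ht => (ContinuousAt.comp (f := fun t => (g (f x).1, t))
        (h.continuousAt_symm h1.1 ht) (by fun_prop)).continuousWithinAt
    · intro t ht
      have h4 := hVf x t
      rw [h3, ← h.param _ h1.1 t ht] at h4
      rw [coord_eq_iff] at h4
      exact Prod.ext (UpperHalfPlane.ext h4.1) h4.2
  obtain ⟨h1, h2, -⟩ := key.self_of_nhds
  have hg : ContinuousAt (fun x : M × ℝ => (g (f x.1).1, x.2)) (q, t) := by
    have h3 : ContinuousAt g ((f q).1 : ℂ) := by
      rw [h2]
      exact (h.differentiable _ h1).continuousAt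
    have h4 : ContinuousAt (fun x => g (f x).1) q :=
      ContinuousAt.comp (f := fun x => ((f x).1 : ℂ)) h3 hfst.continuousAt
    exact (ContinuousAt.comp (g := fun x => g (f x).1) (f := Prod.fst) (x := (q, t)) h4 continuousAt_fst).prodMk continuousAt_snd
  have h5 : ContinuousAt (fun x : M × ℝ => Θ.symm (g (f x.1).1, x.2)) (q, t) :=
    ContinuousAt.comp (f := fun x : M × ℝ => (g (f x.1).1, x.2)) (h.continuousAt_symm h1 ht) hg
  refine h5.congr ?_
  filter_upwards [(key.prod_nhds (Metric.isOpen_ball.mem_nhds ht))] with x hx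
  exact (hx.1.2.2 _ hx.2).symm

/-- The vertical flow on `M`, parametrized by height. -/
lemma exists_vertical_flow [CompleteSpace M] (hb : HasBoxes f) (hf : Continuous (coord ∘ f)) :
    ∃ V : M × ℝ → M, Continuous V ∧ (∀ p, V (p, (f p).2) = p) ∧
      ∀ p t, coord (f (V (p, t))) = (((f p).1 : ℂ), t) := by
  choose V hV0 hVc hVf using exists_vertical_line hb hf
  refine ⟨fun x => V x.1 x.2, ?_, hV0, hVf⟩
  refine continuous_iff_continuousAt.2 fun ⟨p, t⟩ => ?_
  -- Joint continuity propagates along the line through `p`: the heights where it holds form a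
  -- nonempty clopen subset of `ℝ`.
  set C : Set ℝ := {t | ContinuousAt (fun x : M × ℝ => V x.1 x.2) (p, t)} with hC
  have hslice : ∀ {t}, t ∈ C → ContinuousAt (fun x => V x t) p := fun {t} ht =>
    ContinuousAt.comp (g := fun x : M × ℝ => V x.1 x.2) (f := fun x : M => (x, t)) ht
      (by fun_prop)
  have hopen : IsOpen C := by
    refine isOpen_iff_mem_nhds.2 fun t ht => ?_
    obtain ⟨r, Θ, c, g, h⟩ := hb (V p t)
    have h2 : (f (V p t)).2 = t := (coord_eq_iff.1 (hVf p t)).2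
    filter_upwards [Metric.ball_mem_nhds t h.pos] with t' ht'
    refine h.continuousAt_vertical hb hf hVc hVf ?_ (by rwa [h2])
    filter_upwards [(hslice ht).eventually (Θ.open_source.mem_nhds h.mem)] with x hx
      using ⟨t, hx⟩
  have hclosed : IsClosed C := by
    refine isClosed_of_closure_subset fun T hT => ?_
    obtain ⟨r, Θ, c, g, h⟩ := hb (V p T)
    have h2 : (f (V p T)).2 = T := (coord_eq_iff.1 (hVf p T)).2
    obtain ⟨t, ht, hts⟩ := ((mem_closure_iff_frequently.1 hT).and_eventually
      ((hVc p).continuousAt.eventually (Θ.open_source.mem_nhds h.mem))).exists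
    refine h.continuousAt_vertical hb hf hVc hVf ?_ (by rw [h2]; exact Metric.mem_ball_self h.pos)
    filter_upwards [(hslice ht).eventually (Θ.open_source.mem_nhds hts)] with x hx
      using ⟨t, hx⟩
  have hne : C.Nonempty := by
    refine ⟨(f p).2, ?_⟩
    obtain ⟨r, Θ, c, g, h⟩ := hb p
    refine h.continuousAt_vertical hb hf hVc hVf ?_ (Metric.mem_ball_self h.pos)
    filter_upwards [Θ.open_source.mem_nhds h.mem] with x hx
      using ⟨(f x).2, by rwa [hV0]⟩
  have := IsClopen.eq_univ ⟨hclosed, hopen⟩ hne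
  exact (this ▸ mem_univ t : t ∈ C)

end Flow

/-! ### Horizontal unit speed curves. -/

section Horizontal

variable {M : Type*} [MetricSpace M] {f : M → ℍ × ℝ}

/-- At the parameter `s`, the first component of `u` is a horizontal unit speed curve at height
`t₀`, and the second one is the velocity of its projection. -/
def IsUnitHorizontal (f : M → ℍ × ℝ) (t₀ : ℝ) (u : ℝ → M × ℂ) (s : ℝ) : Prop :=
  ContinuousAt u s ∧ (f (u s).1).2 = t₀ ∧
    HasDerivAt (fun s => ((f (u s).1).1 : ℂ)) (u s).2 s ∧ ‖(u s).2‖ = (f (u s).1).1.im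

lemma IsUnitHorizontal.congr {t₀ : ℝ} {u v : ℝ → M × ℂ} {s : ℝ} (h : IsUnitHorizontal f t₀ u s)
    (huv : u =ᶠ[𝓝 s] v) : IsUnitHorizontal f t₀ v s := by
  obtain ⟨h1, h2, h3, h4⟩ := h
  rw [IsUnitHorizontal, ← huv.self_of_nhds]
  exact ⟨h1.congr huv, h2, h3.congr_of_eventuallyEq (huv.mono fun s hs => by simp [hs]), h4⟩

variable [ChartedSpace E2 M] [Bundle.RiemannianBundle (fun p : M => TangentSpace (𝓡 2) p)]
  {p : M} {r : ℝ} {Θ : OpenPartialHomeomorph M (ℝ × ℝ)} {c : ℝ → ℂ} {g : ℂ → ℝ}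

/-- In a box the arc length coordinate of a horizontal unit speed curve has derivative `±1`. By
Darboux's theorem the sign is constant, so the curve is traversed affinely. -/
lemma IsBox.eq_of_horizontal (h : IsBox f p r Θ c g) {t₀ : ℝ} {u : ℝ → M × ℂ} {a b : ℝ}
    (hu : ∀ s ∈ Ioo a b, IsUnitHorizontal f t₀ u s) (hs : ∀ s ∈ Ioo a b, (u s).1 ∈ Θ.source) :
    ∃ ε k : ℝ, (ε = 1 ∨ ε = -1) ∧ ∀ s ∈ Ioo a b, ε * s + k ∈ Metric.ball (0 : ℝ) r ∧
      t₀ ∈ Metric.ball (f p).2 r ∧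
      g (f (u s).1).1 = ε * s + k ∧
      (u s).1 = Θ.symm (ε * s + k, t₀) ∧ (u s).2 = ε • deriv c (ε * s + k) := by
  set σ : ℝ → ℝ := fun s => g (f (u s).1).1 with hσ
  have hmem : ∀ s ∈ Ioo a b, σ s ∈ Metric.ball (0 : ℝ) r ∧ t₀ ∈ Metric.ball (f p).2 r := by
    intro s hsI
    have := h.mem_of_mem_source (hs s hsI)
    rwa [(hu s hsI).2.1] at this
  have hcurve : ∀ s ∈ Ioo a b, ((f (u s).1).1 : ℂ) = c (σ s) := fun s hsI =>
    h.curve_eq (hs s hsI)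
  have hσd : ∀ s ∈ Ioo a b, HasDerivAt σ (fderiv ℝ g (c (σ s)) (u s).2) s := by
    intro s hsI
    have h1 : HasFDerivAt g (fderiv ℝ g (c (σ s))) ((f (u s).1).1 : ℂ) := by
      rw [hcurve s hsI]
      exact (h.differentiable _ (hmem s hsI).1).hasFDerivAt
    exact h1.comp_hasDerivAt s (hu s hsI).2.2.1
  have hvel : ∀ s ∈ Ioo a b, (u s).2 = (fderiv ℝ g (c (σ s)) (u s).2) • deriv c (σ s) := by
    intro s hsI
    refine (hu s hsI).2.2.1.unique ?_
    refine (HasDerivAt.scomp s (h.hasDerivAt (hmem s hsI).1) (hσd s hsI)).congr_of_eventuallyEq ?_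
    filter_upwards [isOpen_Ioo.mem_nhds hsI] with s' hs' using hcurve s' hs'
  have habs : ∀ s ∈ Ioo a b, |fderiv ℝ g (c (σ s)) (u s).2| = 1 := by
    intro s hsI
    have h1 := congrArg norm (hvel s hsI)
    have hpos := h.im_pos (hmem s hsI).1
    rw [norm_smul, h.speed _ (hmem s hsI).1, (hu s hsI).2.2.2, ← UpperHalfPlane.coe_im,
      hcurve s hsI, Real.norm_eq_abs] at h1
    exact mul_right_cancel₀ hpos.ne' (by rw [← h1, one_mul])
  have hsign : ∃ ε : ℝ, (ε = 1 ∨ ε = -1) ∧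
      ∀ s ∈ Ioo a b, fderiv ℝ g (c (σ s)) (u s).2 = ε := by
    have := hasDerivWithinAt_forall_lt_or_forall_gt_of_forall_ne (convex_Ioo a b)
      (fun s hsI => (hσd s hsI).hasDerivWithinAt) (m := 0)
      (fun s hsI h0 => by have := habs s hsI; simp [h0] at this)
    rcases this with h1 | h1
    · refine ⟨-1, Or.inr rfl, fun s hsI => ?_⟩
      have := habs s hsI
      rw [abs_of_neg (h1 s hsI)] at this
      linarith
    · refine ⟨1, Or.inl rfl, fun s hsI => ?_⟩
      have := habs s hsI
      rwa [abs_of_pos (h1 s hsI)] at this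
  obtain ⟨ε, hε, hεs⟩ := hsign
  obtain ⟨k, hk⟩ : ∃ k, ∀ s ∈ Ioo a b, σ s = ε * s + k := by
    have hd : ∀ s ∈ Ioo a b, HasDerivAt (fun s => σ s - ε * s) 0 s := by
      intro s hsI
      have h1 := hσd s hsI
      rw [hεs s hsI] at h1
      simpa using h1.fun_sub ((hasDerivAt_id s).const_mul ε)
    obtain ⟨k, hk⟩ := isOpen_Ioo.exists_is_const_of_deriv_eq_zero (convex_Ioo a b).isPreconnected
      (fun s hsI => (hd s hsI).differentiableAt.differentiableWithinAt)
      (fun s hsI => (hd s hsI).deriv)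
    exact ⟨k, fun s hsI => by linarith [hk s hsI]⟩
  refine ⟨ε, k, hε, fun s hsI => ?_⟩
  rw [← hk s hsI]
  refine ⟨(hmem s hsI).1, (hmem s hsI).2, rfl, ?_, ?_⟩
  · have := h.symm_apply (hs s hsI)
    rw [(hu s hsI).2.1] at this
    exact this.symm
  · have := hvel s hsI
    rwa [hεs s hsI] at this

lemma IsBox.isUnitHorizontal (h : IsBox f p r Θ c g) {t₀ : ℝ} (ht₀ : t₀ ∈ Metric.ball (f p).2 r)
    {ε k : ℝ} (hε : ε = 1 ∨ ε = -1) {s : ℝ} (hs : ε * s + k ∈ Metric.ball (0 : ℝ) r) :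
    IsUnitHorizontal f t₀ (fun s => (Θ.symm (ε * s + k, t₀), ε • deriv c (ε * s + k))) s := by
  have hp : ∀ s, ε * s + k ∈ Metric.ball (0 : ℝ) r →
      ((f (Θ.symm (ε * s + k, t₀))).1 : ℂ) = c (ε * s + k) ∧
      (f (Θ.symm (ε * s + k, t₀))).2 = t₀ := fun s hs => coord_eq_iff.1 (h.param _ hs t₀ ht₀)
  have hev : ∀ᶠ s' in 𝓝 s, ε * s' + k ∈ Metric.ball (0 : ℝ) r :=
    (Continuous.continuousAt (by fun_prop : Continuous fun s => ε * s + k)).eventually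
      (Metric.isOpen_ball.mem_nhds hs)
  have haff : HasDerivAt (fun s => ε * s + k) ε s := by
    simpa using ((hasDerivAt_id s).const_mul ε).add_const k
  have hcat := h.smooth.contDiffAt (Metric.isOpen_ball.mem_nhds hs)
  refine ⟨?_, (hp s hs).2, ?_, ?_⟩
  · refine ContinuousAt.prodMk ?_ (ContinuousAt.const_smul ?_ ε)
    · exact ContinuousAt.comp (f := fun s => (ε * s + k, t₀)) (h.continuousAt_symm hs ht₀)
        (by fun_prop)
    · exact ContinuousAt.comp (f := fun s => ε * s + k) (contDiffAt_deriv hcat).continuousAt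
        (by fun_prop)
  · refine (HasDerivAt.scomp s (h.hasDerivAt hs) haff).congr_of_eventuallyEq ?_
    filter_upwards [hev] with s' hs' using (hp s' hs').1
  · have : ‖ε‖ = 1 := by rcases hε with rfl | rfl <;> simp
    change ‖ε • deriv c (ε * s + k)‖ = _
    rw [norm_smul, this, one_mul, h.speed _ hs, ← UpperHalfPlane.coe_im, (hp s hs).1]

/-- Position alone leaves the direction of travel undetermined; carrying the velocity as part of the
state makes solutions locally unique, as continuation requires. -/
lemma exists_horizontal_curve [CompleteSpace M] (hb : HasBoxes f) (p : M) :
    ∃ u : ℝ → M × ℂ, (u 0).1 = p ∧ ∀ s, IsUnitHorizontal f (f p).2 u s := by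
  obtain ⟨r, Θ, c, g, h⟩ := hb p
  obtain ⟨t₀, ht₀⟩ : ∃ t₀, t₀ = (f p).2 := ⟨_, rfl⟩
  have ht₀m : t₀ ∈ Metric.ball (f p).2 r := ht₀ ▸ Metric.mem_ball_self h.pos
  have hgen : ∀ {u : ℝ → M × ℂ} {a b s : ℝ}, (∀ s ∈ Ioo a b, IsUnitHorizontal f t₀ u s) →
      s ∈ Ioo a b → ∀ {r : ℝ} {Θ : OpenPartialHomeomorph M (ℝ × ℝ)} {c : ℝ → ℂ} {g : ℂ → ℝ},
      IsBox f (u s).1 r Θ c g → ∃ δ > 0, ∃ ε : ℝ, (ε = 1 ∨ ε = -1) ∧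
        ∀ s' ∈ Ioo (s - δ) (s + δ), ε * (s' - s) ∈ Metric.ball (0 : ℝ) r ∧
          (u s').1 = Θ.symm (ε * (s' - s), t₀) ∧ (u s').2 = ε • deriv c (ε * (s' - s)) := by
    intro u a b s hu hs r Θ c g h
    have hc : ContinuousAt (fun s => (u s).1) s := (hu s hs).1.fst
    obtain ⟨δ, hδ, hδs⟩ := Metric.eventually_nhds_iff_ball.1
      ((show ∀ᶠ s' in 𝓝 s, s' ∈ Ioo a b from isOpen_Ioo.mem_nhds hs).and (hc.eventually (Θ.open_source.mem_nhds h.mem)))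
    rw [Real.ball_eq_Ioo] at hδs
    obtain ⟨ε, k, hε, hk⟩ := h.eq_of_horizontal (fun s' hs' => hu s' (hδs s' hs').1)
      (fun s' hs' => (hδs s' hs').2)
    have hk0 := (hk s ⟨by linarith, by linarith⟩).2.2.1
    rw [h.apply_center] at hk0
    have hkk : k = -(ε * s) := by linarith
    refine ⟨δ, hδ, ε, hε, fun s' hs' => ?_⟩
    obtain ⟨h1, -, -, h2, h3⟩ := hk s' hs'
    rw [show ε * s' + k = ε * (s' - s) by rw [hkk]; ring] at h1 h2 h3
    exact ⟨h1, h2, h3⟩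
  suffices hG : ∃ u : ℝ → M × ℂ, u 0 = (Θ.symm (1 * 0 + 0, t₀), (1 : ℝ) • deriv c (1 * 0 + 0)) ∧
      ∀ s, ∀ᶠ s' in 𝓝 s, IsUnitHorizontal f t₀ u s' by
    obtain ⟨u, hu0, hu⟩ := hG
    refine ⟨u, ?_, fun s => ht₀ ▸ (hu s).self_of_nhds⟩
    rw [hu0, ht₀]
    simpa using h.symm_center
  refine exists_global_solution (S := fun u s => ∀ᶠ s' in 𝓝 s, IsUnitHorizontal f t₀ u s')
    (τ := 0) (r := r) (u₀ := fun s => (Θ.symm (1 * s + 0, t₀), (1 : ℝ) • deriv c (1 * s + 0)))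
    ?_ (fun u t hu => hu.self_of_nhds.1) ?_ ?_ h.pos ?_
  · intro u v t huv hu
    filter_upwards [huv.eventually_nhds, hu] with s hs1 hs2 using hs2.congr hs1
  · intro u v s hu hv huv
    obtain ⟨r, Θ, c, g, h⟩ := hb (u s).1
    have h' : IsBox f (v s).1 r Θ c g := huv ▸ h
    obtain ⟨δ₁, hδ₁, hu'⟩ := Metric.eventually_nhds_iff_ball.1 hu
    obtain ⟨δ₂, hδ₂, hv'⟩ := Metric.eventually_nhds_iff_ball.1 hv
    rw [Real.ball_eq_Ioo] at hu' hv'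
    obtain ⟨η₁, hη₁, ε₁, hε₁, h1⟩ := hgen hu' ⟨by linarith, by linarith⟩ h
    obtain ⟨η₂, hη₂, ε₂, hε₂, h2⟩ := hgen hv' ⟨by linarith, by linarith⟩ h'
    have e1 := (h1 s ⟨by linarith, by linarith⟩).2.2
    have e2 := (h2 s ⟨by linarith, by linarith⟩).2.2
    have hne := h.deriv_ne_zero (Metric.mem_ball_self h.pos)
    rw [sub_self, mul_zero] at e1 e2
    -- Equal velocities at `s` force equal signs, because `deriv c 0 ≠ 0`.
    have hεε : ε₁ = ε₂ := by
      rw [huv, e2] at e1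
      exact (smul_left_injective ℝ hne e1).symm
    subst hεε
    filter_upwards [Ioo_mem_nhds (show s - η₁ < s by linarith) (show s < s + η₁ by linarith),
      Ioo_mem_nhds (show s - η₂ < s by linarith) (show s < s + η₂ by linarith)] with s' m1 m2
    exact Prod.ext ((h1 s' m1).2.1.trans (h2 s' m2).2.1.symm)
      ((h1 s' m1).2.2.trans (h2 s' m2).2.2.symm)
  · intro u a b hab hu T hT
    replace hu : ∀ s ∈ Ioo a b, IsUnitHorizontal f t₀ u s := fun s hs => (hu s hs).self_of_nhds
    have hTc : T ∈ closure (Ioo a b) := by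
      rw [closure_Ioo hab.ne]
      rcases hT with rfl | rfl
      · exact left_mem_Icc.2 hab.le
      · exact right_mem_Icc.2 hab.le
    obtain ⟨q, hq⟩ := exists_tendsto_of_local_lipschitz (u := fun s => (u s).1) hTc fun s hs => by
      obtain ⟨r, Θ, c, g, h⟩ := hb (u s).1
      obtain ⟨δ, hδ, ε, hε, h1⟩ := hgen hu hs h
      have h2 : t₀ ∈ Metric.ball (f (u s).1).2 r := by
        rw [(hu s hs).2.1]; exact Metric.mem_ball_self h.pos
      filter_upwards [Ioo_mem_nhds (show s - δ < s by linarith) (show s < s + δ by linarith)]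
        with s' hs'
      have m := h1 s ⟨by linarith, by linarith⟩
      have m' := h1 s' hs'
      have hl := h.lipschitz _ (h.target ▸ ⟨m.1, h2⟩ : (ε * (s - s), t₀) ∈ Θ.target) _
        (h.target ▸ ⟨m'.1, h2⟩ : (ε * (s' - s), t₀) ∈ Θ.target)
      rw [← m.2.1, ← m'.2.1] at hl
      refine hl.trans_eq ?_
      have : |ε| = 1 := by rcases hε with rfl | rfl <;> simp
      simp only [sub_self, mul_zero, abs_zero, add_zero, zero_sub, abs_neg, abs_mul, this, one_mul]
      exact abs_sub_comm _ _
    have hne : NeBot (𝓝[Ioo a b] T) := mem_closure_iff_nhdsWithin_neBot.1 hTc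
    obtain ⟨r, Θ, c, g, h⟩ := hb q
    obtain ⟨δ, hδ, hδs⟩ := Metric.mem_nhdsWithin_iff.1
      (hq.eventually (Θ.open_source.mem_nhds h.mem))
    rw [Real.ball_eq_Ioo, Ioo_inter_Ioo] at hδs
    obtain ⟨ε, k, hε, hk⟩ := h.eq_of_horizontal (a := max (T - δ) a) (b := min (T + δ) b)
      (fun s hs => hu s ⟨(le_max_right _ _).trans_lt hs.1, hs.2.trans_le (min_le_right _ _)⟩)
      (fun s hs => hδs hs)
    have hev : ∀ᶠ s in 𝓝[Ioo a b] T, s ∈ Ioo (max (T - δ) a) (min (T + δ) b) := by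
      filter_upwards [self_mem_nhdsWithin, mem_nhdsWithin_of_mem_nhds
        (Ioo_mem_nhds (show T - δ < T by linarith) (show T < T + δ by linarith))] with s h1 h2
      exact ⟨max_lt h2.1 h1.1, lt_min h2.2 h1.2⟩
    -- The limit point `q` is the centre of its box. Comparing the limit of `Θ (u s).1` with the
    -- affine formula fixes `k` and shows that `q` has height `t₀`, so the formula makes sense past
    -- `T`.
    have hlim : ((0 : ℝ), (f q).2) = (ε * T + k, t₀) := by
      have h1 : Tendsto (fun s => Θ (u s).1) (𝓝[Ioo a b] T) (𝓝 (Θ q)) :=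
        (Θ.continuousAt h.mem).tendsto.comp hq
      have h2 : Tendsto (fun s : ℝ => (ε * s + k, t₀)) (𝓝[Ioo a b] T) (𝓝 (ε * T + k, t₀)) :=
        (Continuous.tendsto (by fun_prop) T).mono_left nhdsWithin_le_nhds
      rw [h.apply q h.mem, h.apply_center] at h1
      refine tendsto_nhds_unique (h1.congr' ?_) h2
      filter_upwards [hev] with s hs
      have := hk s hs
      rw [h.apply _ (hδs hs), this.2.2.1, (hu s ⟨(le_max_right _ _).trans_lt hs.1,
        hs.2.trans_le (min_le_right _ _)⟩).2.1]
    have hT0 : ε * T + k = 0 := (congrArg Prod.fst hlim).symm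
    have ht : (f q).2 = t₀ := congrArg Prod.snd hlim
    have habs : |ε| = 1 := by rcases hε with rfl | rfl <;> simp
    refine ⟨min δ r, lt_min hδ h.pos,
      fun s => (Θ.symm (ε * s + k, t₀), ε • deriv c (ε * s + k)), fun s hs => ?_,
      fun s hs hsT => ?_⟩
    · have : ∀ᶠ s' in 𝓝 s, |s' - T| < r :=
        (Continuous.continuousAt (by fun_prop)).eventually_lt continuousAt_const
          (hs.trans_le (min_le_right _ _))
      filter_upwards [this] with s' hs'
      refine h.isUnitHorizontal (ht ▸ Metric.mem_ball_self h.pos) hε ?_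
      rw [show ε * s' + k = ε * (s' - T) by linarith, mem_ball_zero_iff, Real.norm_eq_abs,
        abs_mul, habs, one_mul]
      exact hs'
    · have hlt := abs_lt.1 (hsT.trans_le (min_le_left _ _))
      have := hk s ⟨max_lt (by linarith) hs.1, lt_min (by linarith) hs.2⟩
      exact Prod.ext this.2.2.2.1 this.2.2.2.2
  · intro s hs
    have : ∀ᶠ s' in 𝓝 s, |s' - 0| < r :=
      (Continuous.continuousAt (by fun_prop)).eventually_lt continuousAt_const hs
    filter_upwards [this] with s' hs'
    refine h.isUnitHorizontal ht₀m (Or.inl rfl) ?_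
    simpa using hs'

end Horizontal

/-! ### The development of the surface by the plane. -/

section Development

variable {M : Type*} [MetricSpace M] [ChartedSpace E2 M]
  [Bundle.RiemannianBundle (fun p : M => TangentSpace (𝓡 2) p)] {f : M → ℍ × ℝ}

/-- Reversing time leaves the second derivative unchanged and flips the velocity, which enters
quadratically. -/
lemma acc_comp_affine {c : ℝ → ℂ} {ε s : ℝ} (hε : ε = 1 ∨ ε = -1) :
    acc (fun s' => c (ε * (s' - s))) s = acc c 0 := by
  have h1 : deriv (fun s' => c (ε * (s' - s))) = fun s' => ε • deriv c (ε * (s' - s)) := by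
    funext x
    rw [deriv_comp_sub_const (f := fun y => c (ε * y)), deriv_comp_mul_left]
  have h2 : deriv (fun s' => ε • deriv c (ε * (s' - s))) s = ε • ε • deriv (deriv c) 0 := by
    rw [deriv_fun_const_smul_field, deriv_comp_sub_const (f := fun y => deriv c (ε * y)),
      deriv_comp_mul_left]
    simp
  simp only [acc, h1, h2, sub_self, mul_zero]
  rcases hε with rfl | rfl <;> simp

/-- A complete vertical surface is the image of the plane by a local homeomorphism, in which the
immersion becomes the product of a unit speed curve of `ℍ` with the line. -/
theorem exists_development [CompleteSpace M] (hb : HasBoxes f) (hf : Continuous (coord ∘ f))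
    (p : M) : ∃ (e : ℝ × ℝ → M) (C : ℝ → ℍ), e (0, (f p).2) = p ∧ Continuous e ∧ IsOpenMap e ∧
      (∀ s t, f (e (s, t)) = (C s, t)) ∧ ContDiff ℝ ∞ (fun s => (C s : ℂ)) ∧
      (∀ s, ‖deriv (fun s => (C s : ℂ)) s‖ = (C s).im) ∧
      ∀ s t, e (s, t) ∈ planarPoints f ↔ acc (fun s => (C s : ℂ)) s = 0 := by
  obtain ⟨V, hVc, hV0, hVf⟩ := exists_vertical_flow hb hf
  obtain ⟨u, hu0, hu⟩ := exists_horizontal_curve hb p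
  set C : ℝ → ℍ := fun s => (f (u s).1).1 with hC
  set e : ℝ × ℝ → M := fun x => V ((u x.1).1, x.2) with he
  have huc : Continuous u := continuous_iff_continuousAt.2 fun s => (hu s).1
  have hec : Continuous e := hVc.comp (by fun_prop)
  have hef : ∀ s t, f (e (s, t)) = (C s, t) := by
    intro s t
    have := coord_eq_iff.1 (hVf (u s).1 t)
    exact Prod.ext (UpperHalfPlane.ext this.1) this.2
  have hspeed : ∀ s, ‖(u s).2‖ = (C s).im := fun s => (hu s).2.2.2
  have hder : ∀ s, HasDerivAt (fun s => (C s : ℂ)) (u s).2 s := fun s => (hu s).2.2.1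
  -- In a box, `e` is `Θ.symm` after a translation and possibly a reflection of the first variable.
  -- Openness, smoothness of `C` and the planarity criterion all follow from this local form.
  have hlocal : ∀ s t, ∃ r Θ c g, IsBox f (e (s, t)) r Θ c g ∧ ∃ ε : ℝ, (ε = 1 ∨ ε = -1) ∧
      ∃ δ > 0, δ ≤ r ∧ (∀ s' ∈ Ioo (s - δ) (s + δ), (C s' : ℂ) = c (ε * (s' - s))) ∧
      ∀ x : ℝ × ℝ, x ∈ Metric.ball (s, t) δ → e x = Θ.symm (ε * (x.1 - s), x.2) := by
    intro s t
    obtain ⟨r, Θ, c, g, h⟩ := hb (e (s, t))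
    obtain ⟨δ, hδ, hδs⟩ := Metric.eventually_nhds_iff_ball.1
      (hec.continuousAt.eventually (Θ.open_source.mem_nhds h.mem))
    -- Sliding the horizontal curve vertically to height `t` keeps its projection, so the result is
    -- again horizontal of unit speed and `eq_of_horizontal` applies to it.
    have hut : ∀ s' ∈ Ioo (s - δ) (s + δ),
        IsUnitHorizontal f t (fun s => (e (s, t), (u s).2)) s' := by
      intro s' _
      refine ⟨?_, by simp only [hef], ?_, ?_⟩
      · exact Continuous.continuousAt (by fun_prop)
      · simp only [hef]; exact hder s'
      · simp only [hef]; exact hspeed s'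
    obtain ⟨ε, k, hε, hk⟩ := h.eq_of_horizontal hut fun s' hs' => hδs (s', t) (by
      rw [← ball_prod_same, Real.ball_eq_Ioo]
      exact ⟨hs', Metric.mem_ball_self hδ⟩)
    have hk0 := (hk s ⟨by linarith, by linarith⟩).2.2.1
    simp only [h.apply_center] at hk0
    have hk1 : ∀ s', ε * s' + k = ε * (s' - s) := fun s' => by linarith
    refine ⟨r, Θ, c, g, h, ε, hε, min δ r, lt_min hδ h.pos, min_le_right _ _,
      fun s' hs' => ?_, fun x hx => ?_⟩
    · have hs'' : s' ∈ Ioo (s - δ) (s + δ) :=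
        ⟨by linarith [hs'.1, min_le_left δ r], by linarith [hs'.2, min_le_left δ r]⟩
      obtain ⟨h1, h2, h3, h4, -⟩ := hk s' hs''
      have h5 := h.param _ h1 _ h2
      rw [← h4] at h5
      simp only [hef] at h5
      rw [coord_eq_iff] at h5
      rw [← hk1]
      exact h5.1
    · have hxδ := Metric.ball_subset_ball (min_le_left δ r) hx
      have hsrc := hδs x hxδ
      rw [← ball_prod_same, Real.ball_eq_Ioo] at hxδ
      have h3 := (hk x.1 hxδ.1).2.2.1
      have h4 := h.symm_apply hsrc
      have h5 : f (e x) = (C x.1, x.2) := hef x.1 x.2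
      simp only [hef] at h3
      rw [h5, h3, hk1] at h4
      exact h4.symm
  refine ⟨e, C, ?_, hec, ?_, hef, ?_, fun s => by rw [(hder s).deriv, hspeed], ?_⟩
  · simp only [he, hu0]; exact hV0 p
  · rw [isOpenMap_iff_nhds_le]
    rintro ⟨s, t⟩
    obtain ⟨r, Θ, c, g, h, ε, hε, δ, hδ, hδr, -, hloc⟩ := hlocal s t
    have hε0 : ε ≠ 0 := by rcases hε with rfl | rfl <;> norm_num
    have hmem : ((0 : ℝ), t) ∈ Θ.target := by
      rw [h.target, hef]
      exact ⟨Metric.mem_ball_self h.pos, Metric.mem_ball_self h.pos⟩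
    set A : ℝ × ℝ ≃ₜ ℝ × ℝ := ((Homeomorph.subRight s).trans
      (Homeomorph.mulLeft₀ ε hε0)).prodCongr (Homeomorph.refl ℝ) with hA
    have hA' : ∀ x, A x = (ε * (x.1 - s), x.2) := fun x => rfl
    have heq : e =ᶠ[𝓝 (s, t)] Θ.symm ∘ A := by
      filter_upwards [Metric.ball_mem_nhds (s, t) hδ] with x hx
      rw [hloc x hx, Function.comp_apply, hA']
    rw [map_congr heq, ← map_map, A.map_nhds_eq, hA']
    simp only [sub_self, mul_zero]
    rw [Θ.symm.map_nhds_eq hmem, hloc (s, t) (Metric.mem_ball_self hδ)]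
    simp
  · refine contDiff_iff_contDiffAt.2 fun s => ?_
    obtain ⟨r, Θ, c, g, h, ε, hε, δ, hδ, hδr, hCc, -⟩ := hlocal s 0
    have h1 : ContDiffAt ℝ ∞ c (ε * (s - s)) :=
      h.smooth.contDiffAt (by rw [sub_self, mul_zero]; exact Metric.ball_mem_nhds 0 h.pos)
    have h2 : ContDiffAt ℝ ∞ (fun s' => c (ε * (s' - s))) s :=
      ContDiffAt.comp (f := fun s' => ε * (s' - s)) s h1 (by fun_prop)
    refine h2.congr_of_eventuallyEq ?_
    filter_upwards [Ioo_mem_nhds (show s - δ < s by linarith) (show s < s + δ by linarith)]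
      with s' hs' using hCc s' hs'
  · intro s t
    obtain ⟨r, Θ, c, g, h, ε, hε, δ, hδ, hδr, hCc, -⟩ := hlocal s t
    rw [h.planar, ← acc_comp_affine (s := s) hε]
    refine Eq.congr (acc_congr ?_) rfl
    filter_upwards [Ioo_mem_nhds (show s - δ < s by linarith) (show s < s + δ by linarith)]
      with s' hs' using (hCc s' hs').symm

end Development

/-! ### Geodesics of the upper half-plane -/

section Geodesic

variable {x₀ y₀ C S : ℝ}

lemma geodesicDenom_pos (h : C ^ 2 + S ^ 2 = 1) (s : ℝ) : 0 < Real.cosh s - S * Real.sinh s := by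
  have h1 := Real.cosh_sq s
  have h2 := Real.cosh_pos s
  have h3 : (S * Real.sinh s) ^ 2 < Real.cosh s ^ 2 := by
    nlinarith [sq_nonneg (C * Real.sinh s), sq_nonneg (Real.sinh s)]
  linarith [(abs_lt_of_sq_lt_sq' h3 h2.le).2]

/-- The geodesic through `x₀ + i y₀` with initial velocity `y₀ (C + i S)`. -/
def geodesicFrom (x₀ : ℝ) (hy : 0 < y₀) (h : C ^ 2 + S ^ 2 = 1) (s : ℝ) : ℍ :=
  ⟨⟨x₀ + y₀ * C * Real.sinh s / (Real.cosh s - S * Real.sinh s),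
    y₀ / (Real.cosh s - S * Real.sinh s)⟩, div_pos hy (geodesicDenom_pos h s)⟩

variable (x₀) (hy : 0 < y₀) (h : C ^ 2 + S ^ 2 = 1)

lemma geodesicFrom_re (s : ℝ) : (geodesicFrom x₀ hy h s).re
    = x₀ + y₀ * C * Real.sinh s / (Real.cosh s - S * Real.sinh s) := rfl

lemma geodesicFrom_im (s : ℝ) : (geodesicFrom x₀ hy h s).im
    = y₀ / (Real.cosh s - S * Real.sinh s) := rfl

/-- Distances are compared through their `cosh`. That `γ` is an isometry on all of `ℝ` is what later
makes it injective, and a closed embedding. -/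
lemma isometry_geodesicFrom : Isometry (geodesicFrom x₀ hy h) := by
  refine Isometry.of_dist_eq fun s t => ?_
  rw [Real.dist_eq]
  refine Real.cosh_injOn dist_nonneg (abs_nonneg (s - t)) ?_
  rw [Real.cosh_abs, Real.cosh_sub, UpperHalfPlane.cosh_dist, Complex.dist_eq,
    ← Complex.normSq_eq_norm_sq, Complex.normSq_apply]
  simp only [Complex.sub_re, Complex.sub_im, UpperHalfPlane.coe_re, UpperHalfPlane.coe_im,
    geodesicFrom_re, geodesicFrom_im]
  have h1 := Real.cosh_sq s
  have h2 := Real.cosh_sq t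
  have hD := (geodesicDenom_pos h s).ne'
  have hE := (geodesicDenom_pos h t).ne'
  generalize Real.cosh s = b at *
  generalize Real.cosh t = b' at *
  generalize Real.sinh s = a at *
  generalize Real.sinh t = a' at *
  have hy' := hy.ne'
  -- With the two denominators as variables, the claim is a polynomial consequence of `h` and `cosh²
  -- = sinh² + 1`.
  obtain ⟨D, rfl⟩ : ∃ D, b = D + S * a := ⟨b - S * a, by ring⟩
  obtain ⟨E, rfl⟩ : ∃ E, b' = E + S * a' := ⟨b' - S * a', by ring⟩
  simp only [add_sub_cancel_right] at *
  field_simp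
  linear_combination y₀ ^ 2 * ((a * E - a' * D) ^ 2 * h - E ^ 2 * h1 - D ^ 2 * h2)

lemma isUnitSpeedGeodesic_geodesicFrom : IsUnitSpeedGeodesic (geodesicFrom x₀ hy h) := by
  have hD : ∀ s, HasDerivAt (fun s => Real.cosh s - S * Real.sinh s)
      (Real.sinh s - S * Real.cosh s) s := fun s =>
    (Real.hasDerivAt_cosh s).sub ((Real.hasDerivAt_sinh s).const_mul S)
  have hD' : ∀ s, HasDerivAt (fun s => Real.sinh s - S * Real.cosh s)
      (Real.cosh s - S * Real.sinh s) s := fun s =>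
    (Real.hasDerivAt_sinh s).sub ((Real.hasDerivAt_cosh s).const_mul S)
  have hne : ∀ s, Real.cosh s - S * Real.sinh s ≠ 0 := fun s => (geodesicDenom_pos h s).ne'
  have hq : ∀ s, (Real.cosh s - S * Real.sinh s) ^ 2 - (Real.sinh s - S * Real.cosh s) ^ 2
      = C ^ 2 := fun s => by
    linear_combination (1 - S ^ 2) * Real.cosh_sq s - h
  have hco : ∀ s, (geodesicFrom x₀ hy h s : ℂ)
      = ((x₀ + y₀ * C * Real.sinh s / (Real.cosh s - S * Real.sinh s) : ℝ) : ℂ)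
        + ((y₀ / (Real.cosh s - S * Real.sinh s) : ℝ) : ℂ) * Complex.I := fun s =>
    (Complex.re_add_im _).symm
  have hd1 : ∀ s, HasDerivAt (fun s => (geodesicFrom x₀ hy h s : ℂ))
      (((y₀ * C / (Real.cosh s - S * Real.sinh s) ^ 2 : ℝ) : ℂ)
        + ((-(y₀ * (Real.sinh s - S * Real.cosh s)) / (Real.cosh s - S * Real.sinh s) ^ 2 : ℝ) : ℂ)
          * Complex.I) s := by
    intro s
    have e1 : HasDerivAt (fun s => x₀ + y₀ * C * Real.sinh s / (Real.cosh s - S * Real.sinh s))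
        (y₀ * C / (Real.cosh s - S * Real.sinh s) ^ 2) s := by
      refine ((((Real.hasDerivAt_sinh s).const_mul (y₀ * C)).fun_div (hD s)
        (hne s)).const_add x₀).congr_deriv ?_
      congr 1
      linear_combination (y₀ * C) * Real.cosh_sq s
    have e2 : HasDerivAt (fun s => y₀ / (Real.cosh s - S * Real.sinh s))
        (-(y₀ * (Real.sinh s - S * Real.cosh s)) / (Real.cosh s - S * Real.sinh s) ^ 2) s := by
      refine ((hasDerivAt_const s y₀).fun_div (hD s) (hne s)).congr_deriv ?_
      congr 1
      ring
    simp only [hco]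
    exact e1.ofReal_comp.add (e2.ofReal_comp.mul_const Complex.I)
  have hderiv : deriv (fun s => (geodesicFrom x₀ hy h s : ℂ)) = _ := funext fun s => (hd1 s).deriv
  have hd2 : ∀ s, HasDerivAt (deriv fun s => (geodesicFrom x₀ hy h s : ℂ))
      (((-(2 * y₀ * C * (Real.sinh s - S * Real.cosh s))
          / (Real.cosh s - S * Real.sinh s) ^ 3 : ℝ) : ℂ)
        + ((y₀ * (2 * (Real.sinh s - S * Real.cosh s) ^ 2 - (Real.cosh s - S * Real.sinh s) ^ 2)
          / (Real.cosh s - S * Real.sinh s) ^ 3 : ℝ) : ℂ) * Complex.I) s := by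
    intro s
    rw [hderiv]
    have e1 : HasDerivAt (fun s => y₀ * C / (Real.cosh s - S * Real.sinh s) ^ 2)
        (-(2 * y₀ * C * (Real.sinh s - S * Real.cosh s))
          / (Real.cosh s - S * Real.sinh s) ^ 3) s := by
      refine ((hasDerivAt_const s (y₀ * C)).fun_div ((hD s).fun_pow 2)
        (pow_ne_zero 2 (hne s))).congr_deriv ?_
      have := hne s
      field_simp
      ring
    have e2 : HasDerivAt (fun s => -(y₀ * (Real.sinh s - S * Real.cosh s))
          / (Real.cosh s - S * Real.sinh s) ^ 2)
        (y₀ * (2 * (Real.sinh s - S * Real.cosh s) ^ 2 - (Real.cosh s - S * Real.sinh s) ^ 2)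
          / (Real.cosh s - S * Real.sinh s) ^ 3) s := by
      refine ((((hD' s).const_mul y₀).fun_neg).fun_div ((hD s).fun_pow 2)
        (pow_ne_zero 2 (hne s))).congr_deriv ?_
      have := hne s
      field_simp
      ring
    exact e1.ofReal_comp.add (e2.ofReal_comp.mul_const Complex.I)
  refine ⟨?_, fun s => ?_, fun s => ?_⟩
  · have e0 : ContDiff ℝ ∞ fun s => Real.cosh s - S * Real.sinh s :=
      Real.contDiff_cosh.sub (contDiff_const.mul Real.contDiff_sinh)
    have e1 : ContDiff ℝ ∞ fun s =>
        x₀ + y₀ * C * Real.sinh s / (Real.cosh s - S * Real.sinh s) :=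
      contDiff_const.add ((contDiff_const.mul Real.contDiff_sinh).div e0 hne)
    have e2 : ContDiff ℝ ∞ fun s => y₀ / (Real.cosh s - S * Real.sinh s) :=
      contDiff_const.div e0 hne
    simp only [hco]
    exact (Complex.ofRealCLM.contDiff.comp e1).add
      ((Complex.ofRealCLM.contDiff.comp e2).mul contDiff_const)
  · rw [(hd1 s).deriv, div_eq_one_iff_eq (geodesicFrom x₀ hy h s).im_pos.ne', geodesicFrom_im]
    have hpos := div_pos hy (geodesicDenom_pos h s)
    rw [← sq_eq_sq₀ (norm_nonneg _) hpos.le, ← Complex.normSq_eq_norm_sq, Complex.normSq_add_mul_I]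
    have := hne s
    field_simp
    linear_combination -hq s
  · rw [(hd2 s).deriv, (hd1 s).deriv, geodesicFrom_im]
    have := hne s
    have hq' := hq s
    generalize Real.cosh s - S * Real.sinh s = D at *
    generalize Real.sinh s - S * Real.cosh s = D' at *
    have hDc : (D : ℂ) ≠ 0 := by exact_mod_cast this
    have hyc : (y₀ : ℂ) ≠ 0 := by exact_mod_cast hy.ne'
    have hqc : (D : ℂ) ^ 2 - (D' : ℂ) ^ 2 = (C : ℂ) ^ 2 := by exact_mod_cast hq'
    push_cast
    field_simp
    have hI := Complex.I_sq
    linear_combination (-(y₀ * Complex.I)) * hqc +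
      (y₀ * (-(2 * C * D') + D' ^ 2 * Complex.I)) * hI

end Geodesic

/-- For `u'' = u`, both `(u + u') exp (-s)` and `(u - u') exp s` are constant. -/
lemma eq_cosh_sinh_of_hasDerivAt {u u' : ℝ → ℝ} {J : Set ℝ} (hJ : Convex ℝ J)
    (h0 : (0 : ℝ) ∈ J) (hu : ∀ s ∈ J, HasDerivAt u (u' s) s) (hu' : ∀ s ∈ J, HasDerivAt u' (u s) s)
    {s : ℝ} (hs : s ∈ J) : u s = u 0 * Real.cosh s + u' 0 * Real.sinh s := by
  have key : ∀ φ : ℝ → ℝ, (∀ s ∈ J, HasDerivAt φ 0 s) → φ s = φ 0 := by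
    intro φ hφ
    have := hJ.norm_image_sub_le_of_norm_hasDerivWithin_le (C := 0)
      (fun x hx => (hφ x hx).hasDerivWithinAt) (by simp) h0 hs
    rw [zero_mul] at this
    exact sub_eq_zero.1 (norm_le_zero_iff.1 this)
  have h1 := key (fun s => (u s + u' s) * Real.exp (-s)) fun s hs => by
    refine (((hu s hs).fun_add (hu' s hs)).fun_mul ((Real.hasDerivAt_exp _).comp s
      (hasDerivAt_neg s))).congr_deriv ?_
    simp
    ring
  have h2 := key (fun s => (u s - u' s) * Real.exp s) fun s hs => by
    refine (((hu s hs).fun_sub (hu' s hs)).fun_mul (Real.hasDerivAt_exp s)).congr_deriv ?_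
    ring
  simp only [neg_zero, Real.exp_zero, mul_one] at h1 h2
  rw [Real.exp_neg] at h1
  have hpos := (Real.exp_pos s).ne'
  rw [Real.cosh_eq, Real.sinh_eq, Real.exp_neg]
  have h3 : u s + u' s = (u 0 + u' 0) * Real.exp s := by
    rw [← h1]; field_simp
  have h4 : u s - u' s = (u 0 - u' 0) * (Real.exp s)⁻¹ := by
    rw [← h2]; field_simp
  linear_combination h3 / 2 + h4 / 2

/-- Along a unit speed geodesic, `1 / y` and `x / y` solve `u'' = u`: they are linear coordinates of
the hyperboloid model. Hence they are combinations of `cosh` and `sinh` with the initial data of the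
explicit geodesic. The set `J` may be reduced to a point, since `c` is differentiable on the whole
line. -/
lemma exists_geodesic_of_acc_eq_zero {c : ℝ → ℍ} (hc : ContDiff ℝ ∞ fun s => (c s : ℂ))
    (hspeed : ∀ s, ‖deriv (fun s => (c s : ℂ)) s‖ = (c s).im) {J : Set ℝ} (hJ : Convex ℝ J)
    (h0 : (0 : ℝ) ∈ J) (hacc : ∀ s ∈ J, acc (fun s => (c s : ℂ)) s = 0) :
    ∃ γ : ℝ → ℍ, IsUnitSpeedGeodesic γ ∧ Isometry γ ∧ ∀ s ∈ J, γ s = c s := by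
  set d1 := deriv fun s => (c s : ℂ) with hd1
  set d2 := deriv d1 with hd2
  have e1 : ∀ s, HasDerivAt (fun s => (c s : ℂ)) (d1 s) s := fun s =>
    (hc.contDiffAt.differentiableAt (by simp)).hasDerivAt
  have e2 : ∀ s, HasDerivAt d1 (d2 s) s := fun s =>
    ((contDiffAt_deriv hc.contDiffAt).differentiableAt (by simp)).hasDerivAt
  have hx : ∀ s, HasDerivAt (fun s => (c s).re) (d1 s).re s := fun s =>
    Complex.reCLM.hasFDerivAt.comp_hasDerivAt s (e1 s)
  have hy : ∀ s, HasDerivAt (fun s => (c s).im) (d1 s).im s := fun s =>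
    Complex.imCLM.hasFDerivAt.comp_hasDerivAt s (e1 s)
  have hx' : ∀ s, HasDerivAt (fun s => (d1 s).re) (d2 s).re s := fun s =>
    Complex.reCLM.hasFDerivAt.comp_hasDerivAt s (e2 s)
  have hy' : ∀ s, HasDerivAt (fun s => (d1 s).im) (d2 s).im s := fun s =>
    Complex.imCLM.hasFDerivAt.comp_hasDerivAt s (e2 s)
  have hpos : ∀ s, (c s).im ≠ 0 := fun s => (c s).im_pos.ne'
  have hsq : ∀ s, (d1 s).re ^ 2 + (d1 s).im ^ 2 = (c s).im ^ 2 := fun s => by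
    rw [← hspeed s, ← Complex.normSq_eq_norm_sq, Complex.normSq_apply]; ring
  have hre : ∀ s ∈ J, (d2 s).re * (c s).im = 2 * (d1 s).re * (d1 s).im := by
    intro s hs
    have := congrArg Complex.re (hacc s hs)
    simp only [acc, Complex.add_re, Complex.div_ofReal_re, UpperHalfPlane.coe_im, pow_two,
      Complex.mul_re, Complex.mul_im, Complex.I_re, Complex.I_im, Complex.zero_re] at this
    have hp := hpos s
    field_simp at this
    linear_combination this
  have him : ∀ s ∈ J, (d2 s).im * (c s).im = (d1 s).im ^ 2 - (d1 s).re ^ 2 := by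
    intro s hs
    have := congrArg Complex.im (hacc s hs)
    simp only [acc, Complex.add_im, Complex.div_ofReal_im, UpperHalfPlane.coe_im, pow_two,
      Complex.mul_re, Complex.mul_im, Complex.I_re, Complex.I_im, Complex.zero_im] at this
    have hp := hpos s
    field_simp at this
    linear_combination this
  have hu := fun s (hs : s ∈ J) => eq_cosh_sinh_of_hasDerivAt (u := fun s => ((c s).im)⁻¹)
    (u' := fun s => -(d1 s).im / (c s).im ^ 2) hJ h0 (fun s _ => (hy s).fun_inv (hpos s))
    (fun s hs => by
      refine (((hy' s).fun_neg).fun_div ((hy s).fun_pow 2)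
        (pow_ne_zero 2 (hpos s))).congr_deriv ?_
      have hp := hpos s
      field_simp
      linear_combination (c s).im * (-him s hs + hsq s)) hs
  have hv := fun s (hs : s ∈ J) => eq_cosh_sinh_of_hasDerivAt (u := fun s => (c s).re / (c s).im)
    (u' := fun s => ((d1 s).re * (c s).im - (c s).re * (d1 s).im) / (c s).im ^ 2) hJ h0
    (fun s _ => (hx s).fun_div (hy s) (hpos s))
    (fun s hs => by
      refine ((((hx' s).fun_mul (hy s)).fun_sub ((hx s).fun_mul (hy' s))).fun_div
        ((hy s).fun_pow 2) (pow_ne_zero 2 (hpos s))).congr_deriv ?_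
      have hp := hpos s
      field_simp
      linear_combination (c s).im * ((c s).im * hre s hs - (c s).re * him s hs + (c s).re * hsq s)) hs
  have hcs : ((d1 0).re / (c 0).im) ^ 2 + ((d1 0).im / (c 0).im) ^ 2 = 1 := by
    have := hpos 0
    field_simp
    exact hsq 0
  refine ⟨geodesicFrom (c 0).re (c 0).im_pos hcs, isUnitSpeedGeodesic_geodesicFrom _ _ _,
    isometry_geodesicFrom _ _ _, fun s hs => ?_⟩
  have hu := hu s hs
  have hv := hv s hs
  have hDpos := (geodesicDenom_pos hcs s).ne'
  have hp := hpos s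
  have hp0 := hpos 0
  have him' : (geodesicFrom (c 0).re (c 0).im_pos hcs s).im = (c s).im := by
    rw [geodesicFrom_im]
    have : ((c s).im)⁻¹ = (Real.cosh s - (d1 0).im / (c 0).im * Real.sinh s) / (c 0).im := by
      rw [hu]; field_simp; ring
    rw [← inv_inv (c s).im, this, inv_div]
  refine UpperHalfPlane.ext_re_im ?_ him'
  rw [geodesicFrom_im] at him'
  rw [div_eq_iff hp] at hv
  rw [geodesicFrom_re, hv, ← him']
  obtain ⟨D, hD⟩ : ∃ D, Real.cosh s = D + (d1 0).im / (c 0).im * Real.sinh s :=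
    ⟨_, (sub_add_cancel _ _).symm⟩
  rw [hD, add_sub_cancel_right] at hDpos ⊢
  field_simp
  ring

/-! ### Components of the planar set -/

/-- The endpoints are the infimum and supremum in `EReal`. Closedness puts the finite ones in `J`;
infinite ones drop out of the last set because `s` is real. -/
lemma _root_.Set.OrdConnected.exists_ereal_endpoints {J : Set ℝ} (hJ : J.OrdConnected)
    (hc : IsClosed J) (hne : J.Nonempty) :
    ∃ a b : EReal, a ≤ b ∧ interior J = {s : ℝ | a < (s : EReal) ∧ (s : EReal) < b} ∧
      J \ interior J = {s : ℝ | (s : EReal) = a ∨ (s : EReal) = b} := by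
  set a : EReal := sInf ((fun s : ℝ => (s : EReal)) '' J) with ha
  set b : EReal := sSup ((fun s : ℝ => (s : EReal)) '' J) with hb
  have hle : ∀ s ∈ J, a ≤ (s : EReal) ∧ (s : EReal) ≤ b := fun s hs =>
    ⟨sInf_le (mem_image_of_mem _ hs), le_sSup (mem_image_of_mem _ hs)⟩
  have hmem : ∀ s : ℝ, a ≤ (s : EReal) → (s : EReal) ≤ b → s ∈ J := by
    intro s h1 h2
    by_contra hs
    obtain ⟨δ, hδ, hball⟩ := Metric.isOpen_iff.1 hc.isOpen_compl s hs
    rw [Real.ball_eq_Ioo] at hball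
    by_cases hlt : ∃ x ∈ J, x < s
    · obtain ⟨x, hx, hxs⟩ := hlt
      have : b ≤ ((s - δ : ℝ) : EReal) := by
        refine sSup_le ?_
        rintro _ ⟨y, hy, rfl⟩
        refine EReal.coe_le_coe_iff.2 ?_
        by_contra! hlt
        rcases le_total s y with h | h
        · exact hs (hJ.out hx hy ⟨hxs.le, h⟩)
        · exact hball ⟨hlt, by linarith⟩ hy
      have := EReal.coe_le_coe_iff.1 (h2.trans this)
      linarith
    · push Not at hlt
      have : ((s + δ : ℝ) : EReal) ≤ a := by
        refine le_sInf ?_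
        rintro _ ⟨y, hy, rfl⟩
        refine EReal.coe_le_coe_iff.2 ?_
        by_contra! h
        exact hball ⟨by linarith [hlt y hy], h⟩ hy
      have := EReal.coe_le_coe_iff.1 (this.trans h1)
      linarith
  have hint : interior J = {s : ℝ | a < (s : EReal) ∧ (s : EReal) < b} := by
    refine Subset.antisymm (fun s hs => ?_) (interior_maximal (fun s hs => hmem s hs.1.le hs.2.le) ?_)
    · obtain ⟨δ, hδ, hball⟩ := Metric.isOpen_iff.1 isOpen_interior s hs
      rw [Real.ball_eq_Ioo] at hball
      have h1 := hle _ (interior_subset (hball (show s - δ / 2 ∈ _ by constructor <;> linarith)))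
      have h2 := hle _ (interior_subset (hball (show s + δ / 2 ∈ _ by constructor <;> linarith)))
      exact ⟨h1.1.trans_lt (EReal.coe_lt_coe_iff.2 (by linarith)),
        (EReal.coe_lt_coe_iff.2 (by linarith)).trans_le h2.2⟩
    · exact (isOpen_Ioi.preimage continuous_coe_real_ereal).inter
        (isOpen_Iio.preimage continuous_coe_real_ereal)
  obtain ⟨x, hx⟩ := hne
  have hab : a ≤ b := (hle x hx).1.trans (hle x hx).2
  refine ⟨a, b, hab, hint, ?_⟩
  ext s
  rw [hint]
  simp only [Set.mem_sdiff, mem_ofPred_eq, not_and, not_lt]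
  constructor
  · rintro ⟨hs, h⟩
    rcases (hle s hs).1.lt_or_eq with h1 | h1
    · exact Or.inr ((hle s hs).2.antisymm (h h1))
    · exact Or.inl h1.symm
  · rintro (h | h)
    · exact ⟨hmem s h.ge (h.le.trans hab), fun h1 => absurd h h1.ne'⟩
    · exact ⟨hmem s (hab.trans h.ge) h.le, fun _ => h.ge⟩

lemma _root_.IsClosed.connectedComponentIn_of_mem {X : Type*} [TopologicalSpace X] {Z : Set X}
    (hZ : IsClosed Z) {x : X} (hx : x ∈ Z) : IsClosed (connectedComponentIn Z x) :=
  isClosed_of_closure_subset <|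
    isPreconnected_connectedComponentIn.closure.subset_connectedComponentIn
      (subset_closure (mem_connectedComponentIn hx))
      (closure_minimal (connectedComponentIn_subset _ _) hZ)

/-- Unless `J` contains the whole half-line, cut at a point `z ∉ Z` preceding every nonnegative
point of `S`, and take `O = Iio z`, `O' = Iic z`. If `S` meets the half-line, its least point there
is outside `J`, so such a `z` lies before it. -/
lemma exists_isOpen_right {Z J S : Set ℝ} (hS : IsClosed S) (hSJ : Disjoint S J)
    (hJ : ∀ s, 0 ≤ s → s ∉ J → ∃ z ∈ Icc 0 s, z ∉ Z) (h0 : (0 : ℝ) ∈ Z) :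
    ∃ O O' K : Set ℝ, IsOpen O ∧ IsClosed O' ∧ IsCompact K ∧ O ⊆ O' ∧ O' ∩ Z ⊆ O ∧ Iic 0 ⊆ O ∧
      (∀ s ∈ O, 0 ≤ s → s ∉ S) ∧ ∀ s ∈ O', 0 ≤ s → s ∈ J ∪ K := by
  have key : ∀ z, 0 ≤ z → z ∉ Z → (∀ s ∈ S, 0 ≤ s → z ≤ s) →
      ∃ O O' K : Set ℝ, IsOpen O ∧ IsClosed O' ∧ IsCompact K ∧ O ⊆ O' ∧ O' ∩ Z ⊆ O ∧ Iic 0 ⊆ O ∧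
      (∀ s ∈ O, 0 ≤ s → s ∉ S) ∧ ∀ s ∈ O', 0 ≤ s → s ∈ J ∪ K := by
    intro z hz hzZ hzS
    have hz' : 0 < z := hz.lt_of_ne fun h => hzZ (h ▸ h0)
    refine ⟨Iio z, Iic z, Icc 0 z, isOpen_Iio, isClosed_Iic, isCompact_Icc, Iio_subset_Iic_self,
      fun s hs => lt_of_le_of_ne hs.1 fun (h : s = z) => hzZ (h ▸ hs.2), fun s hs => lt_of_le_of_lt hs hz',
      fun s hs hs0 hsS => (hzS s hsS hs0).not_gt hs, fun s hs hs0 => Or.inr ⟨hs0, hs⟩⟩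
  by_cases hall : ∀ s, 0 ≤ s → s ∈ J
  · exact ⟨univ, univ, ∅, isOpen_univ, isClosed_univ, isCompact_empty, subset_univ _,
      subset_univ _, subset_univ _, fun s _ hs hsS => disjoint_left.1 hSJ hsS (hall s hs),
      fun s _ hs => Or.inl (hall s hs)⟩
  · push Not at hall
    obtain ⟨x, hx0, hxJ⟩ := hall
    rcases (S ∩ Ici 0).eq_empty_or_nonempty with he | hne
    · obtain ⟨z, hz, hzZ⟩ := hJ x hx0 hxJ
      exact key z hz.1 hzZ fun s hs hs0 => (eq_empty_iff_forall_notMem.1 he s ⟨hs, hs0⟩).elim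
    · have hbdd : BddBelow (S ∩ Ici 0) := ⟨0, fun s hs => hs.2⟩
      have hm := (hS.inter isClosed_Ici).csInf_mem hne hbdd
      obtain ⟨z, hz, hzZ⟩ := hJ _ hm.2 (disjoint_left.1 hSJ hm.1)
      exact key z hz.1 hzZ fun s hs hs0 => hz.2.trans (csInf_le hbdd ⟨hs, hs0⟩)

/-- Cuts on both sides, the left one by reflection, separate the component from `S` through gaps of
`Z`. That `O'` exceeds the component only by a compact set is what later makes its image under `e`
closed. -/
lemma exists_isOpen_connectedComponentIn {Z S : Set ℝ} (hS : IsClosed S)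
    (h0 : (0 : ℝ) ∈ Z) (hSJ : Disjoint S (connectedComponentIn Z 0)) :
    ∃ O O' K : Set ℝ, IsOpen O ∧ IsClosed O' ∧ IsCompact K ∧ O ⊆ O' ∧ O' ∩ Z ⊆ O ∧ 0 ∈ O ∧
      Disjoint O S ∧ O' ⊆ connectedComponentIn Z 0 ∪ K := by
  set J := connectedComponentIn Z 0 with hJdef
  have hJ : ∀ s, s ∉ J → ∃ z ∈ uIcc 0 s, z ∉ Z := by
    intro s hs
    by_contra! hz
    exact hs (isPreconnected_uIcc.subset_connectedComponentIn left_mem_uIcc hz right_mem_uIcc)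
  obtain ⟨O₁, O₁', K₁, h1, h2, h3, h4, h5, h6, h7, h8⟩ := exists_isOpen_right hS hSJ
    (fun s hs hsJ => by simpa only [uIcc_of_le hs] using hJ s hsJ) h0
  obtain ⟨O₂, O₂', K₂, g1, g2, g3, g4, g5, g6, g7, g8⟩ := exists_isOpen_right
    (Z := Neg.neg ⁻¹' Z) (J := Neg.neg ⁻¹' J) (hS.preimage continuous_neg)
    (hSJ.preimage _)
    (fun s hs hsJ => by
      obtain ⟨z, hz, hzZ⟩ := hJ (-s) hsJ
      rw [uIcc_of_ge (by linarith)] at hz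
      exact ⟨-z, ⟨by linarith [hz.2], by linarith [hz.1]⟩, by simpa using hzZ⟩) (by simpa using h0)
  refine ⟨O₁ ∩ Neg.neg ⁻¹' O₂, O₁' ∩ Neg.neg ⁻¹' O₂', K₁ ∪ Neg.neg '' K₂,
    h1.inter (g1.preimage continuous_neg), h2.inter (g2.preimage continuous_neg),
    h3.union (g3.image continuous_neg), inter_subset_inter h4 (preimage_mono g4), ?_,
    ⟨h6 self_mem_Iic, g6 (by simp)⟩, ?_, ?_⟩
  · rintro s ⟨⟨hs1, hs2⟩, hs3⟩
    exact ⟨h5 ⟨hs1, hs3⟩, g5 ⟨hs2, by simpa using hs3⟩⟩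
  · rw [disjoint_left]
    rintro s ⟨hs1, hs2⟩ hsS
    rcases le_total 0 s with h | h
    · exact h7 s hs1 h hsS
    · exact g7 (-s) hs2 (by linarith) (by simpa using hsS)
  · rintro s ⟨hs1, hs2⟩
    rcases le_total 0 s with h | h
    · exact (h8 s hs1 h).imp id Or.inl
    · exact (g8 (-s) hs2 (by linarith)).imp (by simp) fun hk => Or.inr ⟨-s, hk, neg_neg s⟩

/-! ### From components of the parameter set to components in the surface. -/

section Development

variable {M : Type*} {f : M → ℍ × ℝ} {e : ℝ × ℝ → M} {C γ : ℝ → ℍ}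

lemma image_image_prod_univ (hfe : ∀ s t, f (e (s, t)) = (C s, t)) {T : Set ℝ}
    (hγC : ∀ s ∈ T, γ s = C s) : f '' (e '' (T ×ˢ univ)) = (γ '' T) ×ˢ univ := by
  ext ⟨z, t⟩
  simp only [mem_image, mem_prod, mem_univ, and_true, Prod.exists]
  constructor
  · rintro ⟨_, ⟨s, t', hs, rfl⟩, h⟩
    rw [hfe, Prod.mk.injEq] at h
    exact ⟨s, hs, (hγC s hs).trans h.1⟩
  · rintro ⟨s, hs, rfl⟩
    exact ⟨_, ⟨s, t, hs, rfl⟩, by rw [hfe, hγC s hs]⟩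

variable [TopologicalSpace M]

lemma isClosed_image_prod_univ {T : Set ℝ} (h : IsProperMap fun x : T × ℝ => e (x.1, x.2)) :
    IsClosed (e '' (T ×ˢ univ)) := by
  convert h.isClosedMap.isClosed_range using 1
  ext q
  simp

/-- Injectivity of `e` is not needed: moving `s` slightly from an interior point keeps the image in
`A`, so a whole interval about `s` lies in `Z`, hence in the same component. -/
lemma interior_image_eq (he : Continuous e) (heo : IsOpenMap e) {A : Set M} {Z : Set ℝ}
    (hA : ∀ s t, e (s, t) ∈ A ↔ s ∈ Z)
    (hsub : e '' (connectedComponentIn Z 0 ×ˢ univ) ⊆ A) :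
    interior (e '' (connectedComponentIn Z 0 ×ˢ univ))
      = e '' (interior (connectedComponentIn Z 0) ×ˢ univ) := by
  refine Subset.antisymm (fun q hq => ?_) (interior_maximal
    (image_mono (prod_mono interior_subset subset_rfl)) (heo _ (isOpen_interior.prod isOpen_univ)))
  obtain ⟨⟨s, t⟩, hs, rfl⟩ := interior_subset hq
  refine ⟨(s, t), ⟨?_, mem_univ _⟩, rfl⟩
  have hopen : IsOpen {s' | e (s', t) ∈ interior (e '' (connectedComponentIn Z 0 ×ˢ univ))} :=
    isOpen_interior.preimage (by fun_prop)
  obtain ⟨δ, hδ, hball⟩ := Metric.isOpen_iff.1 hopen s hq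
  refine mem_interior.2 ⟨Metric.ball s δ, ?_, Metric.isOpen_ball, Metric.mem_ball_self hδ⟩
  rw [connectedComponentIn_eq hs.1]
  exact (convex_ball s δ).isPreconnected.subset_connectedComponentIn (Metric.mem_ball_self hδ)
    fun x hx => (hA x t).1 (hsub (interior_subset (hball hx)))

variable [T2Space M]

/-- Over `T` the composite `f ∘ e` is `γ × id`, a closed embedding; as `M` is Hausdorff, properness
of the composite passes to `e`. -/
lemma isProperMap_restrict_of_isometry (hf : Continuous f) (he : Continuous e)
    (hfe : ∀ s t, f (e (s, t)) = (C s, t)) (hγ : Isometry γ) {T : Set ℝ} (hT : IsClosed T)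
    (hγC : ∀ s ∈ T, γ s = C s) :
    IsClosedEmbedding (fun x : T × ℝ => f (e (x.1, x.2))) ∧
      IsProperMap fun x : T × ℝ => e (x.1, x.2) := by
  have h1 : IsClosedEmbedding (fun x : T × ℝ => f (e (x.1, x.2))) := by
    have : (fun x : T × ℝ => f (e (x.1, x.2)))
        = Prod.map (fun s : T => γ s) (id : ℝ → ℝ) := by
      funext x
      simp [hfe, hγC x.1 x.1.2, Prod.map]
    rw [this]
    exact (hγ.isClosedEmbedding.comp hT.isClosedEmbedding_subtypeVal).prodMap IsClosedEmbedding.id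
  exact ⟨h1, isProperMap_of_comp_of_t2 (by fun_prop) hf h1.isProperMap⟩

/-- The height composed with `e` is the projection `T × ℝ → ℝ`, which is proper for compact `T`. -/
lemma isProperMap_restrict_of_isCompact (hf : Continuous f) (he : Continuous e)
    (hfe : ∀ s t, f (e (s, t)) = (C s, t)) {T : Set ℝ} (hT : IsCompact T) :
    IsProperMap fun x : T × ℝ => e (x.1, x.2) := by
  have := isCompact_iff_compactSpace.1 hT
  refine isProperMap_of_comp_of_t2 (g := fun q => (f q).2) (by fun_prop) (by fun_prop) ?_
  convert isProperMap_snd_of_compactSpace (X := T) (Y := ℝ) using 1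
  funext x
  simp [hfe]

/-- For `q` outside the image of `J × ℝ`, a neighbourhood `O` of `J` is chosen so that the image of
`O × ℝ` is open, misses `q` and is relatively closed in `A`. The component cannot then leave it. -/
lemma connectedComponentIn_eq_image (hf : Continuous f) (he : Continuous e) (heo : IsOpenMap e)
    (hfe : ∀ s t, f (e (s, t)) = (C s, t)) {A : Set M} {Z : Set ℝ} (hZ : IsClosed Z)
    (hA : ∀ s t, e (s, t) ∈ A ↔ s ∈ Z) (h0 : (0 : ℝ) ∈ Z) (t₀ : ℝ) (hγ : Isometry γ)
    (hγC : ∀ s ∈ connectedComponentIn Z 0, γ s = C s) :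
    connectedComponentIn A (e (0, t₀)) = e '' (connectedComponentIn Z 0 ×ˢ univ) := by
  set J := connectedComponentIn Z 0 with hJ
  have hJc : IsClosed J := hZ.connectedComponentIn_of_mem h0
  have hJ0 : (0 : ℝ) ∈ J := mem_connectedComponentIn h0
  have hJZ : J ⊆ Z := connectedComponentIn_subset _ _
  refine Subset.antisymm (fun q hq => ?_) ?_
  · by_contra hqJ
    -- The set `S` consists of the parameters of all preimages of `q`; their height is forced to be
    -- that of `q`.
    obtain ⟨O, O', K, h1, h2, h3, h4, h5, h6, h7, h8⟩ := exists_isOpen_connectedComponentIn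
      (Z := Z) (S := {s | e (s, (f q).2) = q})
      (isClosed_eq (by fun_prop) continuous_const) h0 (by
        rw [disjoint_left]
        exact fun s hs hsJ => hqJ ⟨(s, (f q).2), ⟨hsJ, mem_univ _⟩, hs⟩)
    have hclosed : IsClosed (e '' (O' ×ˢ univ)) := by
      have : O' = (O' ∩ J) ∪ (O' ∩ K) := by
        rw [← inter_union_distrib_left, inter_eq_left.2 h8]
      rw [this, union_prod, image_union]
      exact (isClosed_image_prod_univ (isProperMap_restrict_of_isometry hf he hfe hγ
        (h2.inter hJc) fun s hs => hγC s hs.2).2).union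
        (isClosed_image_prod_univ (isProperMap_restrict_of_isCompact hf he hfe (h3.inter_left h2)))
    have hsub : connectedComponentIn A (e (0, t₀)) ⊆ e '' (O ×ˢ univ) := by
      refine isPreconnected_connectedComponentIn.subset_left_of_subset_union
        (heo _ (h1.prod isOpen_univ)) hclosed.isOpen_compl ?_ (fun x hx => ?_)
        ⟨e (0, t₀), mem_connectedComponentIn ((hA _ _).2 h0), ⟨(0, t₀), ⟨h6, mem_univ _⟩, rfl⟩⟩
      · exact disjoint_compl_right.mono_left (image_mono (prod_mono h4 subset_rfl))
      · by_cases hx' : x ∈ e '' (O' ×ˢ univ)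
        · obtain ⟨⟨s, t⟩, hs, rfl⟩ := hx'
          have := (hA s t).1 (connectedComponentIn_subset _ _ hx)
          exact Or.inl ⟨(s, t), ⟨h5 ⟨hs.1, this⟩, mem_univ _⟩, rfl⟩
        · exact Or.inr hx'
    obtain ⟨⟨s, t⟩, hs, hst⟩ := hsub hq
    refine disjoint_left.1 h7 hs.1 ?_
    have : (f q).2 = t := by rw [← hst, hfe]
    rw [mem_ofPred_eq, this, hst]
  · refine ((isPreconnected_connectedComponentIn.prod isPreconnected_univ).image e
      he.continuousOn).subset_connectedComponentIn ⟨(0, t₀), ⟨hJ0, mem_univ _⟩, rfl⟩ ?_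
    rintro _ ⟨⟨s, t⟩, hs, rfl⟩
    exact (hA s t).2 (hJZ hs.1)

/-- The strip `T × ℝ` surjects onto the image, and its composite with `f` is a closed embedding, so
the restriction of `f` is closed and injective. -/
lemma isEmbedding_domRestrict_image (hf : Continuous f) (he : Continuous e)
    (hfe : ∀ s t, f (e (s, t)) = (C s, t)) (hγ : Isometry γ) {T : Set ℝ} (hT : IsClosed T)
    (hγC : ∀ s ∈ T, γ s = C s) : IsEmbedding ((e '' (T ×ˢ univ)).domRestrict f) := by
  have h1 := (isProperMap_restrict_of_isometry hf he hfe hγ hT hγC).1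
  let φ : T × ℝ → e '' (T ×ˢ univ) := fun x => ⟨e (x.1, x.2), (x.1, x.2), ⟨x.1.2, mem_univ _⟩, rfl⟩
  have hφ : Continuous φ := by fun_prop
  have hφs : Function.Surjective φ := by
    rintro ⟨_, ⟨s, t⟩, hs, rfl⟩
    exact ⟨(⟨s, hs.1⟩, t), rfl⟩
  refine (IsClosedEmbedding.of_continuous_injective_isClosedMap (hf.comp continuous_subtype_val)
    ?_ (IsClosedMap.of_comp_surjective hφs hφ h1.isClosedMap)).isEmbedding
  intro x y hxy
  obtain ⟨x, rfl⟩ := hφs x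
  obtain ⟨y, rfl⟩ := hφs y
  exact congrArg φ (h1.injective hxy)

end Development

end HypProd

end

/-! ### Assembly of the theorem. -/

theorem mainTheorem4 {M : Type*} [MetricSpace M] [ConnectedSpace M] [SecondCountableTopology M]
    [ChartedSpace (EuclideanSpace ℝ (Fin 2)) M] [IsManifold (𝓡 2) ∞ M]
    [Bundle.RiemannianBundle (fun p : M => TangentSpace (𝓡 2) p)]
    [IsRiemannianManifold (𝓡 2) M] [CompleteSpace M]
    (f : M → ℍ × ℝ) (hf : HypProd.IsIsometricImmersion f)
    (hK : ∀ p : M, HypProd.gaussianCurvature p = 0)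
    (hext : ∀ p : M, HypProd.extrinsicCurvature f p = 0)
    (p₀ : M) (hp₀ : p₀ ∈ HypProd.planarPoints f)
    (P₀ : Set M) (hP₀ : P₀ = connectedComponentIn (HypProd.planarPoints f) p₀) :
    ∃ (γ : ℝ → ℍ) (a b : EReal), HypProd.IsUnitSpeedGeodesic γ ∧ a ≤ b ∧
      Topology.IsEmbedding (P₀.domRestrict f) ∧
      f '' interior P₀ = (γ '' {s : ℝ | a < (s : EReal) ∧ (s : EReal) < b}) ×ˢ Set.univ ∧
      f '' frontier P₀ = (γ '' {s : ℝ | (s : EReal) = a ∨ (s : EReal) = b}) ×ˢ Set.univ := by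
  have hcoord : Continuous (HypProd.coord ∘ f) := hf.smooth.continuous
  have hfc : Continuous f :=
    (UpperHalfPlane.isEmbedding_coe.continuous_iff.2 (continuous_fst.comp hcoord)).prodMk
      (continuous_snd.comp hcoord :)
  obtain ⟨e, C, he0, hec, heo, hfe, hCs, hCspeed, hCacc⟩ :=
    HypProd.exists_development (fun p => HypProd.exists_isBox hf hK hext p) hcoord p₀
  set c : ℝ → ℂ := fun s => (C s : ℂ)
  let Z : Set ℝ := {s | HypProd.acc c s = 0}
  have hd1 : ContDiff ℝ ∞ (deriv c) := (contDiff_infty_iff_deriv.1 hCs).2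
  have hd2 : ContDiff ℝ ∞ (deriv (deriv c)) := (contDiff_infty_iff_deriv.1 hd1).2
  have haccC : Continuous (HypProd.acc c) :=
    hd2.continuous.add ((continuous_const.mul (hd1.continuous.pow 2)).div
      (Complex.continuous_ofReal.comp (Complex.continuous_im.comp hCs.continuous))
      fun s => Complex.ofReal_ne_zero.2 (C s).im_pos.ne')
  have hAZ : ∀ s t, e (s, t) ∈ HypProd.planarPoints f ↔ s ∈ Z := hCacc
  have hZ : IsClosed Z := isClosed_eq haccC continuous_const
  have h0 : (0 : ℝ) ∈ Z := (hCacc 0 (f p₀).2).1 (he0.symm ▸ hp₀)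
  have hJpre : IsPreconnected (connectedComponentIn Z 0) := isPreconnected_connectedComponentIn
  have hJc : IsClosed (connectedComponentIn Z 0) := hZ.connectedComponentIn_of_mem h0
  have hJ0 : (0 : ℝ) ∈ connectedComponentIn Z 0 := mem_connectedComponentIn h0
  obtain ⟨γ, hγ, hγi, hγC⟩ := HypProd.exists_geodesic_of_acc_eq_zero hCs hCspeed
    hJpre.ordConnected.convex hJ0 fun s hs => connectedComponentIn_subset Z 0 hs
  obtain ⟨a, b, hab, hint, hfr⟩ := hJpre.ordConnected.exists_ereal_endpoints hJc ⟨0, hJ0⟩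
  have hP := HypProd.connectedComponentIn_eq_image hfc hec heo hfe hZ hAZ h0 (f p₀).2 hγi hγC
  have hsub : e '' (connectedComponentIn Z 0 ×ˢ univ) ⊆ HypProd.planarPoints f :=
    hP ▸ connectedComponentIn_subset _ _
  rw [he0] at hP
  rw [hP] at hP₀
  subst hP₀
  have hproper := (HypProd.isProperMap_restrict_of_isometry hfc hec hfe hγi hJc hγC).2
  -- On `J × ℝ` the map `e` is injective because `f ∘ e = γ × id` is. This lets the frontier, image
  -- minus interior, be computed as the image of `(J \ interior J) × ℝ`.
  have hinj : InjOn e (connectedComponentIn Z 0 ×ˢ univ) := by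
    rintro ⟨s, t⟩ hs ⟨s', t'⟩ hs' h
    have := congrArg f h
    rw [hfe, hfe, Prod.mk.injEq, ← hγC s hs.1, ← hγC s' hs'.1] at this
    exact Prod.ext (hγi.injective this.1) this.2
  refine ⟨γ, a, b, hγ, hab, HypProd.isEmbedding_domRestrict_image hfc hec hfe hγi hJc hγC, ?_, ?_⟩
  · rw [HypProd.interior_image_eq hec heo hAZ hsub,
      HypProd.image_image_prod_univ hfe fun s hs => hγC s (interior_subset hs), hint]
  · rw [(HypProd.isClosed_image_prod_univ hproper).frontier_eq,
      HypProd.interior_image_eq hec heo hAZ hsub,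
      ← hinj.image_sdiff_subset (prod_mono interior_subset subset_rfl), prod_sdiff_prod,
      Set.sdiff_self, prod_empty, empty_union,
      HypProd.image_image_prod_univ hfe fun s hs => hγC s hs.1, hfr]
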